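/- **Theorem (Filtering compactness for Navier–Stokes).** *Setting.* Let $d,N\in\mathbb{N}$, $T>0$, and let $\Gamma\in\mathbb{R}^{d\times d}$ be symmetric positive definite. Write $|y|_\Gamma=\langle y,\Gamma^{-1}y\rangle^{1/2}$ on $\mathbb{R}^d$ and $|\boldsymbol y|_\Gamma=(\sum_{j=1}^N|y_j|_\Gamma^2)^{1/2}$ for $\boldsymbol y=(y_1,\dots,y_N)\in\mathbb{R}^{d\times N}$. Let $\rho>0$ be a probability density on $\mathbb{R}^d$ that is bounded, Lipschitz continuous with respect to $|\cdot|_\Gamma$, and satisfies $\rho(y)\ge \frac1c\exp(-\frac12|y|_\Gamma^2)$ for some $c>0$. Let $L^2_x=L^2(\mathbb{T}^n;\mathbb{R}^n)$, where $\mathbb{T}^n$ is the $2\pi$-periodic torus, and let $0=t_0<t_1<\dots<t_N=T$. Let the observables $\mathcal{G}_j:L^1([0,T];L^2_x)\to\mathbb{R}^d$, $j=1,\dots,N$, satisfy $$|\mathcal{G}_j(u)-\mathcal{G}_j(u')|\le L_{\mathcal G}\int_{t_{j-1}}^{t_j}\|u-u'\|_{L^2_x}\,dt\quad\text{for all } u,u',\qquad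 |\mathcal{G}_j(0)|\le g_0 .$$ Let $\mu_{\mathrm{prior}}$ be a Borel probability measure on $L^2_x$, concentrated on divergence-free fields, with $\mu_{\mathrm{prior}}(\|\bar u\|_{L^2_x}\le M)=1$ for some $M>0$. Let $\nu>0$ and, for each $\Delta>0$, let $\mathcal{S}^\Delta:[0,T]\times L^2_x\to L^2_x$, $(t,\bar u)\mapsto\mathcal S^\Delta_t(\bar u)$, be Borel measurable such that for all divergence-free $\bar u\in L^2_x$ and all $\Delta>0$: - ($\Delta$.1) $\|\mathcal S^\Delta_t(\bar u)\|_{L^2_x}\le\|\bar u\|_{L^2_x}$ for all $t\in[0,T]$; - ($\Delta$.2) $\int_0^T\|\nabla\mathcal S^\Delta_t(\bar u)\|_{L^2_x}^2\,dt\le\nu^{-1}\|\bar u\|_{L^2_x}^2$; - ($\Delta$.3) $\|\mathcal S^\Delta_t(\bar u)-\mathcal S^\Delta_s(\bar u)\|_{H^{-L}_x}\le c(\|\bar u\|_{L^2_x})\,|t-s|$ for all $s,t\in[0,T]$, with some $L>0$ and some function $c$, both independent of $\Delta$. For $\boldsymbol y\in\mathbb{R}^{d\times N}$ and $t\in[0,T]$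 let $$\nu^{\Delta,\boldsymbol y}_t=\mathcal S^\Delta_{t,\#}\mu^{\Delta,\boldsymbol y}_{(t)},\qquad \mu^{\Delta,\boldsymbol y}_{(t)}(d\bar u)=\frac1{Z}\prod_{j:\,t_j\le t}\rho\big(y_j-\mathcal G_j(\mathcal S^\Delta(\bar u))\big)\,\mu_{\mathrm{prior}}(d\bar u),$$ with $Z$ the normalization constant; this is the filtering distribution, i.e. the law of $\mathcal S^\Delta_t(\bar u)$ given the measurements $y_j=\mathcal G_j(\mathcal S^\Delta(\bar u))+\eta_j$ with $t_j\le t$, where $\bar u\sim\mu_{\mathrm{prior}}$ and the $\eta_j\sim\rho(y)\,dy$ are i.i.d. and independent of $\bar u$. Let $W_1$ be the $1$-Wasserstein distance on the set $\mathcal P_1(L^2_x)$ of Borel probability measures with finite first moment, and let $L^1_t(\mathcal P)$ be the space of weak-$*$ measurable maps $t\mapsto\nu_t\in\mathcal P_1(L^2_x)$ on $[0,T]$ with $\int_0^T\int\|u\|_{L^2_x}\,\nu_t(du)\,dt<\infty$, with metric $d_T(\nu_t,\nu_t')=\int_0^TW_1(\nu_t,\nu'_t)\,dt$. *Claim.*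 For all $R,M>0$ there is a constant $C=C(R,M)>0$, depending only on $R$, $M$, $N$, the noise ($\rho$ and $\Gamma$) and, through the observables, on $T$, $L_{\mathcal G}$ and $g_0$ (in particular independent of $n$, $\nu$, $\Delta$, the times $t_j$, the particular observables, prior and solution operators), such that the following hold. 1. $\boldsymbol y\mapsto\nu^{\Delta,\boldsymbol y}_t$ belongs to $C_{\mathrm{loc}}(\mathbb{R}^{d\times N};L^1_t(\mathcal P))$ for each $\Delta>0$, and $\{\nu^{\Delta,\boldsymbol y}_t:\Delta>0\}$ is pre-compact in this space. 2. For all $R>0$, $\Delta>0$, $t\in[0,T]$ and all $\boldsymbol y,\boldsymbol y'$ with $|\boldsymbol y|_\Gamma,|\boldsymbol y'|_\Gamma\le R$, $$W_1(\nu^{\Delta,\boldsymbol y}_t,\nu^{\Delta,\boldsymbol y'}_t)\le C\,|\boldsymbol y-\boldsymbol y'|_\Gamma .$$ 3. Every sequence $\Delta_k\to0$ of positive numbers has a subsequence (not relabelled) for which there is $\nu^{*,\boldsymbol y}_t\in C_{\mathrm{loc}}(\mathbb{R}^{d\times N};L^1_t(\mathcal P))$ such that, for all $R>0$, $$\sup_{|\boldsymbol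 y|_\Gamma\le R}\int_0^TW_1(\nu^{\Delta_k,\boldsymbol y}_t,\nu^{*,\boldsymbol y}_t)\,dt\to0 .$$ 4. Any limit $\nu^{*,\boldsymbol y}_t$ in this sense along any sequence $\Delta_k\to0$ satisfies, after modification for each $\boldsymbol y$ on a null set of times $t$, the estimate of item 2 for all $R>0$ and all $t\in[0,T]$, with the same constant $C$. -/

import Mathlib

open MeasureTheory ProbabilityTheory Set Filter Topology
open scoped ENNReal NNReal BoundedContinuousFunction Matrix


noncomputable section

namespace FilteringNS

section Wasserstein
variable {X : Type*} [NormedAddCommGroup X] [MeasurableSpace X]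

/-- `π` is a coupling of `μ` and `ν`. -/
def IsCoupling (π : Measure (X × X)) (μ ν : Measure X) : Prop :=
  π.map Prod.fst = μ ∧ π.map Prod.snd = ν

/-- The `1`-Wasserstein distance `inf_π ∫ ‖u - v‖ π(du, dv)` over all couplings `π`. -/
def W₁ (μ ν : Measure X) : ℝ≥0∞ :=
  ⨅ (π : Measure (X × X)) (_ : IsCoupling π μ ν), ∫⁻ p, edist p.1 p.2 ∂π

theorem IsCoupling.W₁_le {π : Measure (X × X)} {μ ν : Measure X} (h : IsCoupling π μ ν) :
    W₁ μ ν ≤ ∫⁻ p, edist p.1 p.2 ∂π := iInf₂_le π h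

variable [BorelSpace X] [SecondCountableTopology X]

theorem W₁_self (μ : Measure X) : W₁ μ μ = 0 := by
  have hm : Measurable fun x : X => (x, x) := by fun_prop
  have h : IsCoupling (μ.map fun x => (x, x)) μ μ := by
    constructor
    · rw [Measure.map_map measurable_fst hm]; exact Measure.map_id
    · rw [Measure.map_map measurable_snd hm]; exact Measure.map_id
  refine le_antisymm (h.W₁_le.trans ?_) bot_le
  rw [lintegral_map (by fun_prop) hm]
  simp

theorem W₁_comm_le (μ ν : Measure X) : W₁ μ ν ≤ W₁ ν μ := by
  refine le_iInf₂ fun π h => ?_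
  have h' : IsCoupling (π.map Prod.swap) μ ν := by
    constructor
    · rw [Measure.map_map measurable_fst measurable_swap]; exact h.2
    · rw [Measure.map_map measurable_snd measurable_swap]; exact h.1
  refine h'.W₁_le.trans ?_
  rw [lintegral_map (by fun_prop) measurable_swap]
  simp [edist_comm]

theorem W₁_comm (μ ν : Measure X) : W₁ μ ν = W₁ ν μ :=
  le_antisymm (W₁_comm_le μ ν) (W₁_comm_le ν μ)

/-- Triangle inequality, by gluing couplings along their common marginal. -/
theorem W₁_triangle [CompleteSpace X] (μ₁ μ₂ μ₃ : Measure X) [IsProbabilityMeasure μ₁]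
    [IsProbabilityMeasure μ₂] : W₁ μ₁ μ₃ ≤ W₁ μ₁ μ₂ + W₁ μ₂ μ₃ := by
  unfold W₁
  rw [ENNReal.iInf_add]
  refine le_iInf fun π => ?_
  rw [ENNReal.iInf_add]
  refine le_iInf fun h => ?_
  rw [ENNReal.add_iInf]
  refine le_iInf fun π' => ?_
  rw [ENNReal.add_iInf]
  refine le_iInf fun h' => ?_
  have : IsProbabilityMeasure (π.map Prod.fst) := by rw [h.1]; infer_instance
  have hπ : IsProbabilityMeasure π := Measure.isProbabilityMeasure_of_map (f := Prod.fst)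
  have : IsProbabilityMeasure (π'.map Prod.fst) := by rw [h'.1]; infer_instance
  have hπ' : IsProbabilityMeasure π' := Measure.isProbabilityMeasure_of_map (f := Prod.fst)
  set σ := π.map Prod.swap with hσ
  have : IsProbabilityMeasure σ := Measure.isProbabilityMeasure_map (by fun_prop)
  have hσ1 : σ.fst = μ₂ := by
    rw [Measure.fst, hσ, Measure.map_map measurable_fst measurable_swap]; exact h.2
  have hσ2 : σ.snd = μ₁ := by
    rw [Measure.snd, hσ, Measure.map_map measurable_snd measurable_swap]; exact h.1
  have hπ'1 : π'.fst = μ₂ := h'.1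
  have hπ'2 : π'.snd = μ₃ := h'.2
  have d1 : μ₂ ⊗ₘ σ.condKernel = σ := by rw [← hσ1]; exact σ.disintegrate _
  have d2 : μ₂ ⊗ₘ π'.condKernel = π' := by rw [← hπ'1]; exact π'.disintegrate _
  set κ := σ.condKernel
  set η := π'.condKernel
  have hc : IsCoupling (μ₂.bind (κ ×ₖ η)) μ₁ μ₃ := by
    constructor
    · rw [Measure.map_comp _ _ measurable_fst, ← Kernel.fst_eq, Kernel.fst_prod,
        ← Measure.snd_compProd, d1, hσ2]
    · rw [Measure.map_comp _ _ measurable_snd, ← Kernel.snd_eq, Kernel.snd_prod,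
        ← Measure.snd_compProd, d2, hπ'2]
  refine hc.W₁_le.trans ?_
  have e1 : ∫⁻ p, edist p.1 p.2 ∂π = ∫⁻ y, ∫⁻ a, edist a y ∂(κ y) ∂μ₂ := by
    have : ∫⁻ p, edist p.1 p.2 ∂π = ∫⁻ p, edist p.2 p.1 ∂σ := by
      rw [hσ, lintegral_map (by fun_prop) measurable_swap]; rfl
    rw [this, ← d1, Measure.lintegral_compProd (by fun_prop)]
  have e2 : ∫⁻ p, edist p.1 p.2 ∂π' = ∫⁻ y, ∫⁻ b, edist y b ∂(η y) ∂μ₂ := by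
    rw [← d2, Measure.lintegral_compProd (by fun_prop)]
  rw [e1, e2, Measure.lintegral_bind (Kernel.aemeasurable _) (by fun_prop),
    ← lintegral_add_left]
  · refine lintegral_mono fun y => ?_
    rw [Kernel.prod_apply, lintegral_prod _ (by fun_prop)]
    calc ∫⁻ a, ∫⁻ b, edist a b ∂(η y) ∂(κ y)
        ≤ ∫⁻ a, ∫⁻ b, (edist a y + edist y b) ∂(η y) ∂(κ y) :=
          lintegral_mono fun a => lintegral_mono fun b => edist_triangle _ _ _
      _ = _ := by
          simp only [lintegral_add_left measurable_const, lintegral_const, measure_univ, mul_one]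
          rw [lintegral_add_left (by fun_prop)]
          simp
  · exact Measurable.lintegral_kernel_prod_right' (f := fun p : X × X => edist p.2 p.1)
      (by fun_prop)

/-- Mass common to both measures need not be moved. -/
theorem W₁_add_le (m p q : Measure X) [IsFiniteMeasure m] [IsFiniteMeasure p] [IsFiniteMeasure q]
    (h : p univ = q univ) (D : ℝ≥0∞) (hD : ∀ᵐ x ∂p, ∀ᵐ y ∂q, edist x y ≤ D) :
    W₁ (m + p) (m + q) ≤ D * q univ := by
  rcases eq_or_ne (p univ) 0 with h0 | h0
  · have hp : p = 0 := by simpa using h0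
    have hq : q = 0 := by simpa [hp] using h.symm
    subst hp hq
    simp [W₁_self]
  have hm : Measurable fun x : X => (x, x) := by fun_prop
  have hT : p univ ≠ ⊤ := measure_ne_top _ _
  have hc : IsCoupling (m.map (fun x => (x, x)) + (p univ)⁻¹ • p.prod q) (m + p) (m + q) := by
    constructor
    · rw [Measure.map_add _ _ measurable_fst, Measure.map_map measurable_fst hm,
        Measure.map_smul, Measure.map_fst_prod, ← h, smul_smul, ENNReal.inv_mul_cancel h0 hT,
        one_smul]
      congr 1; exact Measure.map_id
    · rw [Measure.map_add _ _ measurable_snd, Measure.map_map measurable_snd hm,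
        Measure.map_smul, Measure.map_snd_prod, smul_smul, ENNReal.inv_mul_cancel h0 hT,
        one_smul]
      congr 1; exact Measure.map_id
  refine hc.W₁_le.trans ?_
  rw [lintegral_add_measure, lintegral_map (by fun_prop) hm, lintegral_smul_measure,
    lintegral_prod _ (by fun_prop)]
  simp only [edist_self, lintegral_zero, zero_add]
  calc (p univ)⁻¹ • ∫⁻ x, ∫⁻ y, edist x y ∂q ∂p
      ≤ (p univ)⁻¹ • ∫⁻ x, ∫⁻ y, D ∂q ∂p := by
        gcongr ?_ • ?_
        refine lintegral_mono_ae ?_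
        filter_upwards [hD] with x hx
        exact lintegral_mono_ae hx
    _ = D * q univ := by
        simp only [lintegral_const, smul_eq_mul]
        rw [mul_comm (D * q univ), ← mul_assoc, ENNReal.inv_mul_cancel h0 hT, one_mul]

theorem W₁_map_le (μ : Measure X) {f : X → X} (hf : Measurable f) :
    W₁ μ (μ.map f) ≤ ∫⁻ x, edist x (f x) ∂μ := by
  have hm : Measurable fun x : X => (x, f x) := by fun_prop
  have h : IsCoupling (μ.map fun x => (x, f x)) μ (μ.map f) := by
    constructor
    · rw [Measure.map_map measurable_fst hm]; exact Measure.map_id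
    · rw [Measure.map_map measurable_snd hm]; rfl
  refine h.W₁_le.trans_eq ?_
  rw [lintegral_map (by fun_prop) hm]

/-- The finitely supported measure with weights `w` at the points `e`. -/
def atomic {m : ℕ} (e : Fin m → X) (w : Fin m → ℝ) : Measure X :=
  ∑ i, ENNReal.ofReal (w i) • Measure.dirac (e i)

instance {m : ℕ} (e : Fin m → X) (w : Fin m → ℝ) : IsFiniteMeasure (atomic e w) := by
  constructor
  simp [atomic, ENNReal.sum_lt_top]

theorem atomic_univ {m : ℕ} (e : Fin m → X) (w : Fin m → ℝ) :
    atomic e w univ = ∑ i, ENNReal.ofReal (w i) := by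
  simp [atomic]

theorem isProbabilityMeasure_atomic {m : ℕ} (e : Fin m → X) {w : Fin m → ℝ}
    (hw : w ∈ stdSimplex ℝ (Fin m)) : IsProbabilityMeasure (atomic e w) := by
  constructor
  rw [atomic_univ, ← ENNReal.ofReal_sum_of_nonneg fun i _ => hw.1 i, hw.2, ENNReal.ofReal_one]

theorem ae_atomic {m : ℕ} (e : Fin m → X) (w : Fin m → ℝ) {s : X → Prop}
    (h : ∀ i, s (e i)) : ∀ᵐ x ∂(atomic e w), s x := by
  have hz : ∀ᵐ x ∂(atomic e w), x ∈ range e := by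
    rw [ae_iff]
    simp [atomic]
  filter_upwards [hz] with x hx
  obtain ⟨i, rfl⟩ := hx
  exact h i

theorem W₁_atomic_le {m : ℕ} (e : Fin m → X) (D : ℝ≥0∞) (hD : ∀ i j, edist (e i) (e j) ≤ D)
    {w w' : Fin m → ℝ} (hw : w ∈ stdSimplex ℝ (Fin m)) (hw' : w' ∈ stdSimplex ℝ (Fin m)) :
    W₁ (atomic e w) (atomic e w') ≤ D * m * edist w w' := by
  set a : Fin m → ℝ := fun i => min (w i) (w' i) with ha
  have hsplit : ∀ v : Fin m → ℝ, (∀ i, a i ≤ v i) →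
      atomic e v = atomic e a + atomic e (v - a) := by
    intro v hv
    simp only [atomic, ← Finset.sum_add_distrib, ← add_smul]
    refine Finset.sum_congr rfl fun i _ => ?_
    rw [← ENNReal.ofReal_add (le_min (hw.1 i) (hw'.1 i)) (by simpa using hv i)]
    simp [ha]
  have h1 : ∀ v ∈ stdSimplex ℝ (Fin m), (∀ i, a i ≤ v i) →
      atomic e (v - a) univ = ENNReal.ofReal (1 - ∑ i, a i) := by
    intro v hv hav
    rw [atomic_univ, ← ENNReal.ofReal_sum_of_nonneg (fun i _ => by simpa using hav i)]
    simp [Finset.sum_sub_distrib, hv.2]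
  have l1 : ∀ i, a i ≤ w i := fun i => min_le_left _ _
  have l2 : ∀ i, a i ≤ w' i := fun i => min_le_right _ _
  rw [hsplit w l1, hsplit w' l2]
  refine (W₁_add_le _ _ _ (by rw [h1 w hw l1, h1 w' hw' l2]) D
    (ae_atomic _ _ fun i => ae_atomic _ _ fun j => hD i j)).trans ?_
  rw [mul_assoc]
  gcongr
  rw [atomic_univ]
  calc ∑ i, ENNReal.ofReal ((w' - a) i) ≤ ∑ _i : Fin m, edist w w' := by
        refine Finset.sum_le_sum fun i _ => le_trans ?_ (edist_le_pi_edist w w' i)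
        rw [edist_dist, Real.dist_eq]
        refine ENNReal.ofReal_le_ofReal ?_
        simp only [ha, Pi.sub_apply]
        rcases le_total (w i) (w' i) with h | h
        · rw [min_eq_left h, abs_sub_comm]; exact le_abs_self _
        · rw [min_eq_right h]; simp
    _ = _ := by simp

theorem continuous_W₁_atomic [CompleteSpace X] {m : ℕ} (e : Fin m → X) :
    Continuous fun p : stdSimplex ℝ (Fin m) × stdSimplex ℝ (Fin m) =>
      W₁ (atomic e p.1) (atomic e p.2) := by
  obtain ⟨D, hDt, hD⟩ : ∃ D : ℝ≥0∞, D ≠ ⊤ ∧ ∀ i j, edist (e i) (e j) ≤ D :=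
    ⟨∑ i, ∑ j, edist (e i) (e j),
      ENNReal.sum_ne_top.2 fun i _ => ENNReal.sum_ne_top.2 fun j _ => edist_ne_top _ _,
      fun i j => (Finset.single_le_sum (f := fun j => edist (e i) (e j))
        (fun _ _ => zero_le) (Finset.mem_univ j)).trans
        (Finset.single_le_sum (f := fun i => ∑ j, edist (e i) (e j))
        (fun _ _ => zero_le) (Finset.mem_univ i))⟩
  refine continuous_of_le_add_edist (2 * (D * m))
    (ENNReal.mul_ne_top (by simp) (ENNReal.mul_ne_top hDt (by simp))) ?_
  rintro ⟨p, p'⟩ ⟨q, q'⟩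
  have := isProbabilityMeasure_atomic e p.2
  have := isProbabilityMeasure_atomic e p'.2
  have := isProbabilityMeasure_atomic e q.2
  have := isProbabilityMeasure_atomic e q'.2
  calc W₁ (atomic e p) (atomic e p')
      ≤ W₁ (atomic e p) (atomic e q) +
          (W₁ (atomic e q) (atomic e q') + W₁ (atomic e q') (atomic e p')) :=
        (W₁_triangle _ (atomic e q) _).trans
          (add_le_add le_rfl (W₁_triangle _ (atomic e q') _))
    _ ≤ D * m * edist (p, p') (q, q') +
          (W₁ (atomic e q) (atomic e q') + D * m * edist (p, p') (q, q')) := by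
        gcongr
        · exact (W₁_atomic_le e D hD p.2 q.2).trans
            (mul_le_mul_right (le_max_left _ _) _)
        · refine (W₁_atomic_le e D hD q'.2 p'.2).trans (mul_le_mul_right ?_ _)
          rw [edist_comm]; exact le_max_right (edist p q) (edist p' q')
    _ = _ := by ring

/-- `W₁` is measurable along measurable families of measures with finite first moment. -/
theorem measurable_W₁ [CompleteSpace X] {α : Type*} [MeasurableSpace α] {a b : α → Measure X}
    [∀ t, IsProbabilityMeasure (a t)] [∀ t, IsProbabilityMeasure (b t)]
    (ha : Measurable a) (hb : Measurable b) (ha1 : ∀ t, ∫⁻ u, ‖u‖ₑ ∂(a t) < ∞)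
    (hb1 : ∀ t, ∫⁻ u, ‖u‖ₑ ∂(b t) < ∞) : Measurable fun t => W₁ (a t) (b t) := by
  set e : ℕ → X := TopologicalSpace.denseSeq X
  set P : ℕ → SimpleFunc X X := SimpleFunc.nearestPt e
  set J : ℕ → SimpleFunc X ℕ := SimpleFunc.nearestPtInd e
  -- the discretized measures
  have hdisc : ∀ (n : ℕ) (μ : Measure X) [IsProbabilityMeasure μ],
      μ.map (P n) = atomic (fun i : Fin (n + 1) => e i) (fun i => μ.real (J n ⁻¹' {(i : ℕ)})) := by
    intro n μ _
    ext s hs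
    rw [Measure.map_apply (P n).measurable hs]
    have hU : P n ⁻¹' s = ⋃ i : Fin (n + 1), (J n ⁻¹' {(i : ℕ)} ∩ {_x | e i ∈ s}) := by
      ext x
      simp only [mem_preimage, mem_iUnion, mem_inter_iff, mem_singleton_iff, mem_ofPred_eq]
      have hx : P n x = e (J n x) := rfl
      rw [hx]
      constructor
      · intro h
        exact ⟨⟨J n x, Nat.lt_succ_of_le (SimpleFunc.nearestPtInd_le e n x)⟩, rfl, h⟩
      · rintro ⟨i, hi, h⟩
        rwa [hi]
    rw [hU, measure_iUnion]
    · simp only [atomic, Measure.coe_finsetSum, Finset.sum_apply, Measure.smul_apply,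
        tsum_fintype, smul_eq_mul, Measure.dirac_apply' _ hs]
      refine Finset.sum_congr rfl fun i _ => ?_
      rw [ofReal_measureReal]
      by_cases h : e i ∈ s <;> simp [h]
    · intro i j hij
      refine Disjoint.mono inter_subset_left inter_subset_left ?_
      rw [disjoint_left]
      rintro x (hx : J n x = i) (hx' : J n x = j)
      exact hij (Fin.ext (hx ▸ hx'))
    · intro i
      exact ((J n).measurableSet_preimage _).inter (MeasurableSet.const _)
  have hsimp : ∀ (n : ℕ) (μ : Measure X) [IsProbabilityMeasure μ],
      (fun i : Fin (n + 1) => μ.real (J n ⁻¹' {(i : ℕ)})) ∈ stdSimplex ℝ (Fin (n + 1)) := by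
    intro n μ _
    refine ⟨fun i => measureReal_nonneg, ?_⟩
    have h1 : IsProbabilityMeasure (μ.map (P n)) :=
      Measure.isProbabilityMeasure_map (P n).measurable.aemeasurable
    have h2 := h1.measure_univ
    rw [hdisc, atomic_univ, ← ENNReal.ofReal_sum_of_nonneg fun i _ => measureReal_nonneg] at h2
    simpa using h2
  have hmeas : ∀ n, Measurable fun t => W₁ ((a t).map (P n)) ((b t).map (P n)) := by
    intro n
    have hw : ∀ {c : α → Measure X} [∀ t, IsProbabilityMeasure (c t)], Measurable c →
        Measurable fun t => (⟨_, hsimp n (c t)⟩ : stdSimplex ℝ (Fin (n + 1))) := by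
      intro c _ hc
      refine Measurable.subtype_mk (measurable_pi_lambda _ fun i => ?_)
      exact (Measure.measurable_coe ((J n).measurableSet_preimage _)).ennreal_toReal.comp hc
    have := (continuous_W₁_atomic (fun i : Fin (n + 1) => e i)).measurable.comp
      ((hw ha).prodMk (hw hb))
    refine (congrArg Measurable (funext fun t => ?_)).mp this
    simp only [Function.comp_apply, hdisc]
    rfl
  -- the discretization error
  have herr : ∀ {c : α → Measure X} [∀ t, IsProbabilityMeasure (c t)] (t : α),
      ∫⁻ u, ‖u‖ₑ ∂(c t) < ∞ →
      Tendsto (fun n => ∫⁻ x, edist x (P n x) ∂(c t)) atTop (𝓝 0) := by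
    intro c _ t hc
    have h0 : ∫⁻ _x, (0 : ℝ≥0∞) ∂(c t) = 0 := by simp
    rw [← h0]
    refine tendsto_lintegral_of_dominated_convergence (fun x => ‖e 0‖ₑ + ‖x‖ₑ)
      (fun n => measurable_id.edist (P n).measurable) (fun n => ae_of_all _ fun x => ?_) ?_
      (ae_of_all _ fun x => ?_)
    · change edist x (P n x) ≤ _
      rw [edist_comm]
      refine (SimpleFunc.edist_nearestPt_le e x (Nat.zero_le n)).trans ?_
      rw [edist_eq_enorm_sub]
      exact enorm_sub_le
    · rw [lintegral_add_left measurable_const]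
      simp [hc.ne]
    · have h1 : Tendsto (fun n => P n x) atTop (𝓝 x) :=
        SimpleFunc.tendsto_nearestPt (TopologicalSpace.denseRange_denseSeq X x)
      simpa using (tendsto_const_nhds (x := x)).edist h1
  refine measurable_of_tendsto_metrizable hmeas (tendsto_pi_nhds.2 fun t => ?_)
  set δ : ℕ → ℝ≥0∞ := fun n =>
    ∫⁻ x, edist x (P n x) ∂(a t) + ∫⁻ x, edist x (P n x) ∂(b t)
  have hδ : Tendsto δ atTop (𝓝 0) := by
    simpa using (herr t (ha1 t)).add (herr t (hb1 t))
  have hP : ∀ n (μ : Measure X) [IsProbabilityMeasure μ], IsProbabilityMeasure (μ.map (P n)) :=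
    fun n μ _ => Measure.isProbabilityMeasure_map (P n).measurable.aemeasurable
  have hup : ∀ n, W₁ ((a t).map (P n)) ((b t).map (P n)) ≤ W₁ (a t) (b t) + δ n := by
    intro n
    have := hP n (a t)
    calc _ ≤ W₁ ((a t).map (P n)) (a t) + (W₁ (a t) (b t) + W₁ (b t) ((b t).map (P n))) :=
          (W₁_triangle _ (a t) _).trans (add_le_add le_rfl (W₁_triangle _ (b t) _))
      _ ≤ ∫⁻ x, edist x (P n x) ∂(a t) +
          (W₁ (a t) (b t) + ∫⁻ x, edist x (P n x) ∂(b t)) := by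
          rw [W₁_comm]
          gcongr <;> exact W₁_map_le _ (P n).measurable
      _ = _ := by simp only [δ]; ring
  have hlow : ∀ n, W₁ (a t) (b t) ≤ W₁ ((a t).map (P n)) ((b t).map (P n)) + δ n := by
    intro n
    have := hP n (a t)
    have := hP n (b t)
    calc _ ≤ W₁ (a t) ((a t).map (P n)) +
          (W₁ ((a t).map (P n)) ((b t).map (P n)) + W₁ ((b t).map (P n)) (b t)) :=
          (W₁_triangle _ ((a t).map (P n)) _).trans
            (add_le_add le_rfl (W₁_triangle _ ((b t).map (P n)) _))
      _ ≤ ∫⁻ x, edist x (P n x) ∂(a t) +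
          (W₁ ((a t).map (P n)) ((b t).map (P n)) + ∫⁻ x, edist x (P n x) ∂(b t)) := by
          rw [W₁_comm _ (b t)]
          gcongr <;> exact W₁_map_le _ (P n).measurable
      _ = _ := by simp only [δ]; ring
  refine tendsto_of_tendsto_of_tendsto_of_le_of_le (g := fun n => W₁ (a t) (b t) - δ n)
    (h := fun n => W₁ (a t) (b t) + δ n) ?_ ?_ (fun n => tsub_le_iff_right.2 (hlow n)) hup
  · simpa using ENNReal.Tendsto.sub (tendsto_const_nhds (x := W₁ (a t) (b t))) hδ (by simp)
  · simpa using tendsto_const_nhds.add hδ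

end Wasserstein
section TimeParametrized

/-- The time interval `[0,T]`. -/
abbrev Time (T : ℝ) : Type := Set.Icc (0 : ℝ) T

/-- Lebesgue measure on `[0,T]`. -/
def lebT (T : ℝ) : Measure (Time T) := Measure.comap Subtype.val volume

/-- The space `L¹_t([0,T]; 𝒫₁(X))` of weak-* measurable maps `t ↦ ν_t` into the Borel probability
measures with finite first moment, with `∫₀ᵀ ∫ ‖u‖ ν_t(du) dt < ∞`. -/
structure L1P (T : ℝ) (X : Type*) [NormedAddCommGroup X] [MeasurableSpace X] where
  meas : Time T → Measure X
  prob : ∀ t, IsProbabilityMeasure (meas t)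
  moment : ∀ t, ∫⁻ u, ‖u‖ₑ ∂(meas t) < ∞
  weakMeasurable : ∀ Φ : X →ᵇ ℝ, Measurable fun t => ∫ u, Φ u ∂(meas t)
  integrable : ∫⁻ t, ∫⁻ u, ‖u‖ₑ ∂(meas t) ∂(lebT T) < ∞

variable {T : ℝ} {X : Type*} [NormedAddCommGroup X] [MeasurableSpace X]

instance (ν : L1P T X) (t : Time T) : IsProbabilityMeasure (ν.meas t) := ν.prob t

variable [BorelSpace X]

theorem L1P.measurable_meas (ν : L1P T X) : Measurable ν.meas := by
  have hgen : (inferInstance : MeasurableSpace X) =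
      MeasurableSpace.generateFrom {s : Set X | IsClosed s} := by
    rw [← borel_eq_generateFrom_isClosed]; exact BorelSpace.measurable_eq
  refine Measurable.measure_of_isPiSystem_of_isProbabilityMeasure hgen isPiSystem_isClosed ?_
  intro F hF
  have hpos : ∀ n : ℕ, (0 : ℝ) < 1 / ((n : ℝ) + 1) := fun n => Nat.one_div_pos_of_nat
  have hlim : Tendsto (fun n : ℕ => 1 / ((n : ℝ) + 1)) atTop (𝓝 0) :=
    tendsto_one_div_add_atTop_nhds_zero_nat
  refine measurable_of_tendsto_metrizable
    (f := fun n t => ∫⁻ u, (thickenedIndicator (hpos n) F u : ℝ≥0∞) ∂(ν.meas t)) (fun n => ?_)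
    (tendsto_pi_nhds.2 fun t =>
      tendsto_lintegral_thickenedIndicator_of_isClosed (ν.meas t) hF hpos hlim)
  set g := thickenedIndicator (hpos n) F
  have h1 := (ν.weakMeasurable (BoundedContinuousFunction.ofNormedAddCommGroup
    (fun u => (g u : ℝ)) (NNReal.continuous_coe.comp g.continuous) 1 fun u => by
      rw [Real.norm_of_nonneg (g u).coe_nonneg]
      exact NNReal.coe_le_one.2 (thickenedIndicator_le_one (hpos n) F u))).ennreal_ofReal
  refine (congrArg Measurable (funext fun t => ?_)).mp h1
  change ENNReal.ofReal (∫ u, (g u : ℝ) ∂(ν.meas t)) = _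
  rw [← BoundedContinuousFunction.toReal_lintegral_coe_eq_integral, ENNReal.ofReal_toReal]
  exact (BoundedContinuousFunction.lintegral_lt_top_of_nnreal (ν.meas t) g).ne

/-- The metric `d_T(ν, ν') = ∫₀ᵀ W₁(ν_t, ν'_t) dt` (elements that agree for almost every `t` are at
distance zero). -/
instance [SecondCountableTopology X] [CompleteSpace X] : PseudoEMetricSpace (L1P T X) where
  edist ν ν' := ∫⁻ t, W₁ (ν.meas t) (ν'.meas t) ∂(lebT T)
  edist_self ν := by simp [W₁_self]
  edist_comm ν ν' := by simp only [W₁_comm]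
  edist_triangle ν₁ ν₂ ν₃ := by
    rw [← lintegral_add_left
      (measurable_W₁ ν₁.measurable_meas ν₂.measurable_meas ν₁.moment ν₂.moment)]
    exact lintegral_mono fun t => W₁_triangle _ _ _

end TimeParametrized

section Torus

instance : Fact (0 < 2 * Real.pi) := ⟨Real.two_pi_pos⟩

/-- The `2π`-periodic torus `𝕋ⁿ = (ℝ / 2πℤ)ⁿ`, carrying Lebesgue measure (total mass `(2π)ⁿ`). -/
abbrev Torus (n : ℕ) : Type := Fin n → AddCircle (2 * Real.pi)

/-- `L²_x = L²(𝕋ⁿ; ℝⁿ)`. -/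
abbrev L2x (n : ℕ) : Type := Lp (EuclideanSpace ℝ (Fin n)) 2 (volume : Measure (Torus n))

instance : Fact ((2 : ℝ≥0∞) ≠ ∞) := ⟨by simp⟩

instance (n : ℕ) : MeasurableSpace (L2x n) := borel _

instance (n : ℕ) : BorelSpace (L2x n) := ⟨rfl⟩

variable {n : ℕ}

/-- The Fourier coefficient `û_k = (2π)⁻ⁿ ∫ u(x) e^{-ik·x} dx ∈ ℂⁿ`. -/
def fourierCoef (u : L2x n) (k : Fin n → ℤ) : EuclideanSpace ℂ (Fin n) :=
  WithLp.toLp 2 fun i =>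
    ((2 * Real.pi : ℂ) ^ n)⁻¹ *
      ∫ x : Torus n, (∏ j, fourier (-(k j)) (x j)) * ((u x i : ℝ) : ℂ)

/-- `|k|²` for a wave vector `k ∈ ℤⁿ`. -/
def waveSq (k : Fin n → ℤ) : ℝ := ∑ j, (k j : ℝ) ^ 2

/-- `div u = 0` in the sense of distributions, i.e. `k · û_k = 0` for all `k`. -/
def DivFree (u : L2x n) : Prop := ∀ k : Fin n → ℤ, ∑ j, (k j : ℂ) * fourierCoef u k j = 0

/-- `‖∇u‖²_{L²_x} = (2π)ⁿ ∑_k |k|² |û_k|²`, equal to `∞` if `u` is not in `H¹_x`. -/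
def gradNormSq (u : L2x n) : ℝ≥0∞ :=
  ∑' k : Fin n → ℤ, ENNReal.ofReal ((2 * Real.pi) ^ n * (waveSq k * ‖fourierCoef u k‖ ^ 2))

/-- The Sobolev norm `‖u‖_{H^s_x} = ((2π)ⁿ ∑_k (1 + |k|²)^s |û_k|²)^{1/2}`, `s ∈ ℝ`. -/
def sobolevNorm (s : ℝ) (u : L2x n) : ℝ≥0∞ :=
  (∑' k : Fin n → ℤ,
    ENNReal.ofReal ((2 * Real.pi) ^ n * ((1 + waveSq k) ^ s * ‖fourierCoef u k‖ ^ 2))) ^ (1 / 2 : ℝ)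

end Torus

section Noise

variable {d N : ℕ}

/-- `|y|_Γ = ⟨y, Γ⁻¹ y⟩^{1/2}` on `ℝᵈ`. -/
def gammaNorm (Γ : Matrix (Fin d) (Fin d) ℝ) (y : EuclideanSpace ℝ (Fin d)) : ℝ :=
  √(y.ofLp ⬝ᵥ (Γ⁻¹ *ᵥ y.ofLp))

/-- `|𝐲|_Γ = (∑_j |y_j|_Γ²)^{1/2}` on `ℝ^{d×N}`. -/
def gammaNormN (Γ : Matrix (Fin d) (Fin d) ℝ) (y : Fin N → EuclideanSpace ℝ (Fin d)) : ℝ :=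
  √(∑ j, gammaNorm Γ (y j) ^ 2)

/-- `ρ` is a positive probability density on `ℝᵈ` which is Lipschitz continuous, bounded, and
satisfies the tail condition `ρ(y) ≥ exp(-|y|_Γ²/2) / C`. -/
structure IsNoiseDensity (Γ : Matrix (Fin d) (Fin d) ℝ) (ρ : EuclideanSpace ℝ (Fin d) → ℝ) :
    Prop where
  pos : ∀ y, 0 < ρ y
  integral_eq_one : ∫⁻ y, ENNReal.ofReal (ρ y) = 1
  lipschitz : ∃ L > 0, ∀ y y', |ρ y - ρ y'| ≤ L * gammaNorm Γ (y - y')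
  bounded : ∃ C > 0, ∀ y, ρ y ≤ C
  tail : ∃ C > 0, ∀ y, Real.exp (-(1 / 2) * gammaNorm Γ y ^ 2) / C ≤ ρ y

end Noise

section Filtering

variable {T : ℝ} {n d N : ℕ}

/-- The space `L¹([0,T]; L²_x)`. -/
abbrev PathSpace (T : ℝ) (n : ℕ) : Type := Lp (L2x n) 1 (lebT T)

/-- Lipschitz continuous observables `𝒢_j : L¹([0,T]; L²_x) → ℝᵈ` that depend only on the values on
`[t_{j-1}, t_j]`; here `𝒢 j` is observed on `[t j.castSucc, t j.succ]`. -/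
def LipschitzObservables (t : Fin (N + 1) → ℝ) (G : Fin N → PathSpace T n → EuclideanSpace ℝ (Fin d))
    (L : ℝ) : Prop :=
  ∀ (j : Fin N) (u u' : PathSpace T n),
    ‖G j u - G j u'‖ ≤
      L * ∫ s in {s : Time T | t j.castSucc ≤ s ∧ (s : ℝ) ≤ t j.succ}, ‖u s - u' s‖ ∂(lebT T)

open Classical in
/-- The trajectory `s ↦ 𝒮_s(ū)` as an element of `L¹([0,T]; L²_x)`. (The value `0` is only used for
initial data `ū` whose trajectory is not integrable in time.) -/
def trajectory (S : Time T → L2x n → L2x n) (u : L2x n) : PathSpace T n :=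
  if h : MemLp (fun s => S s u) 1 (lebT T) then h.toLp else 0

/-- The likelihood `∏_{t_j ≤ s} ρ(y_j - 𝒢_j(𝒮(ū)))` of the measurements `y_j = 𝒢_j(𝒮(ū)) + η_j`
available at time `s`. -/
def likelihood (ρ : EuclideanSpace ℝ (Fin d) → ℝ) (t : Fin (N + 1) → ℝ)
    (G : Fin N → PathSpace T n → EuclideanSpace ℝ (Fin d)) (S : Time T → L2x n → L2x n)
    (y : Fin N → EuclideanSpace ℝ (Fin d)) (s : Time T) (u : L2x n) : ℝ≥0∞ :=
  ENNReal.ofReal (∏ j with t (Fin.succ j) ≤ s, ρ (y j - G j (trajectory S u)))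

/-- The posterior on the initial data given the measurements `y_j` with `t_j ≤ s`: by Bayes'
formula, it is the prior reweighted by the likelihood and normalized. -/
def posterior (ρ : EuclideanSpace ℝ (Fin d) → ℝ) (t : Fin (N + 1) → ℝ)
    (G : Fin N → PathSpace T n → EuclideanSpace ℝ (Fin d)) (S : Time T → L2x n → L2x n)
    (prior : Measure (L2x n)) (y : Fin N → EuclideanSpace ℝ (Fin d)) (s : Time T) :
    Measure (L2x n) :=
  (∫⁻ u, likelihood ρ t G S y s u ∂prior)⁻¹ • prior.withDensity (likelihood ρ t G S y s)

/-- The filtering distribution `ν^𝐲_s`: the law of `𝒮_s(ū)` given the measurements `y_j` with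
`t_j ≤ s`, i.e. the push-forward under `𝒮_s` of the posterior on the initial data. -/
def filtering (ρ : EuclideanSpace ℝ (Fin d) → ℝ) (t : Fin (N + 1) → ℝ)
    (G : Fin N → PathSpace T n → EuclideanSpace ℝ (Fin d)) (S : Time T → L2x n → L2x n)
    (prior : Measure (L2x n)) (y : Fin N → EuclideanSpace ℝ (Fin d)) (s : Time T) :
    Measure (L2x n) :=
  (posterior ρ t G S prior y s).map (S s)

/-- Approximate solution operators `𝒮^Δ_s : L²_x → L²_x`, `Δ > 0`, `s ∈ [0,T]`, for the
Navier-Stokes equations with viscosity `visc`. The bounds are required for divergence-free initial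
data, and uniformly in `Δ`. -/
structure ApproxSolutionOperators (visc : ℝ) (S : Set.Ioi (0 : ℝ) → Time T → L2x n → L2x n) :
    Prop where
  measurable : ∀ Δ, Measurable fun p : Time T × L2x n => S Δ p.1 p.2
  energy : ∀ Δ s u, DivFree u → ‖S Δ s u‖ ≤ ‖u‖
  coercivity : ∀ Δ u, DivFree u →
    ∫⁻ s, gradNormSq (S Δ s u) ∂(lebT T) ≤ ENNReal.ofReal (visc⁻¹ * ‖u‖ ^ 2)
  timeRegularity : ∃ L > 0, ∃ C : ℝ → ℝ, ∀ Δ u, DivFree u → ∀ s s',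
    sobolevNorm (-L) (S Δ s u - S Δ s' u) ≤ ENNReal.ofReal (C ‖u‖ * |(s : ℝ) - s'|)

end Filtering

end FilteringNS

end

open FilteringNS

/-!
The posterior at time `s` reweights the prior by a likelihood which, since `ρ` is bounded, Lipschitz
and bounded below by a Gaussian, lies between positive constants and is Lipschitz in the
measurements `y`, locally uniformly in `y`; hence so are the filtering distributions in `W₁`, because
the fields in question have norm at most `M`. This gives equicontinuity in `y`, and by the theorem of
Arzelà and Ascoli compactness reduces to total boundedness for a fixed `y`. There, the posterior is
dominated by a multiple of the prior, and three approximations, uniform in `Δ`, bring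
`s ↦ (S Δ s)_# posterior` close to a finite set: truncating the Fourier modes (the bound on the
gradient controls the error), freezing the time on a grid which resolves the measurement times (the
truncated fields are Lipschitz in time by the bound in `H^{-L}`), and replacing measures on a compact
set by a finite net in `W₁`.

For a limit, the local Lipschitz bound holds at almost every time for each pair `y, y'`. Taken for all
pairs from a countable dense set it holds off one null set of times, and there the limit at the dense
points extends by completeness to all `y`; this extension is the modification.
-/

namespace FilteringNS

section Wasserstein

variable {X : Type*} [MeasurableSpace X]

theorem IsCoupling.isProbabilityMeasure {π : Measure (X × X)} {μ ν : Measure X}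
    [IsProbabilityMeasure μ] (h : IsCoupling π μ ν) : IsProbabilityMeasure π := by
  have : IsProbabilityMeasure (π.map Prod.fst) := by rw [h.1]; infer_instance
  exact Measure.isProbabilityMeasure_of_map (f := Prod.fst)

theorem isCoupling_map_prodMk {Ω : Type*} [MeasurableSpace Ω] (P : Measure Ω) {f g : Ω → X}
    (hf : Measurable f) (hg : Measurable g) :
    IsCoupling (P.map fun ω => (f ω, g ω)) (P.map f) (P.map g) :=
  ⟨Measure.map_map measurable_fst (hf.prodMk hg), Measure.map_map measurable_snd (hf.prodMk hg)⟩

variable [NormedAddCommGroup X]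

theorem exists_isCoupling_lintegral_lt {μ ν : Measure X} {r : ℝ≥0∞} (h : W₁ μ ν < r) :
    ∃ π : Measure (X × X), IsCoupling π μ ν ∧ ∫⁻ p, edist p.1 p.2 ∂π < r := by
  simpa [W₁, iInf_lt_iff] using h

variable [BorelSpace X] [SecondCountableTopology X]

theorem W₁_map_map_le {Ω : Type*} [MeasurableSpace Ω] (P : Measure Ω) {f g : Ω → X}
    (hf : Measurable f) (hg : Measurable g) :
    W₁ (P.map f) (P.map g) ≤ ∫⁻ ω, edist (f ω) (g ω) ∂P :=
  (isCoupling_map_prodMk P hf hg).W₁_le.trans_eq (lintegral_map (by fun_prop) (hf.prodMk hg))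

section Duality

theorem lintegral_le_add_W₁ (μ ν : Measure X) {f : X → ℝ≥0} {K : ℝ≥0} (hK : K ≠ 0)
    (hf : LipschitzWith K f) : ∫⁻ u, f u ∂μ ≤ ∫⁻ u, f u ∂ν + K * W₁ μ ν := by
  have hfm : Measurable fun u => (f u : ℝ≥0∞) := hf.continuous.measurable.coe_nnreal_ennreal
  have hle : ∀ x y, (f x : ℝ≥0∞) ≤ f y + K * edist x y := fun x y =>
    calc (f x : ℝ≥0∞) ≤ f y + edist (f x) (f y) := by
          rw [edist_nndist, ← ENNReal.coe_add, ENNReal.coe_le_coe, NNReal.nndist_eq]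
          exact tsub_le_iff_left.1 (le_max_left _ _)
      _ ≤ f y + K * edist x y := by gcongr; exact hf x y
  simp only [W₁, ENNReal.mul_iInf_of_ne (ENNReal.coe_ne_zero.2 hK) ENNReal.coe_ne_top,
    ENNReal.add_iInf]
  refine le_iInf₂ fun π h => ?_
  rw [← h.1, ← h.2, lintegral_map hfm measurable_fst, lintegral_map hfm measurable_snd,
    ← lintegral_const_mul _ (by fun_prop),
    ← lintegral_add_left (f := fun p : X × X => (f p.2 : ℝ≥0∞)) (hfm.comp measurable_snd)]
  exact lintegral_mono fun p => hle _ _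

theorem lintegral_enorm_le_add_W₁ (μ ν : Measure X) :
    ∫⁻ u, ‖u‖ₑ ∂μ ≤ ∫⁻ u, ‖u‖ₑ ∂ν + W₁ μ ν := by
  simpa [enorm_eq_nnnorm] using lintegral_le_add_W₁ μ ν one_ne_zero lipschitzWith_one_nnnorm

theorem tendsto_lintegral_of_tendsto_W₁ {ι : Type*} {l : Filter ι} {μ : ι → Measure X}
    {ν : Measure X} (h : Tendsto (fun k => W₁ (μ k) ν) l (𝓝 0)) {f : X → ℝ≥0} {K : ℝ≥0}
    (hf : LipschitzWith K f) :
    Tendsto (fun k => ∫⁻ u, f u ∂(μ k)) l (𝓝 (∫⁻ u, f u ∂ν)) := by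
  set K' : ℝ≥0 := max K 1
  have hK' : K' ≠ 0 := (zero_lt_one.trans_le (le_max_right K 1)).ne'
  have hf' : LipschitzWith K' f := hf.weaken (le_max_left K 1)
  have h0 : Tendsto (fun k => K' * W₁ (μ k) ν) l (𝓝 0) := by
    simpa using ENNReal.Tendsto.const_mul h (Or.inr ENNReal.coe_ne_top)
  refine tendsto_of_tendsto_of_tendsto_of_le_of_le
    (g := fun k => ∫⁻ u, f u ∂ν - K' * W₁ (μ k) ν)
    (h := fun k => ∫⁻ u, f u ∂ν + K' * W₁ (μ k) ν) ?_ ?_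
    (fun k => tsub_le_iff_right.2 (W₁_comm (μ k) ν ▸ lintegral_le_add_W₁ ν (μ k) hK' hf'))
    fun k => lintegral_le_add_W₁ (μ k) ν hK' hf'
  · simpa using ENNReal.Tendsto.sub tendsto_const_nhds h0 (by simp)
  · simpa using tendsto_const_nhds.add h0

theorem measure_eq_of_lintegral_thickenedIndicator_eq {Y : Type*} [PseudoEMetricSpace Y]
    [MeasurableSpace Y] [BorelSpace Y] {μ ν : Measure Y} [IsProbabilityMeasure μ]
    [IsProbabilityMeasure ν]
    (h : ∀ {δ : ℝ} (hδ : 0 < δ) (F : Set Y),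
      ∫⁻ u, (thickenedIndicator hδ F u : ℝ≥0∞) ∂μ = ∫⁻ u, (thickenedIndicator hδ F u : ℝ≥0∞) ∂ν) :
    μ = ν := by
  refine ext_of_generate_finite {s | IsClosed s} ?_ isPiSystem_isClosed (fun F hF => ?_) (by simp)
  · rw [← borel_eq_generateFrom_isClosed]; exact BorelSpace.measurable_eq
  · have hpos : ∀ n : ℕ, (0 : ℝ) < 1 / ((n : ℝ) + 1) := fun n => Nat.one_div_pos_of_nat
    refine tendsto_nhds_unique_of_eventuallyEq
      (tendsto_lintegral_thickenedIndicator_of_isClosed μ hF hpos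
        tendsto_one_div_add_atTop_nhds_zero_nat)
      (tendsto_lintegral_thickenedIndicator_of_isClosed ν hF hpos
        tendsto_one_div_add_atTop_nhds_zero_nat)
      (Eventually.of_forall fun n => h (hpos n) F)

theorem measurable_of_measurable_lintegral_thickenedIndicator {Y : Type*} [PseudoEMetricSpace Y]
    [MeasurableSpace Y] [BorelSpace Y] {α : Type*} [MeasurableSpace α] {b : α → Measure Y}
    [∀ t, IsProbabilityMeasure (b t)]
    (h : ∀ {δ : ℝ} (hδ : 0 < δ) (F : Set Y),
      Measurable fun t => ∫⁻ u, (thickenedIndicator hδ F u : ℝ≥0∞) ∂(b t)) : Measurable b := by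
  have hgen : (inferInstance : MeasurableSpace Y) =
      MeasurableSpace.generateFrom {s : Set Y | IsClosed s} := by
    rw [← borel_eq_generateFrom_isClosed]; exact BorelSpace.measurable_eq
  refine Measurable.measure_of_isPiSystem_of_isProbabilityMeasure hgen isPiSystem_isClosed ?_
  intro F hF
  have hpos : ∀ n : ℕ, (0 : ℝ) < 1 / ((n : ℝ) + 1) := fun n => Nat.one_div_pos_of_nat
  exact measurable_of_tendsto_metrizable (fun n => h (hpos n) F) (tendsto_pi_nhds.2 fun t =>
    tendsto_lintegral_thickenedIndicator_of_isClosed (b t) hF hpos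
      tendsto_one_div_add_atTop_nhds_zero_nat)

theorem eq_of_W₁_eq_zero {μ ν : Measure X} [IsProbabilityMeasure μ] [IsProbabilityMeasure ν]
    (h : W₁ μ ν = 0) : μ = ν :=
  measure_eq_of_lintegral_thickenedIndicator_eq fun hδ F =>
    tendsto_nhds_unique (tendsto_const_nhds (f := (atTop : Filter ℕ)))
      (tendsto_lintegral_of_tendsto_W₁ (by simp [h]) (lipschitzWith_thickenedIndicator hδ F))

theorem measurable_of_tendsto_W₁ {α : Type*} [MeasurableSpace α] {a : ℕ → α → Measure X}
    {b : α → Measure X} [∀ t, IsProbabilityMeasure (b t)] (ha : ∀ k, Measurable (a k))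
    (h : ∀ t, Tendsto (fun k => W₁ (a k t) (b t)) atTop (𝓝 0)) : Measurable b :=
  measurable_of_measurable_lintegral_thickenedIndicator fun hδ F =>
    measurable_of_tendsto_metrizable
      (fun k => (Measure.measurable_lintegral (by fun_prop)).comp (ha k))
      (tendsto_pi_nhds.2 fun t =>
        tendsto_lintegral_of_tendsto_W₁ (h t) (lipschitzWith_thickenedIndicator hδ F))

end Duality

section Completeness

theorem map_compProd_comap {A B Z : Type*} [MeasurableSpace A] [MeasurableSpace B]
    [MeasurableSpace Z] {μ : Measure A} [IsFiniteMeasure μ] {e : A → B} (he : Measurable e)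
    (κ : Kernel B Z) [IsMarkovKernel κ] :
    (μ ⊗ₘ κ.comap e he).map (Prod.map e id) = μ.map e ⊗ₘ κ := by
  ext s hs
  have hm : Measurable (Prod.map e (id : Z → Z)) := he.prodMap measurable_id
  rw [Measure.map_apply hm hs, Measure.compProd_apply (hm hs), Measure.compProd_apply hs,
    lintegral_map (Kernel.measurable_kernel_prodMk_left hs) he]
  rfl

theorem map_zero_trajMeasure {Z : Type*} [MeasurableSpace Z] {μ : Measure Z}
    [IsProbabilityMeasure μ] (κ : (k : ℕ) → Kernel (Π _ : Finset.Iic k, Z) Z)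
    [∀ k, IsMarkovKernel (κ k)] :
    (Kernel.trajMeasure (X := fun _ => Z) μ κ).map (fun x => x 0) = μ := by
  have he : Measurable fun x : (Π _ : Finset.Iic 0, Z) => x ⟨0, by simp⟩ := measurable_pi_apply _
  have hinit : (Kernel.trajMeasure (X := fun _ => Z) μ κ).map (Preorder.frestrictLe 0) =
      μ.map (MeasurableEquiv.piUnique (fun _ : Finset.Iic 0 => Z)).symm := by
    rw [Kernel.trajMeasure, Measure.map_comp _ _ (by fun_prop), Kernel.traj_map_frestrictLe,
      Kernel.partialTraj_self, Measure.id_comp]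
  calc (Kernel.trajMeasure (X := fun _ => Z) μ κ).map (fun x => x 0)
      = ((Kernel.trajMeasure (X := fun _ => Z) μ κ).map (Preorder.frestrictLe 0)).map
          (fun x : (Π _ : Finset.Iic 0, Z) => x ⟨0, by simp⟩) := by
        rw [Measure.map_map he (by fun_prop)]; rfl
    _ = μ := by rw [hinit, Measure.map_map he (by fun_prop)]; exact Measure.map_id

variable [CompleteSpace X]

-- The gluing is a Markov chain whose transition kernels are the disintegrations of the `π k`.
theorem exists_map_prodMk_succ_eq (μ : ℕ → Measure X) [∀ k, IsProbabilityMeasure (μ k)]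
    (π : ℕ → Measure (X × X)) (hπ : ∀ k, IsCoupling (π k) (μ k) (μ (k + 1))) :
    ∃ P : Measure (ℕ → X), IsProbabilityMeasure P ∧
      ∀ k, P.map (fun x => (x k, x (k + 1))) = π k := by
  have := fun k => (hπ k).isProbabilityMeasure
  have hlast : ∀ k : ℕ, Measurable fun x : (Π _ : Finset.Iic k, X) =>
      x ⟨k, Finset.mem_Iic.2 le_rfl⟩ := fun k => measurable_pi_apply _
  let κ (k : ℕ) : Kernel (Π _ : Finset.Iic k, X) X := (π k).condKernel.comap _ (hlast k)
  set P := Kernel.trajMeasure (X := fun _ => X) (μ 0) κ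
  have hstep : ∀ k, P.map (fun x => x k) = μ k → P.map (fun x => (x k, x (k + 1))) = π k := by
    intro k hk
    have : IsProbabilityMeasure (P.map (Preorder.frestrictLe (π := fun _ => X) k)) :=
      Measure.isProbabilityMeasure_map (by fun_prop)
    have hmarg : (P.map (Preorder.frestrictLe k)).map
        (fun x : (Π _ : Finset.Iic k, X) => x ⟨k, Finset.mem_Iic.2 le_rfl⟩) = μ k := by
      rw [Measure.map_map (hlast k) (by fun_prop)]; exact hk
    have hdis : μ k ⊗ₘ (π k).condKernel = π k := by
      have hfst : (π k).fst = μ k := (hπ k).1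
      rw [← hfst]; exact (π k).disintegrate _
    have hglue := map_compProd_comap (μ := P.map (Preorder.frestrictLe (π := fun _ => X) k))
      (hlast k) (π k).condKernel
    rw [hmarg, hdis, Kernel.map_frestrictLe_trajMeasure_compProd_eq_map_trajMeasure
      (X := fun _ => X) (κ := κ), Measure.map_map ((hlast k).prodMap measurable_id)
      (by fun_prop)] at hglue
    exact hglue
  refine ⟨P, inferInstance, fun k => hstep k ?_⟩
  induction k with
  | zero => exact map_zero_trajMeasure κ
  | succ k ih =>
    rw [← (hπ k).2, ← hstep k ih, Measure.map_map measurable_snd (by fun_prop)]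
    rfl

theorem exists_law_tsum_lintegral_edist_ne_top (μ : ℕ → Measure X)
    [∀ k, IsProbabilityMeasure (μ k)] (h : ∑' k, W₁ (μ k) (μ (k + 1)) ≠ ∞) :
    ∃ P : Measure (ℕ → X), IsProbabilityMeasure P ∧ (∀ k, P.map (fun x => x k) = μ k) ∧
      ∑' k, ∫⁻ x, edist (x k) (x (k + 1)) ∂P ≠ ∞ := by
  have hlt : ∀ k, W₁ (μ k) (μ (k + 1)) < W₁ (μ k) (μ (k + 1)) + 2⁻¹ ^ k := fun k =>
    ENNReal.lt_add_right (ENNReal.ne_top_of_tsum_ne_top h k) (pow_ne_zero _ (by simp))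
  choose π hπ hlt using fun k => exists_isCoupling_lintegral_lt (hlt k)
  obtain ⟨P, hP, hPπ⟩ := exists_map_prodMk_succ_eq μ π hπ
  refine ⟨P, hP, fun k => ?_, ?_⟩
  · rw [← (hπ k).1, ← hPπ k, Measure.map_map measurable_fst (by fun_prop)]
    rfl
  · have hcost : ∀ k, ∫⁻ x, edist (x k) (x (k + 1)) ∂P = ∫⁻ p, edist p.1 p.2 ∂(π k) := fun k => by
      rw [← hPπ k, lintegral_map (by fun_prop) (by fun_prop)]
    simp only [hcost]
    refine ne_top_of_le_ne_top ?_ (ENNReal.tsum_le_tsum fun k => (hlt k).le)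
    rw [ENNReal.tsum_add, ENNReal.tsum_geometric]
    exact ENNReal.add_ne_top.2 ⟨h, by simp⟩

theorem exists_tendsto_lintegral_edist {Ω : Type*} [MeasurableSpace Ω] {P : Measure Ω}
    {f : ℕ → Ω → X} (hf : ∀ k, Measurable (f k))
    (h : ∑' k, ∫⁻ ω, edist (f k ω) (f (k + 1) ω) ∂P ≠ ∞) :
    ∃ g : Ω → X, Measurable g ∧
      Tendsto (fun k => ∫⁻ ω, edist (f k ω) (g ω) ∂P) atTop (𝓝 0) := by
  have hm : ∀ k, Measurable fun ω => edist (f k ω) (f (k + 1) ω) := fun k =>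
    (hf k).edist (hf (k + 1))
  have hae : ∀ᵐ ω ∂P, ∑' k, edist (f k ω) (f (k + 1) ω) < ∞ :=
    ae_lt_top (Measurable.tsum hm) (by rwa [lintegral_tsum fun k => (hm k).aemeasurable])
  obtain ⟨g, hg, hlim⟩ := measurable_limit_of_tendsto_metrizable_ae (μ := P) (L := atTop)
    (fun k => (hf k).aemeasurable) (by
      filter_upwards [hae] with ω hω
      exact cauchySeq_tendsto_of_complete
        (cauchySeq_of_edist_le_of_tsum_ne_top _ (fun _ => le_rfl) hω.ne))
  refine ⟨g, hg, tendsto_of_tendsto_of_tendsto_of_le_of_le tendsto_const_nhds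
    (ENNReal.tendsto_sum_nat_add _ h) (fun k => zero_le) fun k => ?_⟩
  calc ∫⁻ ω, edist (f k ω) (g ω) ∂P
      ≤ ∫⁻ ω, ∑' j, edist (f (k + j) ω) (f (k + j + 1) ω) ∂P := by
        refine lintegral_mono_ae ?_
        filter_upwards [hlim] with ω hω
        exact edist_le_tsum_of_edist_le_of_tendsto _ (fun _ => le_rfl) hω k
    _ = ∑' j, ∫⁻ ω, edist (f (j + k) ω) (f (j + k + 1) ω) ∂P := by
        rw [lintegral_tsum fun j => (hm _).aemeasurable]
        simp only [add_comm]

theorem exists_tendsto_W₁ (μ : ℕ → Measure X) [∀ k, IsProbabilityMeasure (μ k)]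
    (h : ∑' k, W₁ (μ k) (μ (k + 1)) ≠ ∞) :
    ∃ ν : Measure X, IsProbabilityMeasure ν ∧ Tendsto (fun k => W₁ (μ k) ν) atTop (𝓝 0) := by
  obtain ⟨P, hP, hmarg, hsum⟩ := exists_law_tsum_lintegral_edist_ne_top μ h
  obtain ⟨Z, hZ, hlim⟩ := exists_tendsto_lintegral_edist measurable_pi_apply hsum
  refine ⟨P.map Z, Measure.isProbabilityMeasure_map hZ.aemeasurable,
    tendsto_of_tendsto_of_tendsto_of_le_of_le tendsto_const_nhds hlim (fun k => zero_le)
      fun k => ?_⟩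
  change W₁ (μ k) _ ≤ _
  rw [← hmarg k]
  exact W₁_map_map_le P (measurable_pi_apply k) hZ

theorem W₁_le_tsum_of_tendsto {μ : ℕ → Measure X} [∀ k, IsProbabilityMeasure (μ k)]
    {ν : Measure X} (h : Tendsto (fun k => W₁ (μ k) ν) atTop (𝓝 0)) (k : ℕ) :
    W₁ (μ k) ν ≤ ∑' j, W₁ (μ (j + k)) (μ (j + k + 1)) := by
  have hpartial : ∀ m, W₁ (μ k) (μ (m + k)) ≤
      ∑ j ∈ Finset.range m, W₁ (μ (j + k)) (μ (j + k + 1)) := by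
    intro m
    induction m with
    | zero => simp [W₁_self]
    | succ m ih =>
      rw [Finset.sum_range_succ, Nat.add_right_comm]
      exact (W₁_triangle _ (μ (m + k)) _).trans (by gcongr)
  have hlim : Tendsto (fun m => ∑' j, W₁ (μ (j + k)) (μ (j + k + 1)) + W₁ (μ (m + k)) ν) atTop
      (𝓝 (∑' j, W₁ (μ (j + k)) (μ (j + k + 1)))) := by
    simpa using tendsto_const_nhds.add (h.comp (tendsto_add_atTop_nat k))
  refine ge_of_tendsto' hlim fun m => (W₁_triangle _ (μ (m + k)) _).trans ?_
  gcongr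
  exact (hpartial m).trans (ENNReal.sum_le_tsum _)

end Completeness

end Wasserstein

section TimeDependentMeasures

variable {T : ℝ} {X : Type*} [NormedAddCommGroup X] [MeasurableSpace X] [BorelSpace X]

theorem lebT_univ (T : ℝ) : lebT T univ = ENNReal.ofReal T := by
  rw [lebT, Measure.comap_apply _ Subtype.val_injective
    (fun s hs => measurableSet_Icc.subtype_image hs) _ MeasurableSet.univ, image_univ,
    Subtype.range_coe, Real.volume_Icc, sub_zero]

instance : IsFiniteMeasure (lebT T) where
  measure_univ_lt_top := by rw [lebT_univ]; exact ENNReal.ofReal_lt_top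

/-- The element of `L1P T X` given by a Borel measurable family of probability measures; this is
how elements are built, since limits of measurable families are easier to handle than weak-*
limits. -/
noncomputable def L1P.ofMeasurable (a : Time T → Measure X)
    (hprob : ∀ t, IsProbabilityMeasure (a t)) (ha : Measurable a)
    (hmoment : ∀ t, ∫⁻ u, ‖u‖ₑ ∂(a t) < ∞)
    (hint : ∫⁻ t, ∫⁻ u, ‖u‖ₑ ∂(a t) ∂(lebT T) < ∞) : L1P T X where
  meas := a
  prob := hprob
  moment := hmoment
  weakMeasurable Φ := by
    have hΦ : Measurable Φ := Φ.continuous.measurable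
    have hpos : Measurable fun t => ∫⁻ u, ENNReal.ofReal (Φ u) ∂(a t) :=
      (Measure.measurable_lintegral (by fun_prop)).comp ha
    have hneg : Measurable fun t => ∫⁻ u, ENNReal.ofReal (-Φ u) ∂(a t) :=
      (Measure.measurable_lintegral (by fun_prop)).comp ha
    refine (congrArg Measurable (funext fun t => ?_)).mp
      (hpos.ennreal_toReal.sub hneg.ennreal_toReal)
    have := hprob t
    exact (integral_eq_lintegral_pos_part_sub_lintegral_neg_part (Φ.integrable (a t))).symm
  integrable := hint

theorem L1P.measurable_moment (ν : L1P T X) : Measurable fun t => ∫⁻ u, ‖u‖ₑ ∂(ν.meas t) :=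
  (Measure.measurable_lintegral (by fun_prop)).comp ν.measurable_meas

open Classical in
/-- The modification of `ν` to `δ₀` at the times outside `𝒢`; it makes properties that hold for
almost every time hold at all times. -/
noncomputable def L1P.truncate (ν : L1P T X) {𝒢 : Set (Time T)} (h𝒢 : MeasurableSet 𝒢) : L1P T X :=
  L1P.ofMeasurable (𝒢.piecewise ν.meas fun _ => Measure.dirac 0)
    (fun t => by by_cases ht : t ∈ 𝒢 <;> simp only [ht, piecewise_eq_of_mem,
      piecewise_eq_of_notMem, not_false_eq_true] <;> infer_instance)
    (ν.measurable_meas.piecewise h𝒢 measurable_const)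
    (fun t => by by_cases ht : t ∈ 𝒢 <;> simp [ht, ν.moment t])
    ((lintegral_mono fun t => by by_cases ht : t ∈ 𝒢 <;> simp [ht]).trans_lt ν.integrable)

theorem L1P.truncate_meas_of_mem (ν : L1P T X) {𝒢 : Set (Time T)} (h𝒢 : MeasurableSet 𝒢)
    {t : Time T} (ht : t ∈ 𝒢) : (ν.truncate h𝒢).meas t = ν.meas t :=
  if_pos ht

theorem L1P.truncate_meas_of_notMem (ν : L1P T X) {𝒢 : Set (Time T)} (h𝒢 : MeasurableSet 𝒢)
    {t : Time T} (ht : t ∉ 𝒢) : (ν.truncate h𝒢).meas t = Measure.dirac 0 :=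
  if_neg ht

variable [SecondCountableTopology X] [CompleteSpace X]

theorem L1P.edist_def (ν ν' : L1P T X) :
    edist ν ν' = ∫⁻ t, W₁ (ν.meas t) (ν'.meas t) ∂(lebT T) := rfl

theorem L1P.measurable_W₁ (ν ν' : L1P T X) :
    Measurable fun t => W₁ (ν.meas t) (ν'.meas t) :=
  FilteringNS.measurable_W₁ ν.measurable_meas ν'.measurable_meas ν.moment ν'.moment

section Completeness

theorem L1P.exists_forall_tendsto_W₁ (a : ℕ → L1P T X)
    (hsum : ∀ t, ∑' k, W₁ ((a k).meas t) ((a (k + 1)).meas t) ≠ ∞)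
    (hint : ∫⁻ t, ∑' k, W₁ ((a k).meas t) ((a (k + 1)).meas t) ∂(lebT T) ≠ ∞) :
    ∃ ν : L1P T X, ∀ t, Tendsto (fun k => W₁ ((a k).meas t) (ν.meas t)) atTop (𝓝 0) := by
  choose b hprob hlim using fun t => exists_tendsto_W₁ (fun k => (a k).meas t) (hsum t)
  have hmoment : ∀ t, ∫⁻ u, ‖u‖ₑ ∂(b t) ≤
      ∫⁻ u, ‖u‖ₑ ∂((a 0).meas t) + ∑' k, W₁ ((a k).meas t) ((a (k + 1)).meas t) := fun t =>
    calc ∫⁻ u, ‖u‖ₑ ∂(b t) ≤ ∫⁻ u, ‖u‖ₑ ∂((a 0).meas t) + W₁ ((a 0).meas t) (b t) := by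
          rw [W₁_comm]; exact lintegral_enorm_le_add_W₁ _ _
      _ ≤ _ := by gcongr; exact W₁_le_tsum_of_tendsto (hlim t) 0
  refine ⟨L1P.ofMeasurable b hprob
    (measurable_of_tendsto_W₁ (fun k => (a k).measurable_meas) hlim)
    (fun t => (hmoment t).trans_lt (ENNReal.add_lt_top.2 ⟨(a 0).moment t, (hsum t).lt_top⟩))
    ((lintegral_mono hmoment).trans_lt ?_), hlim⟩
  rw [lintegral_add_left (a 0).measurable_moment]
  exact ENNReal.add_lt_top.2 ⟨(a 0).integrable, hint.lt_top⟩

theorem L1P.exists_ae_tendsto_W₁ (a : ℕ → L1P T X) (h : ∑' k, edist (a k) (a (k + 1)) ≠ ∞) :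
    ∃ ν : L1P T X,
      ∀ᵐ t ∂(lebT T), Tendsto (fun k => W₁ ((a k).meas t) (ν.meas t)) atTop (𝓝 0) := by
  set σ : Time T → ℝ≥0∞ := fun t => ∑' k, W₁ ((a k).meas t) ((a (k + 1)).meas t) with hσ
  have hσm : Measurable σ := Measurable.tsum fun k => (a k).measurable_W₁ _
  have hint : ∫⁻ t, σ t ∂(lebT T) ≠ ∞ := by
    rwa [lintegral_tsum fun k => ((a k).measurable_W₁ _).aemeasurable]
  have h𝒢 : MeasurableSet {t | σ t < ∞} := measurableSet_lt hσm measurable_const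
  set a' : ℕ → L1P T X := fun k => (a k).truncate h𝒢
  have hmem : ∀ k t, σ t < ∞ → (a' k).meas t = (a k).meas t := fun k t ht =>
    (a k).truncate_meas_of_mem h𝒢 ht
  have hnotMem : ∀ k t, ¬ σ t < ∞ → (a' k).meas t = Measure.dirac 0 := fun k t ht =>
    (a k).truncate_meas_of_notMem h𝒢 ht
  have hsum : ∀ t, ∑' k, W₁ ((a' k).meas t) ((a' (k + 1)).meas t) ≤ σ t := fun t => by
    by_cases ht : σ t < ∞
    · simp only [hmem _ t ht, hσ, le_refl]
    · simp [hnotMem _ t ht, W₁_self]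
  obtain ⟨ν, hν⟩ := L1P.exists_forall_tendsto_W₁ a' (fun t => by
      by_cases ht : σ t < ∞
      · exact ((hsum t).trans_lt ht).ne
      · simp [hnotMem _ t ht, W₁_self])
    (ne_top_of_le_ne_top hint (lintegral_mono hsum))
  refine ⟨ν, ?_⟩
  filter_upwards [ae_lt_top hσm hint] with t ht
  simpa only [hmem _ t ht] using hν t

instance : CompleteSpace (L1P T X) := by
  refine EMetric.complete_of_convergent_controlled_sequences (fun n => 2⁻¹ ^ n)
    (fun n => ENNReal.pow_pos (by simp) n) fun a ha => ?_
  have hsum : ∑' k, edist (a k) (a (k + 1)) ≠ ∞ :=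
    ne_top_of_le_ne_top (b := ∑' k : ℕ, (2⁻¹ : ℝ≥0∞) ^ k) (by simp [ENNReal.tsum_geometric])
      (ENNReal.tsum_le_tsum fun k => (ha k k (k + 1) le_rfl (Nat.le_succ k)).le)
  obtain ⟨ν, hν⟩ := L1P.exists_ae_tendsto_W₁ a hsum
  refine ⟨ν, tendsto_iff_edist_tendsto_0.2 (tendsto_of_tendsto_of_tendsto_of_le_of_le
    tendsto_const_nhds (ENNReal.tendsto_sum_nat_add _ hsum) (fun _ => zero_le) fun k => ?_)⟩
  calc edist (a k) ν
      ≤ ∫⁻ t, ∑' j, W₁ ((a (j + k)).meas t) ((a (j + k + 1)).meas t) ∂(lebT T) := by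
        refine lintegral_mono_ae ?_
        filter_upwards [hν] with t ht
        exact W₁_le_tsum_of_tendsto ht k
    _ = ∑' j, edist (a (j + k)) (a (j + k + 1)) :=
        lintegral_tsum fun j => ((a (j + k)).measurable_W₁ _).aemeasurable

end Completeness

section Stability

variable {Y : Type*} [TopologicalSpace Y] {c : Y → Y → ℝ≥0∞}

theorem L1P.equicontinuous_of_W₁_le {ι : Type*} (hc : Continuous (Function.uncurry c))
    (hc0 : ∀ y, c y y = 0) (F : ι → Y → L1P T X)
    (h : ∀ i y y' s, W₁ ((F i y).meas s) ((F i y').meas s) ≤ c y y') : Equicontinuous F := by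
  intro y U hU
  obtain ⟨ε, hε, hεU⟩ := mem_uniformity_edist.1 hU
  have hlim : Tendsto (fun y' => c y y' * lebT T univ) (𝓝 y) (𝓝 0) := by
    have hcy : Tendsto (fun y' => c y y') (𝓝 y) (𝓝 0) :=
      hc0 y ▸ (hc.comp (Continuous.prodMk_right y)).tendsto y
    simpa using ENNReal.Tendsto.mul_const hcy (Or.inr (measure_ne_top (lebT T) univ))
  filter_upwards [hlim.eventually (gt_mem_nhds hε)] with y' hy' i
  refine hεU (lt_of_le_of_lt ?_ hy')
  exact (lintegral_mono fun s => h i y y' s).trans_eq (lintegral_const _)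

theorem L1P.ae_W₁_le_of_tendsto {a b : ℕ → L1P T X} {ν ν' : L1P T X} {r : ℝ≥0∞}
    (ha : Tendsto a atTop (𝓝 ν)) (hb : Tendsto b atTop (𝓝 ν'))
    (h : ∀ k s, W₁ ((a k).meas s) ((b k).meas s) ≤ r) :
    ∀ᵐ s ∂(lebT T), W₁ (ν.meas s) (ν'.meas s) ≤ r := by
  have hle : ∀ k, ∫⁻ s, (W₁ (ν.meas s) (ν'.meas s) - r) ∂(lebT T) ≤
      edist (a k) ν + edist (b k) ν' := by
    intro k
    rw [L1P.edist_def, L1P.edist_def, ← lintegral_add_left ((a k).measurable_W₁ ν)]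
    refine lintegral_mono fun s => tsub_le_iff_right.2 ?_
    calc W₁ (ν.meas s) (ν'.meas s)
        ≤ W₁ (ν.meas s) ((a k).meas s) +
            (W₁ ((a k).meas s) ((b k).meas s) + W₁ ((b k).meas s) (ν'.meas s)) :=
          (W₁_triangle _ ((a k).meas s) _).trans
            (add_le_add le_rfl (W₁_triangle _ ((b k).meas s) _))
      _ ≤ W₁ ((a k).meas s) (ν.meas s) + (r + W₁ ((b k).meas s) (ν'.meas s)) := by
          rw [W₁_comm (ν.meas s)]
          gcongr
          exact h k s
      _ = _ := by ring
  have hzero : ∫⁻ s, (W₁ (ν.meas s) (ν'.meas s) - r) ∂(lebT T) = 0 := by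
    refine le_antisymm (ge_of_tendsto' (x := atTop) ?_ hle) bot_le
    simpa using (tendsto_iff_edist_tendsto_0.1 ha).add (tendsto_iff_edist_tendsto_0.1 hb)
  rw [lintegral_eq_zero_iff ((ν.measurable_W₁ ν').sub_const r)] at hzero
  filter_upwards [hzero] with s hs
  exact tsub_eq_zero_iff_le.1 hs

theorem exists_tendsto_forall_le_geometric [FirstCountableTopology Y] {ι : Type*} {e : ι → Y}
    (he : DenseRange e) (hc : Continuous (Function.uncurry c)) (hc0 : ∀ y, c y y = 0) (y : Y) :
    ∃ q : ℕ → ι, Tendsto (fun k => e (q k)) atTop (𝓝 y) ∧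
      ∀ k, c (e (q k)) (e (q (k + 1))) ≤ 2⁻¹ ^ k := by
  obtain ⟨x, hx, hxy⟩ := mem_closure_iff_seq_limit.1 (he y)
  choose r hr using hx
  obtain rfl : (fun k => e (r k)) = x := funext hr
  have hlim : Tendsto (fun p : ℕ × ℕ => c (e (r p.1)) (e (r p.2))) atTop (𝓝 0) := by
    rw [← prod_atTop_atTop_eq, ← hc0 y]
    exact (hc.tendsto (y, y)).comp ((hxy.comp tendsto_fst).prodMk_nhds (hxy.comp tendsto_snd))
  obtain ⟨φ, hφ, hφc⟩ := extraction_forall_of_eventually'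
    (P := fun k j => ∀ l ≥ j, c (e (r j)) (e (r l)) ≤ 2⁻¹ ^ k) fun k => by
      obtain ⟨m, hm⟩ := eventually_atTop_prod_self'.1
        (hlim.eventually (ge_mem_nhds (ENNReal.pow_pos (a := 2⁻¹) (by simp) k)))
      exact ⟨m, fun j hj l hl => hm j hj l (hj.le.trans hl)⟩
  exact ⟨r ∘ φ, hxy.comp hφ.tendsto_atTop, fun k => hφc k _ (hφ.monotone (Nat.le_succ k))⟩

theorem L1P.exists_extension_of_denseRange [FirstCountableTopology Y] {ι : Type*} {e : ι → Y}
    (he : DenseRange e) (hc : Continuous (Function.uncurry c)) (hc0 : ∀ y, c y y = 0)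
    (ν : ι → L1P T X) (h : ∀ i j s, W₁ ((ν i).meas s) ((ν j).meas s) ≤ c (e i) (e j)) :
    ∃ ν' : Y → L1P T X, (∀ i y s, W₁ ((ν i).meas s) ((ν' y).meas s) ≤ c (e i) y) ∧
      ∀ y y' s, W₁ ((ν' y).meas s) ((ν' y').meas s) ≤ c y y' := by
  have hgeo : ∑' k : ℕ, (2⁻¹ : ℝ≥0∞) ^ k ≠ ∞ := by simp [ENNReal.tsum_geometric]
  choose q hq hqc using exists_tendsto_forall_le_geometric he hc hc0
  have hsum : ∀ y s, ∑' k, W₁ ((ν (q y k)).meas s) ((ν (q y (k + 1))).meas s) ≤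
      ∑' k : ℕ, (2⁻¹ : ℝ≥0∞) ^ k := fun y s =>
    ENNReal.tsum_le_tsum fun k => (h _ _ s).trans (hqc y k)
  choose ν' hν' using fun y => L1P.exists_forall_tendsto_W₁ (fun k => ν (q y k))
    (fun s => ne_top_of_le_ne_top hgeo (hsum y s))
    (ne_top_of_le_ne_top (ENNReal.mul_ne_top hgeo (measure_ne_top (lebT T) univ))
      ((lintegral_mono (hsum y)).trans_eq (lintegral_const _)))
  have hdense : ∀ i y s, W₁ ((ν i).meas s) ((ν' y).meas s) ≤ c (e i) y := fun i y s => by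
    have hlim : Tendsto (fun k => c (e i) (e (q y k)) +
        W₁ ((ν (q y k)).meas s) ((ν' y).meas s)) atTop (𝓝 (c (e i) y)) := by
      simpa using ((hc.tendsto (e i, y)).comp (tendsto_const_nhds.prodMk_nhds (hq y))).add
        (hν' y s)
    exact ge_of_tendsto' hlim fun k => (W₁_triangle _ ((ν (q y k)).meas s) _).trans
      (add_le_add (h _ _ s) le_rfl)
  refine ⟨ν', hdense, fun y y' s => ?_⟩
  have hlim : Tendsto (fun k => W₁ ((ν (q y k)).meas s) ((ν' y).meas s) + c (e (q y k)) y')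
      atTop (𝓝 (c y y')) := by
    simpa using (hν' y s).add
      ((hc.tendsto (y, y')).comp ((hq y).prodMk_nhds tendsto_const_nhds))
  refine ge_of_tendsto' hlim fun k => (W₁_triangle _ ((ν (q y k)).meas s) _).trans ?_
  rw [W₁_comm]
  exact add_le_add le_rfl (hdense _ _ s)

theorem L1P.exists_modification [FirstCountableTopology Y] [TopologicalSpace.SeparableSpace Y]
    (hc : Continuous (Function.uncurry c)) (hc0 : ∀ y, c y y = 0) (ν : Y → L1P T X)
    (h : ∀ y y', ∀ᵐ s ∂(lebT T), W₁ ((ν y).meas s) ((ν y').meas s) ≤ c y y') :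
    ∃ ν' : Y → L1P T X, (∀ y, ∀ᵐ s ∂(lebT T), (ν' y).meas s = (ν y).meas s) ∧
      ∀ y y' s, W₁ ((ν' y).meas s) ((ν' y').meas s) ≤ c y y' := by
  cases isEmpty_or_nonempty Y
  · exact ⟨ν, isEmptyElim, isEmptyElim⟩
  have he : DenseRange (TopologicalSpace.denseSeq Y) := TopologicalSpace.denseRange_denseSeq Y
  set e := TopologicalSpace.denseSeq Y
  set 𝒢 : Set (Time T) :=
    {s | ∀ i j, W₁ ((ν (e i)).meas s) ((ν (e j)).meas s) ≤ c (e i) (e j)}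
  have h𝒢 : MeasurableSet 𝒢 := by
    simp only [𝒢, ofPred_forall]
    exact MeasurableSet.iInter fun i => MeasurableSet.iInter fun j =>
      measurableSet_le ((ν (e i)).measurable_W₁ _) measurable_const
  have h𝒢ae : ∀ᵐ s ∂(lebT T), s ∈ 𝒢 := ae_all_iff.2 fun i => ae_all_iff.2 fun j => h (e i) (e j)
  obtain ⟨ν', hdense, hν'⟩ := L1P.exists_extension_of_denseRange he hc hc0
    (fun i => (ν (e i)).truncate h𝒢) fun i j s => by
      by_cases hs : s ∈ 𝒢
      · simpa only [L1P.truncate_meas_of_mem _ h𝒢 hs] using hs i j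
      · simp [L1P.truncate_meas_of_notMem _ h𝒢 hs, W₁_self]
  refine ⟨ν', fun y => ?_, hν'⟩
  filter_upwards [h𝒢ae, ae_all_iff.2 fun i => h (e i) y] with s hs hsy
  have hle : ∀ x, W₁ ((ν' y).meas s) ((ν y).meas s) ≤ c x y + c x y := fun x => by
    have hcy : Continuous fun x => c x y := hc.comp (Continuous.prodMk_left y)
    refine he.induction_on x (isClosed_le continuous_const (hcy.add hcy)) fun i => ?_
    refine (W₁_triangle _ ((ν (e i)).meas s) _).trans (add_le_add ?_ (hsy i))
    rw [W₁_comm]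
    simpa only [L1P.truncate_meas_of_mem _ h𝒢 hs] using hdense i y s
  exact eq_of_W₁_eq_zero (le_antisymm (by simpa [hc0] using hle y) bot_le)

theorem L1P.exists_modification_of_tendsto [FirstCountableTopology Y]
    [TopologicalSpace.SeparableSpace Y] (hc : Continuous (Function.uncurry c))
    (hc0 : ∀ y, c y y = 0) {ν : ℕ → Y → L1P T X} {νlim : Y → L1P T X}
    (hν : ∀ k y y' s, W₁ ((ν k y).meas s) ((ν k y').meas s) ≤ c y y')
    (hlim : ∀ y, Tendsto (fun k => ν k y) atTop (𝓝 (νlim y))) :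
    ∃ ν' : Y → L1P T X, (∀ y, ∀ᵐ s ∂(lebT T), (ν' y).meas s = (νlim y).meas s) ∧
      ∀ y y' s, W₁ ((ν' y).meas s) ((ν' y').meas s) ≤ c y y' :=
  L1P.exists_modification hc hc0 νlim fun y y' =>
    L1P.ae_W₁_le_of_tendsto (hlim y) (hlim y') fun k => hν k y y'

end Stability

end TimeDependentMeasures

section Ascoli

theorem isCompact_closure_range_of_equicontinuous {ι Y Z : Type*} [TopologicalSpace Y]
    [CompactlyCoherentSpace Y] [UniformSpace Z] [CompleteSpace Z] (F : ι → C(Y, Z))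
    (hF : Equicontinuous fun i => (F i : Y → Z))
    (hb : ∀ y, TotallyBounded (range fun i => F i y)) : IsCompact (closure (range F)) := by
  let _ : UniformSpace ι := UniformSpace.comap F inferInstance
  have hFi : IsUniformInducing F := ⟨rfl⟩
  have hpi : IsUniformInducing fun i => (F i : Y → Z) := by
    rw [← EquicontinuousOn.isUniformInducing_uniformOnFun_iff_pi (𝔖 := {K | IsCompact K})
      (eq_univ_iff_forall.2 fun y => ⟨{y}, isCompact_singleton, rfl⟩) (fun K hK => hK)
      fun K _ => hF.equicontinuousOn K]
    exact ContinuousMap.isUniformEmbedding_toUniformOnFunIsCompact.isUniformInducing.comp hFi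
  have htb : TotallyBounded (univ : Set ι) := by
    refine totallyBounded_iff_ultrafilter.2 fun u _ => ?_
    rw [← hpi.cauchy_map_iff, cauchy_pi_iff']
    intro y
    refine totallyBounded_iff_ultrafilter.1 (hb y) (u.map fun i => F i y) ?_
    exact le_principal_iff.2 (Filter.mem_map.2 (univ_mem' fun i => mem_range_self i))
  rw [← image_univ]
  exact (htb.image hFi.uniformContinuous).closure.isCompact_of_isClosed isClosed_closure

end Ascoli

section Fourier

variable {n : ℕ}

/-- Normalized Haar measure on the torus of side length one, on which Mathlib's multivariate
Fourier series live. -/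
noncomputable def unitTorusMeasure (n : ℕ) : Measure (UnitAddTorus (Fin n)) :=
  Measure.pi fun _ => AddCircle.haarAddCircle

instance : IsProbabilityMeasure (unitTorusMeasure n) := by
  unfold unitTorusMeasure; infer_instance

theorem hasSum_sq_mFourierCoeff_memLp {g : UnitAddTorus (Fin n) → ℂ}
    (hg : MemLp g 2 (unitTorusMeasure n)) :
    HasSum (fun k : Fin n → ℤ =>
        ‖∫ t, UnitAddTorus.mFourier (-k) t • g t ∂(unitTorusMeasure n)‖ ^ 2)
      (∫ t, ‖g t‖ ^ 2 ∂(unitTorusMeasure n)) := by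
  have h := UnitAddTorus.hasSum_sq_mFourierCoeff (d := Fin n) (hg.toLp g)
  have hcoef : ∀ k : Fin n → ℤ, UnitAddTorus.mFourierCoeff (hg.toLp g) k =
      ∫ t, UnitAddTorus.mFourier (-k) t • g t ∂(unitTorusMeasure n) := fun k =>
    integral_congr_ae (hg.coeFn_toLp.mono fun t ht => by simp only [ht])
  have hnorm : ∫ t, ‖hg.toLp g t‖ ^ 2 ∂(unitTorusMeasure n) =
      ∫ t, ‖g t‖ ^ 2 ∂(unitTorusMeasure n) :=
    integral_congr_ae (hg.coeFn_toLp.mono fun t ht => by simp only [ht])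
  rw [← hnorm]
  simp only [← hcoef]
  exact h

/-- The rescaling of the torus of side length one to the torus of side length `2π`, which carries
Parseval's identity over to `L²_x`. -/
noncomputable def torusRescale (n : ℕ) : UnitAddTorus (Fin n) ≃ᵐ Torus n :=
  (Homeomorph.piCongrRight fun _ : Fin n => AddCircle.homeomorphAddCircle 1 (2 * Real.pi)
    one_ne_zero Real.two_pi_pos.ne').toMeasurableEquiv

theorem torusRescale_apply (x : UnitAddTorus (Fin n)) (j : Fin n) : torusRescale n x j =
    AddCircle.homeomorphAddCircle 1 (2 * Real.pi) one_ne_zero Real.two_pi_pos.ne' (x j) := rfl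

theorem fourier_homeomorphAddCircle (k : ℤ) (x : AddCircle (1 : ℝ)) :
    fourier k (AddCircle.homeomorphAddCircle 1 (2 * Real.pi) one_ne_zero Real.two_pi_pos.ne' x) =
      fourier k x := by
  induction x using QuotientAddGroup.induction_on with
  | H x =>
    rw [AddCircle.homeomorphAddCircle_apply_mk, fourier_coe_apply, fourier_coe_apply]
    congr 1
    have : (Real.pi : ℂ) ≠ 0 := by exact_mod_cast Real.pi_ne_zero
    push_cast
    field_simp

theorem measurePreserving_homeomorphAddCircle :
    MeasurePreserving (AddCircle.homeomorphAddCircle 1 (2 * Real.pi) one_ne_zero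
      Real.two_pi_pos.ne') AddCircle.haarAddCircle AddCircle.haarAddCircle :=
  AddMonoidHom.measurePreserving
    (f := (AddCircle.equivAddCircle 1 (2 * Real.pi) one_ne_zero Real.two_pi_pos.ne').toAddMonoidHom)
    (AddCircle.homeomorphAddCircle 1 (2 * Real.pi) one_ne_zero Real.two_pi_pos.ne').continuous
    (AddCircle.equivAddCircle 1 (2 * Real.pi) one_ne_zero Real.two_pi_pos.ne').surjective
    (by simp)

theorem volume_torus_eq : (volume : Measure (Torus n)) =
    ENNReal.ofReal (2 * Real.pi) ^ n • Measure.pi fun _ => AddCircle.haarAddCircle := by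
  refine Measure.pi_eq fun s _ => ?_
  rw [Measure.smul_apply, Measure.pi_pi]
  simp [AddCircle.volume_eq_smul_haarAddCircle, Finset.prod_mul_distrib]

theorem measurePreserving_torusRescale :
    MeasurePreserving (torusRescale n) (unitTorusMeasure n)
      (Measure.pi fun _ => AddCircle.haarAddCircle) :=
  measurePreserving_pi _ _ fun _ => measurePreserving_homeomorphAddCircle

theorem integral_comp_torusRescale {E : Type*} [NormedAddCommGroup E] [NormedSpace ℝ E]
    (f : Torus n → E) : ∫ x, f (torusRescale n x) ∂(unitTorusMeasure n) =
      ((2 * Real.pi) ^ n)⁻¹ • ∫ x, f x := by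
  rw [measurePreserving_torusRescale.integral_comp (torusRescale n).measurableEmbedding,
    volume_torus_eq, integral_smul_measure, smul_smul]
  have : ((2 * Real.pi) ^ n)⁻¹ * (ENNReal.ofReal (2 * Real.pi) ^ n).toReal = 1 := by
    rw [ENNReal.toReal_pow, ENNReal.toReal_ofReal Real.two_pi_pos.le]
    exact inv_mul_cancel₀ (pow_pos Real.two_pi_pos n).ne'
  rw [this, one_smul]

theorem memLp_comp_torusRescale {f : Torus n → ℂ} (hf : MemLp f 2) :
    MemLp (fun x => f (torusRescale n x)) 2 (unitTorusMeasure n) := by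
  have h : MemLp f 2 (Measure.pi fun _ => AddCircle.haarAddCircle) := by
    rw [volume_torus_eq] at hf
    refine hf.of_measure_le_smul (c := (ENNReal.ofReal (2 * Real.pi) ^ n)⁻¹)
      (by simp [Real.pi_pos]) ?_
    rw [smul_smul, ENNReal.inv_mul_cancel (by simp [Real.pi_pos]) (by finiteness), one_smul]
  exact h.comp_measurePreserving measurePreserving_torusRescale

theorem L2x.memLp_apply (u : L2x n) (i : Fin n) : MemLp (fun x => ((u x i : ℝ) : ℂ)) 2 := by
  have h : MemLp (fun x => u x i) 2 := (Lp.memLp u).continuousLinearMap_comp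
    (EuclideanSpace.proj (𝕜 := ℝ) i)
  exact h.ofReal

theorem fourierCoef_apply (u : L2x n) (k : Fin n → ℤ) (i : Fin n) : fourierCoef u k i =
    ∫ x, UnitAddTorus.mFourier (-k) x • ((u (torusRescale n x) i : ℝ) : ℂ)
      ∂(unitTorusMeasure n) := by
  have h := integral_comp_torusRescale (n := n)
    (fun x => (∏ j, fourier (-(k j)) (x j)) * ((u x i : ℝ) : ℂ))
  simp only [torusRescale_apply, fourier_homeomorphAddCircle] at h
  rw [Complex.real_smul] at h
  push_cast at h
  exact h.symm

theorem hasSum_sq_fourierCoef_apply (u : L2x n) (i : Fin n) :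
    HasSum (fun k => ‖fourierCoef u k i‖ ^ 2) (((2 * Real.pi) ^ n)⁻¹ * ∫ x, ‖u x i‖ ^ 2) := by
  have h := hasSum_sq_mFourierCoeff_memLp (memLp_comp_torusRescale (u.memLp_apply i))
  simp only [← fourierCoef_apply] at h
  rw [integral_comp_torusRescale fun x => ‖((u x i : ℝ) : ℂ)‖ ^ 2] at h
  simpa using h

theorem hasSum_sq_fourierCoef (u : L2x n) :
    HasSum (fun k => (2 * Real.pi) ^ n * ‖fourierCoef u k‖ ^ 2) (‖u‖ ^ 2) := by
  have hint : ∀ i, Integrable fun x => ‖u x i‖ ^ 2 := fun i => by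
    simpa using (u.memLp_apply i).integrable_norm_pow (by simp)
  have hnorm : ‖u‖ ^ 2 = ∑ i, ∫ x, ‖u x i‖ ^ 2 := by
    rw [← integral_finsetSum _ fun i _ => hint i, ← real_inner_self_eq_norm_sq, L2.inner_def]
    refine integral_congr_ae (Eventually.of_forall fun x => ?_)
    simp only [real_inner_self_eq_norm_sq]
    exact EuclideanSpace.norm_sq_eq _
  have h := (hasSum_sum fun i (_ : i ∈ Finset.univ) =>
    hasSum_sq_fourierCoef_apply u i).mul_left ((2 * Real.pi) ^ n)
  rw [← Finset.mul_sum, mul_inv_cancel_left₀ (pow_pos Real.two_pi_pos n).ne', ← hnorm] at h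
  simpa only [EuclideanSpace.norm_sq_eq] using h

theorem sq_norm_fourierCoef_le (u : L2x n) (k : Fin n → ℤ) :
    (2 * Real.pi) ^ n * ‖fourierCoef u k‖ ^ 2 ≤ ‖u‖ ^ 2 :=
  le_hasSum (hasSum_sq_fourierCoef u) k fun _ _ => by positivity

theorem integrable_mFourier_mul (u : L2x n) (k : Fin n → ℤ) (i : Fin n) :
    Integrable (fun x => UnitAddTorus.mFourier (-k) x • ((u (torusRescale n x) i : ℝ) : ℂ))
      (unitTorusMeasure n) := by
  have h := (memLp_comp_torusRescale (u.memLp_apply i)).integrable (by norm_num)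
  refine h.bdd_smul 1 (UnitAddTorus.mFourier (-k)).continuous.aestronglyMeasurable
    (Eventually.of_forall fun x => ?_)
  exact ((UnitAddTorus.mFourier (-k)).norm_coe_le_norm x).trans UnitAddTorus.mFourier_norm.le

theorem ae_comp_torusRescale {p : Torus n → Prop} (h : ∀ᵐ x, p x) :
    ∀ᵐ x ∂(unitTorusMeasure n), p (torusRescale n x) := by
  refine measurePreserving_torusRescale.quasiMeasurePreserving.ae ?_
  rw [volume_torus_eq] at h
  rwa [ae_iff, Measure.smul_apply, smul_eq_mul, mul_eq_zero, or_iff_right] at h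
  exact pow_ne_zero _ (by simp [Real.pi_pos])

/-- The Fourier coefficient `u ↦ û_k` as a continuous linear map. -/
noncomputable def fourierCoefL (k : Fin n → ℤ) : L2x n →L[ℝ] EuclideanSpace ℂ (Fin n) :=
  LinearMap.mkContinuousOfExistsBound
    { toFun := fun u => fourierCoef u k
      map_add' := fun u v => by
        ext i
        rw [PiLp.add_apply, fourierCoef_apply, fourierCoef_apply, fourierCoef_apply,
          ← integral_add (integrable_mFourier_mul u k i) (integrable_mFourier_mul v k i)]
        refine integral_congr_ae ((ae_comp_torusRescale (Lp.coeFn_add u v)).mono fun x hx => ?_)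
        simp only [hx, Pi.add_apply, PiLp.add_apply, Complex.ofReal_add, smul_add]
      map_smul' := fun c u => by
        ext i
        rw [PiLp.smul_apply, fourierCoef_apply, fourierCoef_apply, RingHom.id_apply,
          ← integral_smul]
        refine integral_congr_ae ((ae_comp_torusRescale (Lp.coeFn_smul c u)).mono fun x hx => ?_)
        simp only [hx, Pi.smul_apply, PiLp.smul_apply, smul_eq_mul, Complex.ofReal_mul,
          Complex.real_smul]
        ring }
    (by
      have hpos : (0 : ℝ) < (2 * Real.pi) ^ n := pow_pos Real.two_pi_pos n
      refine ⟨√(((2 * Real.pi) ^ n)⁻¹), fun u => ?_⟩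
      change ‖fourierCoef u k‖ ≤ _
      rw [← Real.sqrt_sq (norm_nonneg u), ← Real.sqrt_mul (by positivity)]
      refine Real.le_sqrt_of_sq_le ?_
      rw [inv_mul_eq_div, le_div_iff₀' hpos]
      exact sq_norm_fourierCoef_le u k)

theorem measurable_gradNormSq : Measurable (gradNormSq : L2x n → ℝ≥0∞) := by
  refine Measurable.tsum fun k => ?_
  have : Measurable fun u : L2x n => fourierCoef u k := (fourierCoefL k).continuous.measurable
  fun_prop

theorem waveSq_nonneg (k : Fin n → ℤ) : 0 ≤ waveSq k := Finset.sum_nonneg fun _ _ => sq_nonneg _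

theorem finite_waveSq_le (r : ℝ) : {k : Fin n → ℤ | waveSq k ≤ r}.Finite := by
  refine (Set.finite_Icc (fun _ : Fin n => -⌈r⌉) (fun _ => ⌈r⌉)).subset fun k hk => ?_
  have hsq : ∀ j, k j ^ 2 ≤ ⌈r⌉ := fun j => by
    have hj : (k j : ℝ) ^ 2 ≤ waveSq k :=
      Finset.single_le_sum (f := fun j => (k j : ℝ) ^ 2) (fun _ _ => sq_nonneg _)
        (Finset.mem_univ j)
    exact_mod_cast (hj.trans hk).trans (Int.le_ceil r)
  have habs : ∀ j, |k j| ≤ ⌈r⌉ := fun j =>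
    (Int.le_self_sq |k j|).trans ((sq_abs (k j)).trans_le (hsq j))
  exact ⟨fun j => (abs_le.1 (habs j)).1, fun j => (abs_le.1 (habs j)).2⟩

theorem enorm_fourierCoef_le_sobolevNorm (s : ℝ) (u : L2x n) (k : Fin n → ℤ) :
    ‖fourierCoef u k‖ₑ ≤
      ENNReal.ofReal (√((2 * Real.pi) ^ n * (1 + waveSq k) ^ s)⁻¹) * sobolevNorm s u := by
  set w : ℝ := (2 * Real.pi) ^ n * (1 + waveSq k) ^ s
  have hw : 0 < w := mul_pos (pow_pos Real.two_pi_pos n)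
    (Real.rpow_pos_of_pos (by linarith [waveSq_nonneg k]) _)
  have hmode : ENNReal.ofReal (√w * ‖fourierCoef u k‖) ≤ sobolevNorm s u := by
    rw [sobolevNorm, one_div, ENNReal.le_rpow_inv_iff two_pos]
    refine le_trans (le_of_eq ?_) (ENNReal.le_tsum k)
    rw [ENNReal.ofReal_rpow_of_nonneg (by positivity) zero_le_two, Real.rpow_two, mul_pow,
      Real.sq_sqrt hw.le, ← mul_assoc]
  calc ‖fourierCoef u k‖ₑ = ENNReal.ofReal (√w⁻¹ * (√w * ‖fourierCoef u k‖)) := by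
        rw [← mul_assoc, ← Real.sqrt_mul (inv_nonneg.2 hw.le), inv_mul_cancel₀ hw.ne',
          Real.sqrt_one, one_mul, ofReal_norm]
    _ ≤ ENNReal.ofReal √w⁻¹ * sobolevNorm s u := by
        rw [ENNReal.ofReal_mul (Real.sqrt_nonneg _)]
        gcongr

end Fourier

section FiniteRank

variable {n : ℕ} (A : Finset (Fin n → ℤ))

/-- The Fourier coefficients with wave vector in the finite set `A`, as a continuous linear map. -/
noncomputable def fourierCoefsL : L2x n →L[ℝ] (A → EuclideanSpace ℂ (Fin n)) :=
  ContinuousLinearMap.pi fun k => fourierCoefL (k : Fin n → ℤ)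

/-- The space of fields whose Fourier modes lie in `A`. Defining it as the orthogonal complement of
the fields whose coefficients in `A` vanish avoids discussing which Fourier coefficients belong to
real fields. -/
noncomputable def modeSpace : Submodule ℝ (L2x n) := (fourierCoefsL A).kerᗮ

/-- The Fourier truncation to the modes in `A`, as an orthogonal projection. -/
noncomputable def modeProj : L2x n →L[ℝ] L2x n := (fourierCoefsL A).kerᗮ.starProjection

theorem modeProj_mem (v : L2x n) : modeProj A v ∈ modeSpace A :=
  (fourierCoefsL A).kerᗮ.starProjection_apply_mem v

theorem sub_modeProj (v : L2x n) :
    v - modeProj A v = (fourierCoefsL A).ker.starProjection v := by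
  rw [modeProj, Submodule.starProjection_orthogonal_val, sub_sub_cancel]

theorem fourierCoefsL_modeProj (v : L2x n) :
    fourierCoefsL A (modeProj A v) = fourierCoefsL A v := by
  have h : fourierCoefsL A (v - modeProj A v) = 0 :=
    sub_modeProj A v ▸ (fourierCoefsL A).ker.starProjection_apply_mem v
  rw [map_sub, sub_eq_zero] at h
  exact h.symm

theorem injective_fourierCoefsL_modeSpace :
    Function.Injective ((fourierCoefsL A).toLinearMap.comp (modeSpace A).subtype) := by
  rw [← LinearMap.ker_eq_bot, LinearMap.ker_eq_bot']
  rintro ⟨x, hx⟩ h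
  have hker : x ∈ (fourierCoefsL A).ker := h
  ext1
  exact (Submodule.mem_bot ℝ).1
    ((fourierCoefsL A).ker.inf_orthogonal_eq_bot ▸ (⟨hker, hx⟩ : _ ∧ _))

instance : FiniteDimensional ℝ (modeSpace A) :=
  FiniteDimensional.of_injective _ (injective_fourierCoefsL_modeSpace A)

theorem sq_norm_sub_modeProj_eq (v : L2x n) :
    ‖v - modeProj A v‖ ^ 2 = ‖v‖ ^ 2 - ‖modeProj A v‖ ^ 2 := by
  rw [Submodule.norm_sq_eq_add_norm_sq_starProjection v (fourierCoefsL A).ker, ← sub_modeProj]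
  exact (add_sub_cancel_right _ _).symm

theorem ofReal_sq_norm_sub_modeProj_le {ε : ℝ} (hε : 0 ≤ ε) (h : ∀ k ∉ A, 1 ≤ ε * waveSq k)
    (v : L2x n) :
    ENNReal.ofReal (‖v - modeProj A v‖ ^ 2) ≤ ENNReal.ofReal ε * gradNormSq v := by
  classical
  set E : (Fin n → ℤ) → ℝ := fun k => (2 * Real.pi) ^ n * ‖fourierCoef v k‖ ^ 2 with hE
  have hE0 : ∀ k, 0 ≤ E k := fun k => by positivity
  have hEs : HasSum E (‖v‖ ^ 2) := hasSum_sq_fourierCoef v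
  have htail : HasSum (indicator (A : Set (Fin n → ℤ))ᶜ E)
      (∑' k, indicator (A : Set (Fin n → ℤ))ᶜ E k) := (hEs.summable.indicator _).hasSum
  have hle : ‖v - modeProj A v‖ ^ 2 ≤ ∑' k, indicator (A : Set (Fin n → ℤ))ᶜ E k := by
    rw [sq_norm_sub_modeProj_eq]
    refine hasSum_le (fun k => ?_) (hEs.sub (hasSum_sq_fourierCoef (modeProj A v))) htail
    by_cases hk : k ∈ A
    · have hcoef : fourierCoef (modeProj A v) k = fourierCoef v k :=
        congrFun (fourierCoefsL_modeProj A v) ⟨k, hk⟩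
      simp [hE, hk, hcoef]
    · rw [indicator_of_mem (by simpa using hk)]
      exact sub_le_self _ (by positivity)
  refine (ENNReal.ofReal_le_ofReal hle).trans ?_
  rw [ENNReal.ofReal_tsum_of_nonneg (fun k => indicator_nonneg (fun k _ => hE0 k) k)
    htail.summable, gradNormSq, ← ENNReal.tsum_mul_left]
  refine ENNReal.tsum_le_tsum fun k => ?_
  rw [← ENNReal.ofReal_mul hε]
  refine ENNReal.ofReal_le_ofReal ?_
  calc indicator (A : Set (Fin n → ℤ))ᶜ E k ≤ (ε * waveSq k) * E k := by
        by_cases hk : k ∈ A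
        · simpa [hk] using mul_nonneg (mul_nonneg hε (waveSq_nonneg k)) (hE0 k)
        · rw [indicator_of_mem (by simpa using hk)]
          exact le_mul_of_one_le_left (hE0 k) (h k hk)
    _ = ε * ((2 * Real.pi) ^ n * (waveSq k * ‖fourierCoef v k‖ ^ 2)) := by ring

theorem exists_enorm_modeProj_le_sobolevNorm (s : ℝ) :
    ∃ C : ℝ≥0, ∀ v, ‖modeProj A v‖ₑ ≤ C * sobolevNorm s v := by
  obtain ⟨C, -, hC⟩ := LinearMap.exists_antilipschitzWith
    ((fourierCoefsL A).toLinearMap.comp (modeSpace A).subtype)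
    (LinearMap.ker_eq_bot.2 (injective_fourierCoefsL_modeSpace A))
  set D : (Fin n → ℤ) → ℝ≥0 := fun k =>
    Real.toNNReal √((2 * Real.pi) ^ n * (1 + waveSq k) ^ s)⁻¹
  refine ⟨C * A.sup D, fun v => ?_⟩
  calc ‖modeProj A v‖ₑ ≤ C * ‖fourierCoefsL A v‖ₑ := by
        have h := hC ⟨modeProj A v, modeProj_mem A v⟩ 0
        rw [map_zero, edist_zero_right, edist_zero_right] at h
        rw [← fourierCoefsL_modeProj]
        exact h
    _ ≤ C * (A.sup D * sobolevNorm s v) := by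
        gcongr
        rw [← edist_zero_right, edist_pi_le_iff]
        intro k
        rw [Pi.zero_apply, edist_zero_right]
        refine (enorm_fourierCoef_le_sobolevNorm s v k).trans ?_
        gcongr
        exact ENNReal.coe_le_coe.2 (Finset.le_sup (f := D) k.2)
    _ = _ := by rw [ENNReal.coe_mul, mul_assoc]

theorem exists_finiteRank_approx (n : ℕ) {ε : ℝ} (hε : 0 < ε) :
    ∃ P : L2x n →L[ℝ] L2x n, FiniteDimensional ℝ P.range ∧ (∀ v, ‖P v‖ ≤ ‖v‖) ∧
      (∀ v, ENNReal.ofReal (‖v - P v‖ ^ 2) ≤ ENNReal.ofReal ε * gradNormSq v) ∧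
      ∀ s : ℝ, ∃ C : ℝ≥0, ∀ v, ‖P v‖ₑ ≤ C * sobolevNorm s v := by
  set A : Finset (Fin n → ℤ) := (finite_waveSq_le (n := n) ε⁻¹).toFinset with hA
  refine ⟨modeProj A, Submodule.finiteDimensional_of_le (S₂ := modeSpace A) ?_,
    fun v => (fourierCoefsL A).kerᗮ.norm_starProjection_apply_le v,
    ofReal_sq_norm_sub_modeProj_le A hε.le fun k hk => ?_,
    exists_enorm_modeProj_le_sobolevNorm A⟩
  · rintro _ ⟨v, rfl⟩
    exact modeProj_mem A v
  · have hk : ε⁻¹ < waveSq k := by simpa [hA] using hk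
    exact ((inv_lt_iff_one_lt_mul₀' hε).1 hk).le

end FiniteRank

section GammaNorm

variable {d N : ℕ} {Γ : Matrix (Fin d) (Fin d) ℝ}

theorem exists_gammaNorm_eq_norm (hΓ : Γ.PosDef) :
    ∃ A : EuclideanSpace ℝ (Fin d) ≃L[ℝ] EuclideanSpace ℝ (Fin d), ∀ y, gammaNorm Γ y = ‖A y‖ := by
  obtain ⟨B, hB⟩ : ∃ B : Matrix (Fin d) (Fin d) ℝ, Γ⁻¹ = Bᴴ * B := by
    open scoped MatrixOrder in
    exact CStarAlgebra.nonneg_iff_eq_star_mul_self.mp hΓ.inv.posSemidef.nonneg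
  set f : EuclideanSpace ℝ (Fin d) →ₗ[ℝ] EuclideanSpace ℝ (Fin d) := Matrix.toEuclideanLin B with hf
  have hnorm : ∀ y, y.ofLp ⬝ᵥ (Γ⁻¹ *ᵥ y.ofLp) = ‖f y‖ ^ 2 := fun y => by
    rw [hB, ← Matrix.mulVec_mulVec, Matrix.conjTranspose_eq_transpose_of_trivial,
      Matrix.dotProduct_mulVec, Matrix.vecMul_transpose, EuclideanSpace.norm_sq_eq]
    simp [dotProduct, hf, sq, Matrix.toEuclideanLin]
  have hinj : Function.Injective f := by
    rw [← LinearMap.ker_eq_bot, LinearMap.ker_eq_bot']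
    intro y hy
    by_contra hne
    have hpos := hΓ.inv.dotProduct_mulVec_pos (x := y.ofLp) (by simpa using hne)
    rw [star_trivial, hnorm, hy] at hpos
    simp at hpos
  refine ⟨(LinearEquiv.ofInjectiveEndo f hinj).toContinuousLinearEquiv, fun y => ?_⟩
  rw [gammaNorm, hnorm, Real.sqrt_sq (norm_nonneg _)]
  rfl

theorem exists_gammaNormN_eq_norm (hΓ : Γ.PosDef) :
    ∃ A : (Fin N → EuclideanSpace ℝ (Fin d)) ≃L[ℝ]
      PiLp 2 (fun _ : Fin N => EuclideanSpace ℝ (Fin d)), ∀ y, gammaNormN Γ y = ‖A y‖ := by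
  obtain ⟨A, hA⟩ := exists_gammaNorm_eq_norm hΓ
  refine ⟨(ContinuousLinearEquiv.piCongrRight fun _ : Fin N => A).trans
    (PiLp.continuousLinearEquiv 2 ℝ (fun _ : Fin N => EuclideanSpace ℝ (Fin d))).symm, fun y => ?_⟩
  rw [gammaNormN, PiLp.norm_eq_of_L2]
  simp [hA]

theorem gammaNorm_nonneg (Γ : Matrix (Fin d) (Fin d) ℝ) (y : EuclideanSpace ℝ (Fin d)) :
    0 ≤ gammaNorm Γ y := Real.sqrt_nonneg _

theorem gammaNormN_nonneg (Γ : Matrix (Fin d) (Fin d) ℝ) (y : Fin N → EuclideanSpace ℝ (Fin d)) :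
    0 ≤ gammaNormN Γ y := Real.sqrt_nonneg _

theorem gammaNorm_apply_le (Γ : Matrix (Fin d) (Fin d) ℝ) (y : Fin N → EuclideanSpace ℝ (Fin d))
    (j : Fin N) : gammaNorm Γ (y j) ≤ gammaNormN Γ y :=
  Real.le_sqrt_of_sq_le (Finset.single_le_sum (f := fun j => gammaNorm Γ (y j) ^ 2)
    (fun _ _ => sq_nonneg _) (Finset.mem_univ j))

theorem continuous_gammaNorm (hΓ : Γ.PosDef) : Continuous (gammaNorm Γ) := by
  obtain ⟨A, hA⟩ := exists_gammaNorm_eq_norm hΓ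
  exact A.continuous.norm.congr fun y => (hA y).symm

theorem continuous_gammaNormN (hΓ : Γ.PosDef) :
    Continuous (gammaNormN Γ : (Fin N → EuclideanSpace ℝ (Fin d)) → ℝ) := by
  obtain ⟨A, hA⟩ := exists_gammaNormN_eq_norm (N := N) hΓ
  exact A.continuous.norm.congr fun y => (hA y).symm

theorem isCompact_gammaNormN_le (hΓ : Γ.PosDef) (R : ℝ) :
    IsCompact {y : Fin N → EuclideanSpace ℝ (Fin d) | gammaNormN Γ y ≤ R} := by
  obtain ⟨A, hA⟩ := exists_gammaNormN_eq_norm (N := N) hΓ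
  have : {y | gammaNormN Γ y ≤ R} = A ⁻¹' Metric.closedBall 0 R := by
    ext y; simp [hA]
  rw [this, ← ContinuousLinearEquiv.coe_toHomeomorph, Homeomorph.isCompact_preimage]
  exact isCompact_closedBall 0 R

variable {ρ : EuclideanSpace ℝ (Fin d) → ℝ}

theorem IsNoiseDensity.continuous (hΓ : Γ.PosDef) (hρ : IsNoiseDensity Γ ρ) : Continuous ρ := by
  obtain ⟨L, -, hLip⟩ := hρ.lipschitz
  refine continuous_iff_continuousAt.2 fun y => tendsto_iff_dist_tendsto_zero.2 ?_
  have hlim : Tendsto (fun x => L * gammaNorm Γ (x - y)) (𝓝 y) (𝓝 0) := by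
    have hcont : Continuous fun x => L * gammaNorm Γ (x - y) :=
      continuous_const.mul ((continuous_gammaNorm hΓ).comp (continuous_id.sub continuous_const))
    simpa [gammaNorm] using hcont.tendsto y
  exact squeeze_zero (fun _ => dist_nonneg) (fun x => (Real.dist_eq _ _).trans_le (hLip x y)) hlim

theorem exists_gammaNorm_sub_le (hΓ : Γ.PosDef) :
    ∃ C : ℝ, 0 ≤ C ∧ ∀ y z, gammaNorm Γ (y - z) ≤ gammaNorm Γ y + C * ‖z‖ := by
  obtain ⟨A, hA⟩ := exists_gammaNorm_eq_norm hΓ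
  refine ⟨‖A.toContinuousLinearMap‖, norm_nonneg _, fun y z => ?_⟩
  rw [hA, hA, map_sub]
  exact (norm_sub_le _ _).trans (add_le_add_right (A.toContinuousLinearMap.le_opNorm z) _)

theorem IsNoiseDensity.exists_lower_bound (hΓ : Γ.PosDef) (hρ : IsNoiseDensity Γ ρ) :
    ∃ m : ℝ → ℝ → ℝ, (∀ R K, 0 < m R K) ∧ (∀ R K, m R K ≤ 1) ∧
      (∀ K, Continuous fun R => m R K) ∧ (∀ K, Antitone fun R => m R K) ∧
      ∀ R K y z, gammaNorm Γ y ≤ R → ‖z‖ ≤ K → m R K ≤ ρ (y - z) := by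
  obtain ⟨C, hC, hsub⟩ := exists_gammaNorm_sub_le hΓ
  obtain ⟨c, hc, htail⟩ := hρ.tail
  have hmono : ∀ {a b : ℝ}, 0 ≤ a → a ≤ b →
      Real.exp (-(1 / 2) * b ^ 2) / c ≤ Real.exp (-(1 / 2) * a ^ 2) / c := fun {a b} ha hab => by
    have := pow_le_pow_left₀ ha hab 2
    gcongr ?_ / c
    exact Real.exp_le_exp.2 (by linarith)
  refine ⟨fun R K => min (Real.exp (-(1 / 2) * (max R 0 + C * max K 0) ^ 2) / c) 1,
    fun R K => by positivity, fun R K => min_le_right _ _, fun K => by fun_prop,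
    fun K R R' hR => ?_, fun R K y z hy hz => ?_⟩
  · refine min_le_min_right _ (hmono (by positivity) ?_)
    gcongr
  · refine (min_le_left _ _).trans (le_trans ?_ (htail (y - z)))
    refine hmono (gammaNorm_nonneg Γ _) ((hsub y z).trans (add_le_add ?_ ?_))
    · exact hy.trans (le_max_left R 0)
    · gcongr
      exact hz.trans (le_max_left K 0)

end GammaNorm

section Observables

variable {T : ℝ} {n d N : ℕ}

theorem measurable_of_measurable_edist {α Y : Type*} [MeasurableSpace α] [PseudoEMetricSpace Y]
    [SecondCountableTopology Y] [MeasurableSpace Y] [BorelSpace Y] {f : α → Y}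
    (hf : ∀ y, Measurable fun a => edist (f a) y) : Measurable f := by
  refine measurable_of_isOpen fun U hU => ?_
  choose! r hr hrU using EMetric.isOpen_iff.1 hU
  obtain ⟨c, hc, hcU⟩ := TopologicalSpace.isOpen_iUnion_countable
    (fun x : U => Metric.eball (x : Y) (r x)) fun _ => Metric.isOpen_eball
  have hU' : U = ⋃ x ∈ c, Metric.eball (x : Y) (r x) := by
    rw [hcU]
    exact Subset.antisymm (fun x hx => mem_iUnion.2 ⟨⟨x, hx⟩, Metric.mem_eball_self (hr x hx)⟩)
      (iUnion_subset fun x => hrU x x.2)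
  rw [hU']
  simp only [preimage_iUnion]
  exact MeasurableSet.biUnion hc fun x _ => measurableSet_lt (hf x) measurable_const

section LipschitzObservables

variable {t : Fin (N + 1) → ℝ} {G : Fin N → PathSpace T n → EuclideanSpace ℝ (Fin d)} {L : ℝ}

theorem LipschitzObservables.norm_sub_le (hG : LipschitzObservables t G L) (j : Fin N)
    (u u' : PathSpace T n) : ‖G j u - G j u'‖ ≤ |L| * ‖u - u'‖ := by
  have hint : Integrable (fun s => ‖u s - u' s‖) (lebT T) :=
    ((L1.integrable_coeFn u).sub (L1.integrable_coeFn u')).norm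
  have hnorm : ∫ s, ‖u s - u' s‖ ∂(lebT T) = ‖u - u'‖ := by
    rw [L1.norm_eq_integral_norm]
    exact integral_congr_ae ((Lp.coeFn_sub u u').mono fun s hs => by
      simp only [hs, Pi.sub_apply])
  refine (hG j u u').trans ?_
  rw [← hnorm]
  exact mul_le_mul (le_abs_self L) (setIntegral_le_integral hint
    (Eventually.of_forall fun _ => norm_nonneg _)) (integral_nonneg fun _ => norm_nonneg _)
    (abs_nonneg L)

theorem LipschitzObservables.continuous (hG : LipschitzObservables t G L) (j : Fin N) :
    Continuous (G j) :=
  (LipschitzWith.of_dist_le_mul (K := |L|.toNNReal) fun u u' => by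
    rw [dist_eq_norm, dist_eq_norm, Real.coe_toNNReal _ (abs_nonneg L)]
    exact hG.norm_sub_le j u u').continuous

end LipschitzObservables

variable {S : Time T → L2x n → L2x n}

theorem measurable_edist_trajectory (hS : Measurable fun p : Time T × L2x n => S p.1 p.2)
    (f : PathSpace T n) : Measurable fun u => edist (trajectory S u) f := by
  have hmem : ∀ u, MemLp (fun s => S s u) 1 (lebT T) ↔ ∫⁻ s, ‖S s u‖ₑ ∂(lebT T) < ∞ := fun u => by
    have hSu : Measurable fun s => S s u := hS.comp measurable_prodMk_right
    rw [memLp_one_iff_integrable, Integrable, and_iff_right hSu.aestronglyMeasurable]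
    rfl
  have hfin : MeasurableSet {u | ∫⁻ s, ‖S s u‖ₑ ∂(lebT T) < ∞} :=
    measurableSet_lt (Measurable.lintegral_prod_left' (f := fun p : Time T × L2x n => ‖S p.1 p.2‖ₑ)
      hS.enorm) measurable_const
  have hf : Measurable (f : Time T → L2x n) := (Lp.stronglyMeasurable f).measurable
  have hdist : Measurable fun u => ∫⁻ s, edist (S s u) (f s) ∂(lebT T) :=
    Measurable.lintegral_prod_left' (f := fun p : Time T × L2x n => edist (S p.1 p.2) (f p.1))
      (hS.edist (hf.comp measurable_fst))
  classical
  have heq : (fun u => edist (trajectory S u) f) = fun u =>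
      if ∫⁻ s, ‖S s u‖ₑ ∂(lebT T) < ∞ then ∫⁻ s, edist (S s u) (f s) ∂(lebT T)
      else edist 0 f := by
    ext u
    by_cases hu : MemLp (fun s => S s u) 1 (lebT T)
    · rw [if_pos ((hmem u).1 hu), trajectory, dif_pos hu, Lp.edist_def,
        eLpNorm_one_eq_lintegral_enorm]
      refine lintegral_congr_ae (hu.coeFn_toLp.mono fun s hs => ?_)
      simp only [Pi.sub_apply, hs, edist_eq_enorm_sub]
    · rw [if_neg fun h => hu ((hmem u).2 h), trajectory, dif_neg hu]
  rw [heq]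
  exact Measurable.ite hfin hdist measurable_const

theorem measurable_comp_trajectory {Y : Type*} [TopologicalSpace Y] [MeasurableSpace Y]
    [BorelSpace Y] (hS : Measurable fun p : Time T × L2x n => S p.1 p.2) {g : PathSpace T n → Y}
    (hg : Continuous g) : Measurable fun u => g (trajectory S u) := by
  borelize (PathSpace T n)
  have : Fact ((1 : ℝ≥0∞) ≠ ∞) := ⟨ENNReal.one_ne_top⟩
  have : SecondCountableTopology (PathSpace T n) := Lp.SecondCountableTopology
  exact hg.measurable.comp (measurable_of_measurable_edist (measurable_edist_trajectory hS))

theorem norm_trajectory_le (hS : Measurable fun p : Time T × L2x n => S p.1 p.2) (hT : 0 ≤ T)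
    {u : L2x n} {M : ℝ} (hu : ∀ s, ‖S s u‖ ≤ M) : ‖trajectory S u‖ ≤ T * M := by
  have hSu : Measurable fun s => S s u := hS.comp measurable_prodMk_right
  have hmem : MemLp (fun s => S s u) 1 (lebT T) :=
    MemLp.of_bound hSu.aestronglyMeasurable M (Eventually.of_forall hu)
  rw [trajectory, dif_pos hmem, L1.norm_eq_integral_norm]
  calc ∫ s, ‖hmem.toLp _ s‖ ∂(lebT T) = ∫ s, ‖S s u‖ ∂(lebT T) :=
        integral_congr_ae (hmem.coeFn_toLp.mono fun s hs => by simp only [hs])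
    _ ≤ ∫ _s, M ∂(lebT T) :=
        integral_mono (hmem.integrable le_rfl).norm (integrable_const M) hu
    _ = T * M := by
        rw [integral_const, Measure.real, lebT_univ, ENNReal.toReal_ofReal hT, smul_eq_mul]

theorem LipschitzObservables.norm_trajectory_le {t : Fin (N + 1) → ℝ}
    {G : Fin N → PathSpace T n → EuclideanSpace ℝ (Fin d)} {L g₀ M : ℝ}
    (hG : LipschitzObservables t G L) (hg : ∀ j, ‖G j 0‖ ≤ g₀)
    (hS : Measurable fun p : Time T × L2x n => S p.1 p.2) (hT : 0 ≤ T) {u : L2x n}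
    (hu : ∀ s, ‖S s u‖ ≤ M) (j : Fin N) : ‖G j (trajectory S u)‖ ≤ g₀ + |L| * (T * M) :=
  calc ‖G j (trajectory S u)‖ ≤ ‖G j 0‖ + ‖G j (trajectory S u) - G j 0‖ :=
        norm_le_norm_add_norm_sub' _ _
    _ ≤ g₀ + |L| * ‖trajectory S u - 0‖ := add_le_add (hg j) (hG.norm_sub_le j _ 0)
    _ ≤ g₀ + |L| * (T * M) := by
        rw [sub_zero]
        gcongr
        exact FilteringNS.norm_trajectory_le hS hT hu

end Observables

section Likelihood

theorem abs_prod_sub_prod_le {ι : Type*} (s : Finset ι) {f g : ι → ℝ} {B δ : ℝ} (hB : 1 ≤ B)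
    (hf : ∀ i, |f i| ≤ B) (hg : ∀ i, |g i| ≤ B) (hfg : ∀ i, |f i - g i| ≤ δ) (hδ : 0 ≤ δ) :
    |∏ i ∈ s, f i - ∏ i ∈ s, g i| ≤ s.card * B ^ s.card * δ := by
  classical
  have : 0 ≤ B := zero_le_one.trans hB
  induction s using Finset.induction_on with
  | empty => simp
  | insert a s ha ih =>
    have hprod : |∏ i ∈ s, g i| ≤ B ^ (s.card + 1) := by
      rw [Finset.abs_prod]
      exact ((Finset.prod_le_prod (fun _ _ => abs_nonneg _) fun i _ => hg i).trans_eq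
        (Finset.prod_const B)).trans (pow_le_pow_right₀ hB (Nat.le_succ _))
    have hsplit : f a * ∏ i ∈ s, f i - g a * ∏ i ∈ s, g i =
        f a * (∏ i ∈ s, f i - ∏ i ∈ s, g i) + (f a - g a) * ∏ i ∈ s, g i := by ring
    rw [Finset.prod_insert ha, Finset.prod_insert ha, Finset.card_insert_of_notMem ha, hsplit]
    calc _ ≤ |f a| * |∏ i ∈ s, f i - ∏ i ∈ s, g i| + |f a - g a| * |∏ i ∈ s, g i| := by
          rw [← abs_mul, ← abs_mul]; exact abs_add_le _ _
      _ ≤ B * (s.card * B ^ s.card * δ) + δ * B ^ (s.card + 1) := by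
          gcongr
          exacts [hf a, hfg a]
      _ = _ := by push_cast; ring

variable {T : ℝ} {n d N : ℕ} {ρ : EuclideanSpace ℝ (Fin d) → ℝ} {t : Fin (N + 1) → ℝ}
  {G : Fin N → PathSpace T n → EuclideanSpace ℝ (Fin d)} {S : Time T → L2x n → L2x n}

/-- The real-valued version of `likelihood`, for estimates involving differences. -/
noncomputable def realLikelihood (ρ : EuclideanSpace ℝ (Fin d) → ℝ) (t : Fin (N + 1) → ℝ)
    (G : Fin N → PathSpace T n → EuclideanSpace ℝ (Fin d)) (S : Time T → L2x n → L2x n)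
    (y : Fin N → EuclideanSpace ℝ (Fin d)) (s : Time T) (u : L2x n) : ℝ :=
  ∏ j with t (Fin.succ j) ≤ s, ρ (y j - G j (trajectory S u))

theorem card_observed_le (s : Time T) : (Finset.univ.filter fun j => t (Fin.succ j) ≤ s).card ≤ N :=
  (Finset.card_le_univ _).trans_eq (Fintype.card_fin N)

theorem realLikelihood_le {B : ℝ} (hB : 1 ≤ B) (hρ0 : ∀ y, 0 ≤ ρ y) (hρB : ∀ y, ρ y ≤ B)
    (y : Fin N → EuclideanSpace ℝ (Fin d)) (s : Time T) (u : L2x n) :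
    realLikelihood ρ t G S y s u ≤ B ^ N :=
  (Finset.prod_le_prod (fun _ _ => hρ0 _) fun _ _ => hρB _).trans_eq (Finset.prod_const B)
    |>.trans (pow_le_pow_right₀ hB (card_observed_le s))

theorem pow_le_realLikelihood {m : ℝ} (hm0 : 0 ≤ m) (hm1 : m ≤ 1)
    {y : Fin N → EuclideanSpace ℝ (Fin d)} {u : L2x n}
    (h : ∀ j, m ≤ ρ (y j - G j (trajectory S u))) (s : Time T) :
    m ^ N ≤ realLikelihood ρ t G S y s u :=
  (pow_le_pow_of_le_one hm0 hm1 (card_observed_le s)).trans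
    ((Finset.prod_const m).symm.trans_le (Finset.prod_le_prod (fun _ _ => hm0) fun j _ => h j))

theorem abs_realLikelihood_sub_le {Γ : Matrix (Fin d) (Fin d) ℝ} {B L : ℝ} (hB : 1 ≤ B)
    (hρB : ∀ y, |ρ y| ≤ B) (hL : 0 ≤ L) (hLip : ∀ y y', |ρ y - ρ y'| ≤ L * gammaNorm Γ (y - y'))
    (y y' : Fin N → EuclideanSpace ℝ (Fin d)) (s : Time T) (u : L2x n) :
    |realLikelihood ρ t G S y s u - realLikelihood ρ t G S y' s u| ≤
      N * B ^ N * L * gammaNormN Γ (y - y') := by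
  have hγ := gammaNormN_nonneg Γ (y - y')
  have hfactor : ∀ j, |ρ (y j - G j (trajectory S u)) - ρ (y' j - G j (trajectory S u))| ≤
      L * gammaNormN Γ (y - y') := fun j => by
    refine (hLip _ _).trans ?_
    rw [sub_sub_sub_cancel_right]
    exact mul_le_mul_of_nonneg_left (gammaNorm_apply_le Γ (y - y') j) hL
  have hcard := card_observed_le (t := t) s
  refine (abs_prod_sub_prod_le _ hB (fun _ => hρB _) (fun _ => hρB _) hfactor
    (by positivity)).trans ?_
  rw [mul_assoc _ L]
  gcongr

theorem measurable_likelihood (hρ : Measurable ρ) (hG : ∀ j, Continuous (G j))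
    (hS : Measurable fun p : Time T × L2x n => S p.1 p.2) (y : Fin N → EuclideanSpace ℝ (Fin d)) :
    Measurable fun p : Time T × L2x n => likelihood ρ t G S y p.1 p.2 := by
  simp only [likelihood, Finset.prod_filter]
  refine ENNReal.measurable_ofReal.comp (Finset.measurable_prod _ fun j _ => Measurable.ite ?_ ?_
    measurable_const)
  · exact measurableSet_le measurable_const (measurable_subtype_coe.comp measurable_fst)
  · exact hρ.comp (measurable_const.sub
      ((measurable_comp_trajectory hS (hG j)).comp measurable_snd))

theorem measurable_realLikelihood (hρ0 : ∀ y, 0 ≤ ρ y)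
    {y : Fin N → EuclideanSpace ℝ (Fin d)}
    (hlik : Measurable fun p : Time T × L2x n => likelihood ρ t G S y p.1 p.2) (s : Time T) :
    Measurable (realLikelihood ρ t G S y s) :=
  (congrArg Measurable (funext fun _ =>
    ENNReal.toReal_ofReal (Finset.prod_nonneg fun _ _ => hρ0 _))).mp
    (hlik.comp (measurable_prodMk_left (x := s))).ennreal_toReal

end Likelihood

section Reweighting

variable {X : Type*} [MeasurableSpace X]

/-- The probability measure with density proportional to `f` with respect to `μ`. The posterior
distributions are of this form; the value is a junk one if `∫⁻ f ∂μ` is `0` or `∞`. -/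
noncomputable def reweight (μ : Measure X) (f : X → ℝ≥0∞) : Measure X :=
  (∫⁻ u, f u ∂μ)⁻¹ • μ.withDensity f

theorem isProbabilityMeasure_reweight {μ : Measure X} {f : X → ℝ≥0∞}
    (h0 : ∫⁻ u, f u ∂μ ≠ 0) (htop : ∫⁻ u, f u ∂μ ≠ ∞) : IsProbabilityMeasure (reweight μ f) := by
  constructor
  rw [reweight, Measure.smul_apply, withDensity_apply _ MeasurableSet.univ, Measure.restrict_univ,
    smul_eq_mul, ENNReal.inv_mul_cancel h0 htop]

theorem ofReal_eq_ofReal_min_add_ofReal_sub {a b : ℝ} (hb : 0 ≤ b) :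
    ENNReal.ofReal a = ENNReal.ofReal (min a b) + ENNReal.ofReal (a - b) := by
  rcases le_total a b with h | h
  · rw [min_eq_left h, ENNReal.ofReal_of_nonpos (sub_nonpos.2 h), add_zero]
  · rw [min_eq_right h, ← ENNReal.ofReal_add hb (sub_nonneg.2 h), add_sub_cancel]

theorem withDensity_ofReal_eq_add {μ : Measure X} {f g : X → ℝ} (hf : Measurable f)
    (hg : Measurable g) (hg0 : ∀ᵐ u ∂μ, 0 ≤ g u) :
    (μ.withDensity fun u => ENNReal.ofReal (f u)) =
      (μ.withDensity fun u => ENNReal.ofReal (min (f u) (g u))) +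
        μ.withDensity fun u => ENNReal.ofReal (f u - g u) := by
  rw [← withDensity_add_left (by fun_prop)]
  exact withDensity_congr_ae (hg0.mono fun u hu => ofReal_eq_ofReal_min_add_ofReal_sub hu)

theorem div_sub_div_le {a b z w m B δ : ℝ} (hm : 0 < m) (hz : m ≤ z) (hw : m ≤ w) (ha : 0 ≤ a)
    (haB : a ≤ B) (hab : |a - b| ≤ δ) (hzw : |z - w| ≤ δ) :
    b / w - a / z ≤ (1 / m + B / m ^ 2) * δ := by
  have hz0 : 0 < z := hm.trans_le hz
  have hw0 : 0 < w := hm.trans_le hw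
  have hδ : 0 ≤ δ := (abs_nonneg _).trans hab
  have hB : 0 ≤ B := ha.trans haB
  calc b / w - a / z = (b - a) / w + a * (z - w) / (w * z) := by field_simp; ring
    _ ≤ δ / m + B * δ / m ^ 2 := by
      have hba : b - a ≤ δ := (le_abs_self _).trans ((abs_sub_comm b a).trans_le hab)
      have hazw : a * (z - w) ≤ B * δ :=
        (mul_le_mul_of_nonneg_left ((le_abs_self _).trans hzw) ha).trans (by gcongr)
      rw [sq]
      gcongr
    _ = (1 / m + B / m ^ 2) * δ := by ring

section Bounds

variable {μ : Measure X} [IsProbabilityMeasure μ] {f : X → ℝ} {m B : ℝ}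

theorem integrable_of_ae_bounds (hf : Measurable f) (hm : 0 < m)
    (hfm : ∀ᵐ u ∂μ, m ≤ f u) (hfB : ∀ᵐ u ∂μ, f u ≤ B) : Integrable f μ := by
  refine Integrable.of_bound hf.aestronglyMeasurable B ?_
  filter_upwards [hfm, hfB] with u h_lower h_upper
  rwa [Real.norm_of_nonneg (hm.le.trans h_lower)]

theorem le_integral_of_ae_bounds (hf : Measurable f) (hm : 0 < m)
    (hfm : ∀ᵐ u ∂μ, m ≤ f u) (hfB : ∀ᵐ u ∂μ, f u ≤ B) : m ≤ ∫ u, f u ∂μ := by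
  simpa using integral_mono_ae (integrable_const m) (integrable_of_ae_bounds hf hm hfm hfB) hfm

theorem abs_integral_sub_integral_le {g : X → ℝ} {δ : ℝ} (hf : Integrable f μ)
    (hg : Integrable g μ) (hfg : ∀ᵐ u ∂μ, |f u - g u| ≤ δ) :
    |∫ u, f u ∂μ - ∫ u, g u ∂μ| ≤ δ := by
  rw [← integral_sub hf hg]
  simpa using norm_integral_le_of_norm_le_const (f := fun u => f u - g u) hfg

theorem lintegral_ofReal_eq_of_ae_bounds (hf : Measurable f) (hm : 0 < m)
    (hfm : ∀ᵐ u ∂μ, m ≤ f u) (hfB : ∀ᵐ u ∂μ, f u ≤ B) :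
    ∫⁻ u, ENNReal.ofReal (f u) ∂μ = ENNReal.ofReal (∫ u, f u ∂μ) :=
  (ofReal_integral_eq_lintegral_ofReal (integrable_of_ae_bounds hf hm hfm hfB)
    (hfm.mono fun _ h => hm.le.trans h)).symm

theorem isProbabilityMeasure_reweight_ofReal (hf : Measurable f) (hm : 0 < m)
    (hfm : ∀ᵐ u ∂μ, m ≤ f u) (hfB : ∀ᵐ u ∂μ, f u ≤ B) :
    IsProbabilityMeasure (reweight μ fun u => ENNReal.ofReal (f u)) := by
  have hpos := hm.trans_le (le_integral_of_ae_bounds hf hm hfm hfB)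
  refine isProbabilityMeasure_reweight ?_ ?_ <;>
    rw [lintegral_ofReal_eq_of_ae_bounds hf hm hfm hfB]
  · simpa using hpos
  · exact ENNReal.ofReal_ne_top

theorem reweight_ofReal_eq (hf : Measurable f) (hm : 0 < m)
    (hfm : ∀ᵐ u ∂μ, m ≤ f u) (hfB : ∀ᵐ u ∂μ, f u ≤ B) :
    reweight μ (fun u => ENNReal.ofReal (f u)) =
      μ.withDensity fun u => ENNReal.ofReal (f u / ∫ v, f v ∂μ) := by
  have hpos := hm.trans_le (le_integral_of_ae_bounds hf hm hfm hfB)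
  rw [reweight, lintegral_ofReal_eq_of_ae_bounds hf hm hfm hfB, ← withDensity_smul _ (by fun_prop)]
  congr 1
  ext u
  rw [Pi.smul_apply, smul_eq_mul, ← ENNReal.ofReal_inv_of_pos hpos,
    ← ENNReal.ofReal_mul (inv_nonneg.2 hpos.le), inv_mul_eq_div]

theorem reweight_ofReal_le (hf : Measurable f) (hm : 0 < m)
    (hfm : ∀ᵐ u ∂μ, m ≤ f u) (hfB : ∀ᵐ u ∂μ, f u ≤ B) :
    reweight μ (fun u => ENNReal.ofReal (f u)) ≤ ENNReal.ofReal (B / m) • μ := by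
  have hz := le_integral_of_ae_bounds hf hm hfm hfB
  rw [reweight_ofReal_eq hf hm hfm hfB, ← withDensity_const]
  refine withDensity_mono ?_
  filter_upwards [hfm, hfB] with u h_lower h_upper
  exact ENNReal.ofReal_le_ofReal
    (div_le_div₀ (hm.le.trans (h_lower.trans h_upper)) h_upper hm hz)

end Bounds

variable {Y : Type*} [NormedAddCommGroup Y] [MeasurableSpace Y] [BorelSpace Y]
  {μ : Measure X} {S : X → Y} {M : ℝ}

theorem ae_norm_le_map_withDensity (hS : Measurable S) (hSM : ∀ᵐ u ∂μ, ‖S u‖ ≤ M)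
    (g : X → ℝ≥0∞) : ∀ᵐ x ∂((μ.withDensity g).map S), ‖x‖ ≤ M :=
  (ae_map_iff hS.aemeasurable (measurableSet_le measurable_norm measurable_const)).2
    ((withDensity_absolutelyContinuous μ g).ae_le hSM)

variable [SecondCountableTopology Y] [IsProbabilityMeasure μ]

-- The common part `min f g` of the two densities need not be moved, and the excess of `g` over `f`
-- has mass at most `ε` and is moved over a distance at most `2 * M`.
theorem W₁_map_withDensity_le {f g : X → ℝ} (hf : Measurable f) (hg : Measurable g)
    (hf0 : ∀ᵐ u ∂μ, 0 ≤ f u) (hg0 : ∀ᵐ u ∂μ, 0 ≤ g u)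
    (hfp : IsProbabilityMeasure (μ.withDensity fun u => ENNReal.ofReal (f u)))
    (hgp : IsProbabilityMeasure (μ.withDensity fun u => ENNReal.ofReal (g u)))
    {ε : ℝ} (hfg : ∀ᵐ u ∂μ, g u - f u ≤ ε) (hS : Measurable S) (hSM : ∀ᵐ u ∂μ, ‖S u‖ ≤ M) :
    W₁ ((μ.withDensity fun u => ENNReal.ofReal (f u)).map S)
      ((μ.withDensity fun u => ENNReal.ofReal (g u)).map S) ≤ ENNReal.ofReal (2 * M * ε) := by
  have hM : 0 ≤ M := hSM.exists.elim fun u hu => (norm_nonneg _).trans hu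
  rw [withDensity_ofReal_eq_add hf hg hg0] at hfp ⊢
  rw [withDensity_ofReal_eq_add hg hf hf0] at hgp ⊢
  simp only [min_comm (g _)] at hgp ⊢
  set κ := μ.withDensity fun u => ENNReal.ofReal (min (f u) (g u))
  set p := μ.withDensity fun u => ENNReal.ofReal (f u - g u)
  set q := μ.withDensity fun u => ENNReal.ofReal (g u - f u) with hq
  have : IsFiniteMeasure κ := isFiniteMeasure_of_le (κ + p) (Measure.le_add_right le_rfl)
  have : IsFiniteMeasure p := isFiniteMeasure_of_le (κ + p) (Measure.le_add_left le_rfl)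
  have : IsFiniteMeasure q := isFiniteMeasure_of_le (κ + q) (Measure.le_add_left le_rfl)
  have hpq : p univ = q univ := (ENNReal.add_right_inj (measure_ne_top κ univ)).1 <| by
    rw [← Measure.add_apply, ← Measure.add_apply, measure_univ, measure_univ]
  have hq_mass : q univ ≤ ENNReal.ofReal ε := by
    rw [hq, withDensity_apply _ MeasurableSet.univ, Measure.restrict_univ]
    refine (lintegral_mono_ae (hfg.mono fun u hu => ENNReal.ofReal_le_ofReal hu)).trans_eq ?_
    simp
  rw [Measure.map_add _ _ hS, Measure.map_add _ _ hS]
  refine (W₁_add_le (κ.map S) (p.map S) (q.map S) ?_ (ENNReal.ofReal (2 * M)) ?_).trans ?_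
  · rwa [Measure.map_apply hS MeasurableSet.univ, Measure.map_apply hS MeasurableSet.univ]
  · filter_upwards [ae_norm_le_map_withDensity hS hSM _] with x hx
    filter_upwards [ae_norm_le_map_withDensity hS hSM _] with y hy
    rw [edist_dist, dist_eq_norm]
    exact ENNReal.ofReal_le_ofReal ((norm_sub_le x y).trans (by linarith))
  · rw [Measure.map_apply hS MeasurableSet.univ, preimage_univ,
      ENNReal.ofReal_mul (p := 2 * M) (by positivity)]
    gcongr

theorem W₁_map_reweight_le {f f' : X → ℝ} {m B δ : ℝ} (hf : Measurable f) (hf' : Measurable f')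
    (hm : 0 < m) (hfm : ∀ᵐ u ∂μ, m ≤ f u) (hfB : ∀ᵐ u ∂μ, f u ≤ B)
    (hfm' : ∀ᵐ u ∂μ, m ≤ f' u) (hfB' : ∀ᵐ u ∂μ, f' u ≤ B) (hff' : ∀ᵐ u ∂μ, |f u - f' u| ≤ δ)
    (hS : Measurable S) (hSM : ∀ᵐ u ∂μ, ‖S u‖ ≤ M) :
    W₁ ((reweight μ fun u => ENNReal.ofReal (f u)).map S)
      ((reweight μ fun u => ENNReal.ofReal (f' u)).map S) ≤
      ENNReal.ofReal (2 * M * ((1 / m + B / m ^ 2) * δ)) := by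
  have hp := isProbabilityMeasure_reweight_ofReal hf hm hfm hfB
  have hp' := isProbabilityMeasure_reweight_ofReal hf' hm hfm' hfB'
  have hz := le_integral_of_ae_bounds hf hm hfm hfB
  have hz' := le_integral_of_ae_bounds hf' hm hfm' hfB'
  have hzz' := abs_integral_sub_integral_le (integrable_of_ae_bounds hf hm hfm hfB)
    (integrable_of_ae_bounds hf' hm hfm' hfB') hff'
  rw [reweight_ofReal_eq hf hm hfm hfB] at hp ⊢
  rw [reweight_ofReal_eq hf' hm hfm' hfB'] at hp' ⊢
  refine W₁_map_withDensity_le (by fun_prop) (by fun_prop) ?_ ?_ hp hp' ?_ hS hSM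
  · exact hfm.mono fun u hu => div_nonneg (hm.le.trans hu) (hm.le.trans hz)
  · exact hfm'.mono fun u hu => div_nonneg (hm.le.trans hu) (hm.le.trans hz')
  · filter_upwards [hfm, hfB, hff'] with u h_lower h_upper h_diff
    exact div_sub_div_le hm hz hz' (hm.le.trans h_lower) h_upper h_diff hzz'

end Reweighting

section FilteringEstimates

variable {T : ℝ} {n d N : ℕ} {Γ : Matrix (Fin d) (Fin d) ℝ} {ρ : EuclideanSpace ℝ (Fin d) → ℝ}
  {t : Fin (N + 1) → ℝ} {G : Fin N → PathSpace T n → EuclideanSpace ℝ (Fin d)}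
  {S : Time T → L2x n → L2x n} {prior : Measure (L2x n)}

theorem measurable_filtering [SFinite prior] {y : Fin N → EuclideanSpace ℝ (Fin d)}
    (hlik : Measurable fun p : Time T × L2x n => likelihood ρ t G S y p.1 p.2)
    (hS : Measurable fun p : Time T × L2x n => S p.1 p.2) :
    Measurable fun s => filtering ρ t G S prior y s := by
  refine Measure.measurable_of_measurable_coe _ fun A hA => ?_
  have happly : ∀ s, filtering ρ t G S prior y s A = (∫⁻ u, likelihood ρ t G S y s u ∂prior)⁻¹ *
      ∫⁻ u, (S s ⁻¹' A).indicator (likelihood ρ t G S y s) u ∂prior := fun s => by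
    have hSs : Measurable (S s) := hS.comp measurable_prodMk_left
    rw [filtering, Measure.map_apply hSs hA, posterior, Measure.smul_apply,
      withDensity_apply _ (hSs hA), lintegral_indicator (hSs hA), smul_eq_mul]
  simp only [happly]
  exact hlik.lintegral_prod_right'.inv.mul <| Measurable.lintegral_prod_right'
    (f := ((fun p : Time T × L2x n => S p.1 p.2) ⁻¹' A).indicator
      fun p : Time T × L2x n => likelihood ρ t G S y p.1 p.2) (hlik.indicator (hS hA))

/-- The properties of the filtering distributions on which the theorem rests, with constants `C R`
and `D R` for measurements with `|𝐲|_Γ ≤ R`: the posteriors are probability measures which are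
dominated by multiples of the prior, and the filtering distributions depend measurably on time and
Lipschitz continuously on the measurements. -/
structure FilteringEstimates (Γ : Matrix (Fin d) (Fin d) ℝ) (ρ : EuclideanSpace ℝ (Fin d) → ℝ)
    (t : Fin (N + 1) → ℝ) (G : Fin N → PathSpace T n → EuclideanSpace ℝ (Fin d))
    (S : Time T → L2x n → L2x n) (prior : Measure (L2x n)) (C : ℝ → ℝ) (D : ℝ → ℝ≥0) :
    Prop where
  isProbabilityMeasure_posterior : ∀ y s, IsProbabilityMeasure (posterior ρ t G S prior y s)
  posterior_le : ∀ R y s, gammaNormN Γ y ≤ R →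
    posterior ρ t G S prior y s ≤ (D R : ℝ≥0∞) • prior
  measurable_filtering : ∀ y, Measurable fun s => filtering ρ t G S prior y s
  W₁_le : ∀ R y y' s, gammaNormN Γ y ≤ R → gammaNormN Γ y' ≤ R →
    W₁ (filtering ρ t G S prior y s) (filtering ρ t G S prior y' s) ≤
      ENNReal.ofReal (C R * gammaNormN Γ (y - y'))

theorem FilteringEstimates.mono {C C' : ℝ → ℝ} {D : ℝ → ℝ≥0}
    (h : FilteringEstimates Γ ρ t G S prior C D) (hC : ∀ R, C R ≤ C' R) :
    FilteringEstimates Γ ρ t G S prior C' D :=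
  { h with
    W₁_le := fun R y y' s hy hy' => (h.W₁_le R y y' s hy hy').trans <| ENNReal.ofReal_le_ofReal <|
      mul_le_mul_of_nonneg_right (hC R) (gammaNormN_nonneg Γ _) }

theorem filteringEstimates_of_likelihood_bounds [IsProbabilityMeasure prior] {B ℓ M : ℝ}
    {m : ℝ → ℝ} (hρ0 : ∀ y, 0 ≤ ρ y)
    (hlik : ∀ y, Measurable fun p : Time T × L2x n => likelihood ρ t G S y p.1 p.2)
    (hS : Measurable fun p : Time T × L2x n => S p.1 p.2)
    (hSM : ∀ᵐ u ∂prior, ∀ s, ‖S s u‖ ≤ M) (hm : ∀ R, 0 < m R)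
    (hlower : ∀ R y s, gammaNormN Γ y ≤ R → ∀ᵐ u ∂prior, m R ≤ realLikelihood ρ t G S y s u)
    (hupper : ∀ y s u, realLikelihood ρ t G S y s u ≤ B)
    (hLip : ∀ y y' s u, |realLikelihood ρ t G S y s u - realLikelihood ρ t G S y' s u| ≤
      ℓ * gammaNormN Γ (y - y')) :
    FilteringEstimates Γ ρ t G S prior
      (fun R => 2 * M * ((1 / m R + B / m R ^ 2) * ℓ)) (fun R => (B / m R).toNNReal) where
  isProbabilityMeasure_posterior y s :=
    isProbabilityMeasure_reweight_ofReal (measurable_realLikelihood hρ0 (hlik y) s) (hm _)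
      (hlower _ y s le_rfl) (.of_forall (hupper y s))
  posterior_le R y s hy :=
    reweight_ofReal_le (measurable_realLikelihood hρ0 (hlik y) s) (hm R) (hlower R y s hy)
      (.of_forall (hupper y s))
  measurable_filtering y := measurable_filtering (hlik y) hS
  W₁_le R y y' s hy hy' := by
    refine (W₁_map_reweight_le (measurable_realLikelihood hρ0 (hlik y) s)
      (measurable_realLikelihood hρ0 (hlik y') s) (hm R) (hlower R y s hy)
      (.of_forall (hupper y s)) (hlower R y' s hy') (.of_forall (hupper y' s))
      (.of_forall (hLip y y' s)) (hS.comp measurable_prodMk_left)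
      (hSM.mono fun u hu => hu s)).trans_eq ?_
    congr 1
    ring

theorem exists_filteringEstimates (hΓ : Γ.PosDef) (hρ : IsNoiseDensity Γ ρ) (hT : 0 ≤ T) (N : ℕ)
    (L_G g₀ : ℝ) :
    ∃ (C : ℝ → ℝ → ℝ) (D : ℝ → ℝ → ℝ≥0), (∀ R M, 0 < C R M) ∧ (∀ M, Continuous fun R => C R M) ∧
      (∀ M, Monotone fun R => C R M) ∧
      ∀ (n : ℕ) (t : Fin (N + 1) → ℝ) (G : Fin N → PathSpace T n → EuclideanSpace ℝ (Fin d)),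
        LipschitzObservables t G L_G → (∀ j, ‖G j 0‖ ≤ g₀) →
      ∀ (prior : Measure (L2x n)) [IsProbabilityMeasure prior] (M : ℝ) (S : Time T → L2x n → L2x n),
        (Measurable fun p : Time T × L2x n => S p.1 p.2) → (∀ᵐ u ∂prior, ∀ s, ‖S s u‖ ≤ M) →
        FilteringEstimates Γ ρ t G S prior (fun R => C R M) (fun R => D R M) := by
  obtain ⟨B₀, -, hB₀⟩ := hρ.bounded
  obtain ⟨L, hL, hLip⟩ := hρ.lipschitz
  obtain ⟨m₀, hm₀, hm₀1, hm₀c, hm₀a, hm₀ρ⟩ := hρ.exists_lower_bound hΓ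
  have hρ0 : ∀ y, 0 ≤ ρ y := fun y => (hρ.pos y).le
  set B : ℝ := max B₀ 1
  have hB : 1 ≤ B := le_max_right _ _
  have hρB : ∀ y, ρ y ≤ B := fun y => (hB₀ y).trans (le_max_left _ _)
  set m : ℝ → ℝ → ℝ := fun R M => m₀ R (g₀ + |L_G| * (T * M)) ^ N
  have hm : ∀ R M, 0 < m R M := fun R M => pow_pos (hm₀ R _) N
  have hma : ∀ {R R'} M, R ≤ R' → m R' M ≤ m R M := fun {R R'} M hR =>
    pow_le_pow_left₀ (hm₀ R' _).le (hm₀a _ hR) N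
  set ℓ : ℝ := N * B ^ N * L
  refine ⟨fun R M => 2 * |M| * ((1 / m R M + B ^ N / m R M ^ 2) * ℓ) + 1,
    fun R M => (B ^ N / m R M).toNNReal, fun R M => ?_, fun M => ?_, fun M R R' hR => ?_,
    fun n t G hG hg prior _ M S hS hSM => ?_⟩
  · have := hm R M
    positivity
  · have hne : ∀ R, m R M ≠ 0 := fun R => (hm R M).ne'
    have hne_sq : ∀ R, m R M ^ 2 ≠ 0 := fun R => pow_ne_zero 2 (hne R)
    have : Continuous fun R => m R M := (hm₀c _).pow N
    fun_prop (disch := assumption)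
  · have := hm R' M
    have := hma M hR
    dsimp only
    gcongr
  · exact (filteringEstimates_of_likelihood_bounds hρ0
      (measurable_likelihood (hρ.continuous hΓ).measurable hG.continuous hS) hS
      (hSM.mono fun u hu s => (hu s).trans (le_abs_self M)) (hm · M)
      (fun R y s hy => hSM.mono fun u hu => pow_le_realLikelihood (hm₀ R _).le (hm₀1 R _)
        (fun j => hm₀ρ R _ _ _ ((gammaNorm_apply_le Γ y j).trans hy)
          (hG.norm_trajectory_le hg hS hT hu j)) s)
      (realLikelihood_le hB hρ0 hρB)
      (abs_realLikelihood_sub_le hB (fun y => (abs_of_nonneg (hρ0 y)).trans_le (hρB y)) hL.le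
        hLip)).mono fun R => (lt_add_one _).le

end FilteringEstimates

section FiniteNets

theorem map_comp_eq_atomic {Ω X : Type*} [MeasurableSpace Ω] [MeasurableSpace X] (μ : Measure Ω)
    [IsFiniteMeasure μ] {m : ℕ} (e : Fin m → X) {J : Ω → Fin m} (hJ : Measurable J) :
    μ.map (e ∘ J) = atomic e fun i => μ.real (J ⁻¹' {i}) := by
  have he : Measurable e := measurable_of_countable e
  rw [← Measure.map_map he hJ, ← Measure.sum_smul_dirac (μ.map J),
    Measure.map_sum he.aemeasurable, Measure.sum_fintype]
  refine Finset.sum_congr rfl fun i _ => ?_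
  rw [Measure.map_smul, Measure.map_dirac' he, Measure.map_apply hJ (measurableSet_singleton i),
    ofReal_measureReal]

theorem measureReal_preimage_singleton_mem_stdSimplex {Ω : Type*} [MeasurableSpace Ω]
    (μ : Measure Ω) [IsProbabilityMeasure μ] {m : ℕ} {J : Ω → Fin m} (hJ : Measurable J) :
    (fun i => μ.real (J ⁻¹' {i})) ∈ stdSimplex ℝ (Fin m) := by
  refine ⟨fun i => measureReal_nonneg, ?_⟩
  rw [sum_measureReal_preimage_singleton _ fun i _ => hJ (measurableSet_singleton i)]
  simp

theorem lintegral_enorm_atomic_lt_top {X : Type*} [NormedAddCommGroup X] [MeasurableSpace X]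
    [BorelSpace X] {m : ℕ} (e : Fin m → X) (w : Fin m → ℝ) :
    ∫⁻ u, ‖u‖ₑ ∂(atomic e w) < ∞ := by
  simp only [atomic, lintegral_finsetSum_measure, lintegral_smul_measure, lintegral_dirac]
  exact ENNReal.sum_lt_top.2 fun i _ => ENNReal.mul_lt_top ENNReal.ofReal_lt_top enorm_lt_top

theorem exists_measurable_finite_net {X : Type*} [PseudoEMetricSpace X] [MeasurableSpace X]
    [OpensMeasurableSpace X] [TopologicalSpace.SeparableSpace X] [Nonempty X] {K : Set X}
    (hK : IsCompact K) {ε : ℝ≥0∞} (hε : ε ≠ 0) :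
    ∃ (m : ℕ) (e : Fin m → X) (J : X → Fin m), Measurable J ∧ ∀ x ∈ K, edist x (e (J x)) ≤ ε := by
  set e := TopologicalSpace.denseSeq X
  obtain ⟨I, hI⟩ := hK.elim_finite_subcover (fun i => Metric.eball (e i) ε)
    (fun _ => Metric.isOpen_eball) fun x _ => by
      obtain ⟨_, ⟨i, rfl⟩, hi⟩ := EMetric.mem_closure_iff.1
        (TopologicalSpace.denseRange_denseSeq X x) ε hε.bot_lt
      exact mem_iUnion.2 ⟨i, hi⟩
  set J := SimpleFunc.nearestPtInd e (I.sup id)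
  refine ⟨I.sup id + 1, fun i => e i, J.map (Fin.ofNat _), SimpleFunc.measurable _,
    fun x hx => ?_⟩
  obtain ⟨i, hi, hxi⟩ := mem_iUnion₂.1 (hI hx)
  have hJx : (Fin.ofNat (I.sup id + 1) (J x) : ℕ) = J x :=
    Nat.mod_eq_of_lt (Nat.lt_succ_of_le (SimpleFunc.nearestPtInd_le e _ x))
  change edist x (e (Fin.ofNat (I.sup id + 1) (J x) : ℕ)) ≤ ε
  rw [hJx, edist_comm]
  refine (SimpleFunc.edist_nearestPt_le e x (Finset.le_sup (f := id) hi)).trans ?_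
  rw [edist_comm]
  exact (Metric.mem_eball.1 hxi).le

theorem exists_finite_L1P_net {T : ℝ} {X : Type*} [NormedAddCommGroup X]
    [MeasurableSpace X] [BorelSpace X] (τ : SimpleFunc (Time T) (Time T))
    {Q : Set (Measure X)} (hQ : Q.Finite) (hprob : ∀ q ∈ Q, IsProbabilityMeasure q)
    (hmoment : ∀ q ∈ Q, ∫⁻ u, ‖u‖ₑ ∂q < ∞) :
    ∃ F : Set (L1P T X), F.Finite ∧ ∀ w : Time T → Measure X, (∀ s, w s ∈ Q) →
      ∃ ν ∈ F, ∀ s, ν.meas s = w (τ s) := by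
  have : Finite Q := hQ
  have hint : ∀ w : τ.range → Q,
      ∫⁻ s, ∫⁻ u, ‖u‖ₑ ∂(w ⟨τ s, τ.mem_range_self s⟩ : Measure X) ∂(lebT T) < ∞ := fun w => by
    refine (lintegral_mono fun s => Finset.single_le_sum
      (f := fun e => ∫⁻ u, ‖u‖ₑ ∂(w e : Measure X)) (fun _ _ => zero_le)
      (Finset.mem_univ _)).trans_lt ?_
    rw [lintegral_const]
    exact ENNReal.mul_lt_top (ENNReal.sum_lt_top.2 fun e _ => hmoment _ (w e).2)
      (measure_lt_top _ _)
  set ν : (τ.range → Q) → L1P T X := fun w =>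
    L1P.ofMeasurable (fun s => w ⟨τ s, τ.mem_range_self s⟩) (fun s => hprob _ (w _).2)
      ((measurable_of_countable fun e => (w e : Measure X)).comp τ.measurable.subtype_mk)
      (fun s => hmoment _ (w _).2) (hint w)
  exact ⟨range ν, finite_range ν, fun w hw =>
    ⟨_, mem_range_self fun e => ⟨w e, hw e⟩, fun _ => rfl⟩⟩

variable {X : Type*} [NormedAddCommGroup X] [MeasurableSpace X] [BorelSpace X]
  [SecondCountableTopology X] [CompleteSpace X]

theorem exists_finite_W₁_net_atomic {m : ℕ} (e : Fin m → X) {ε : ℝ≥0∞} (hε : ε ≠ 0) :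
    ∃ W : Finset (stdSimplex ℝ (Fin m)),
      ∀ w : stdSimplex ℝ (Fin m), ∃ w' ∈ W, W₁ (atomic e w) (atomic e w') ≤ ε := by
  have hnhds : ∀ w' : stdSimplex ℝ (Fin m),
      {w : stdSimplex ℝ (Fin m) | W₁ (atomic e w) (atomic e w') < ε} ∈ 𝓝 w' := by
    intro w'
    have hcont : Continuous fun w : stdSimplex ℝ (Fin m) => W₁ (atomic e w) (atomic e w') :=
      (continuous_W₁_atomic e).comp₂ continuous_id continuous_const
    refine (isOpen_Iio.preimage hcont).mem_nhds ?_
    rw [mem_preimage, W₁_self]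
    exact hε.bot_lt
  obtain ⟨W, hW⟩ := finite_cover_nhds hnhds
  refine ⟨W, fun w => ?_⟩
  obtain ⟨w', hw', hlt⟩ := mem_iUnion₂.1 (hW.ge (mem_univ w))
  exact ⟨w', hw', le_of_lt hlt⟩

theorem exists_finite_W₁_net {K : Set X} (hK : IsCompact K) {ε : ℝ≥0∞} (hε : ε ≠ 0) :
    ∃ Q : Set (Measure X), Q.Finite ∧
      (∀ q ∈ Q, IsProbabilityMeasure q ∧ ∫⁻ u, ‖u‖ₑ ∂q < ∞) ∧
      ∀ (μ : Measure X) [IsProbabilityMeasure μ], (∀ᵐ u ∂μ, u ∈ K) → ∃ q ∈ Q, W₁ μ q ≤ ε := by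
  have hε2 : ε / 2 ≠ 0 := (ENNReal.half_pos hε).ne'
  obtain ⟨m, e, J, hJ, hJK⟩ := exists_measurable_finite_net hK hε2
  obtain ⟨W, hW⟩ := exists_finite_W₁_net_atomic e hε2
  refine ⟨(fun w : stdSimplex ℝ (Fin m) => atomic e w) '' W, W.finite_toSet.image _, ?_, ?_⟩
  · rintro _ ⟨w, -, rfl⟩
    exact ⟨isProbabilityMeasure_atomic e w.2, lintegral_enorm_atomic_lt_top e w⟩
  · intro μ _ hμK
    set w : stdSimplex ℝ (Fin m) := ⟨_, measureReal_preimage_singleton_mem_stdSimplex μ hJ⟩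
    obtain ⟨w', hw', hww'⟩ := hW w
    have heJ : Measurable (e ∘ J) := (measurable_of_countable e).comp hJ
    have := isProbabilityMeasure_atomic e w.2
    refine ⟨_, mem_image_of_mem _ hw', ?_⟩
    calc W₁ μ (atomic e w')
        ≤ W₁ μ (atomic e w) + W₁ (atomic e w) (atomic e w') := W₁_triangle _ _ _
      _ ≤ ∫⁻ x, edist x (e (J x)) ∂μ + ε / 2 := by
          gcongr
          exact map_comp_eq_atomic μ e hJ ▸ W₁_map_le μ heJ
      _ ≤ ε / 2 + ε / 2 := by
          gcongr
          exact (lintegral_mono_ae (hμK.mono hJK)).trans_eq (by simp)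
      _ = ε := ENNReal.add_halves ε

theorem isCompact_mem_and_norm_le {E : Type*} [NormedAddCommGroup E] [NormedSpace ℝ E]
    (V : Submodule ℝ E) [FiniteDimensional ℝ V] (M : ℝ) : IsCompact {v | v ∈ V ∧ ‖v‖ ≤ M} := by
  have : ProperSpace V := FiniteDimensional.proper ℝ V
  convert (isCompact_closedBall (0 : V) M).image continuous_subtype_val
  ext v
  simp [and_comm]

end FiniteNets

section TimeGrid

variable {T : ℝ}

theorem exists_monotone_round_down {α : Type*} [LinearOrder α] (E : Finset α)
    (hE : ∀ s, ∃ e ∈ E, e ≤ s) :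
    ∃ τ : α → α, Monotone τ ∧ ∀ s, τ s ∈ E ∧ τ s ≤ s ∧ ∀ e ∈ E, e ≤ s → e ≤ τ s := by
  have hne : ∀ s, (E.filter (· ≤ s)).Nonempty := fun s =>
    let ⟨e, he, hes⟩ := hE s
    ⟨e, Finset.mem_filter.2 ⟨he, hes⟩⟩
  refine ⟨fun s => (E.filter (· ≤ s)).max' (hne s), fun s s' hss' => ?_, fun s => ?_⟩
  · exact Finset.max'_subset _ (Finset.monotone_filter_right E fun _ _ he => le_trans he hss')
  · obtain ⟨hmem, hle⟩ := Finset.mem_filter.1 (Finset.max'_mem _ (hne s))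
    exact ⟨hmem, hle, fun e he hes => Finset.le_max' _ _ (Finset.mem_filter.2 ⟨he, hes⟩)⟩

theorem exists_finite_time_mesh {h : ℝ} (hh : 0 < h) :
    ∃ E : Finset (Time T), ∀ s : Time T, ∃ e ∈ E, e ≤ s ∧ (s : ℝ) - e ≤ h := by
  have hfin : {e : Time T | (e : ℝ) ∈ (fun i : ℕ => i * h) '' Iic ⌊T / h⌋₊}.Finite :=
    ((finite_Iic _).image _).preimage Subtype.val_injective.injOn
  refine ⟨hfin.toFinset, fun s => ?_⟩
  have hle : (⌊(s : ℝ) / h⌋₊ : ℝ) * h ≤ s :=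
    (le_div_iff₀ hh).1 (Nat.floor_le (div_nonneg s.2.1 hh.le))
  have hlt : (s : ℝ) < (⌊(s : ℝ) / h⌋₊ + 1) * h := (div_lt_iff₀ hh).1 (Nat.lt_floor_add_one _)
  have hfloor : ⌊(s : ℝ) / h⌋₊ ≤ ⌊T / h⌋₊ := Nat.floor_le_floor (by gcongr; exact s.2.2)
  refine ⟨⟨⌊(s : ℝ) / h⌋₊ * h, by positivity, hle.trans s.2.2⟩,
    hfin.mem_toFinset.2 (mem_image_of_mem _ hfloor), hle, ?_⟩
  change (s : ℝ) - ⌊(s : ℝ) / h⌋₊ * h ≤ h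
  linarith

theorem exists_time_grid {ι : Type*} [Finite ι] {t : ι → ℝ} (ht : ∀ j, 0 ≤ t j) {h : ℝ}
    (hh : 0 < h) :
    ∃ τ : SimpleFunc (Time T) (Time T), (∀ s : Time T, |(s : ℝ) - τ s| ≤ h) ∧
      ∀ (s : Time T) j, t j ≤ s ↔ t j ≤ τ s := by
  classical
  obtain ⟨E, hE⟩ := exists_finite_time_mesh (T := T) hh
  have hobs : {e : Time T | (e : ℝ) ∈ range t}.Finite :=
    (finite_range t).preimage Subtype.val_injective.injOn
  obtain ⟨τ, hτ, hround⟩ := exists_monotone_round_down (E ∪ hobs.toFinset) fun s =>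
    let ⟨e, he, hes, _⟩ := hE s
    ⟨e, Finset.mem_union_left _ he, hes⟩
  refine ⟨⟨τ, fun _ => hτ.measurable (measurableSet_singleton _), (Finset.finite_toSet _).subset
    (range_subset_iff.2 fun s => (hround s).1)⟩, fun s => ?_, fun s j =>
    ⟨fun hj => ?_, fun hj => hj.trans (hround s).2.1⟩⟩
  · obtain ⟨-, hle, hmax⟩ := hround s
    obtain ⟨e, he, hes, heh⟩ := hE s
    have hτe : (e : ℝ) ≤ τ s := hmax e (Finset.mem_union_left _ he) hes
    have hτs : (τ s : ℝ) ≤ s := hle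
    change |(s : ℝ) - τ s| ≤ h
    exact abs_le.2 ⟨by linarith, by linarith⟩
  · exact (hround s).2.2 ⟨t j, ht j, hj.trans s.2.2⟩
      (Finset.mem_union_right _ (hobs.mem_toFinset.2 (mem_range_self j))) hj

end TimeGrid

section MarkovBounds

theorem exists_nat_measure_le {Ω : Type*} [MeasurableSpace Ω] (μ : Measure Ω)
    [IsProbabilityMeasure μ] (c : Ω → ℝ) {η : ℝ≥0∞} (hη : η ≠ 0) :
    ∃ K : ℕ, ∀ B : Set Ω, MeasurableSet B → (∀ᵐ u ∂μ, c u ≤ K → u ∉ B) → μ B ≤ η := by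
  have hmono : Monotone fun K : ℕ => {u | c u ≤ K} := fun K K' h u (hu : c u ≤ K) =>
    hu.trans (Nat.cast_le.2 h)
  have hU : ⋃ K : ℕ, {u | c u ≤ K} = univ :=
    eq_univ_of_forall fun u => mem_iUnion.2 (exists_nat_ge (c u))
  have hlim := tendsto_measure_iUnion_atTop (μ := μ) hmono
  rw [hU, measure_univ] at hlim
  obtain ⟨K, hK⟩ := (hlim.eventually (lt_mem_nhds
    (ENNReal.sub_lt_self ENNReal.one_ne_top one_ne_zero hη))).exists
  refine ⟨K, fun B hB h => ?_⟩
  have hcompl : μ {u | c u ≤ K} ≤ μ Bᶜ := measure_mono_ae h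
  refine (ENNReal.add_le_add_iff_left (measure_ne_top μ {u | c u ≤ K})).1 ?_
  calc μ {u | c u ≤ K} + μ B ≤ μ Bᶜ + μ B := by gcongr
    _ = 1 := by rw [add_comm, prob_add_prob_compl hB]
    _ ≤ μ {u | c u ≤ K} + η := tsub_le_iff_right.1 hK.le

theorem exists_nat_lintegral_le {Ω : Type*} [MeasurableSpace Ω] (μ : Measure Ω)
    [IsProbabilityMeasure μ] (c : Ω → ℝ) {η : ℝ≥0∞} (hη : η ≠ 0) :
    ∃ K : ℕ, ∀ (g : Ω → ℝ≥0∞) (δ R : ℝ≥0∞), Measurable g → (∀ᵐ u ∂μ, g u ≤ R) →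
      (∀ᵐ u ∂μ, c u ≤ K → g u ≤ δ) → ∫⁻ u, g u ∂μ ≤ δ + R * η := by
  obtain ⟨K, hK⟩ := exists_nat_measure_le μ c hη
  refine ⟨K, fun g δ R hg hR hδ => ?_⟩
  have hB : MeasurableSet {u | δ < g u} := measurableSet_lt measurable_const hg
  have hle : ∀ᵐ u ∂μ, g u ≤ δ + {u | δ < g u}.indicator (fun _ => R) u := by
    filter_upwards [hR] with u hu
    by_cases h : δ < g u
    · exact le_add_left (hu.trans_eq (indicator_of_mem (s := {u | δ < g u}) h fun _ => R).symm)
    · exact le_add_right (not_lt.1 h)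
  calc ∫⁻ u, g u ∂μ
      ≤ ∫⁻ u, (δ + {u | δ < g u}.indicator (fun _ => R) u) ∂μ := lintegral_mono_ae hle
    _ = δ + R * μ {u | δ < g u} := by
        rw [lintegral_add_left measurable_const, lintegral_indicator_const hB, lintegral_const,
          measure_univ, mul_one]
    _ ≤ δ + R * η := by
        gcongr
        exact hK _ hB (hδ.mono fun u hu hc => not_lt.2 (hu hc))

end MarkovBounds

section TotalBoundedness

variable {T : ℝ}

section PiecewiseConstant

variable {Ω X : Type*} [MeasurableSpace Ω] [NormedAddCommGroup X] [MeasurableSpace X]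
  [BorelSpace X] [SecondCountableTopology X] [CompleteSpace X] {μ : Measure Ω} {D : ℝ≥0}

theorem W₁_map_le_mul_lintegral_add {p : Measure Ω} [IsProbabilityMeasure p]
    (hp : p ≤ (D : ℝ≥0∞) • μ) {f g : Ω → X} (hf : Measurable f) (hg : Measurable g)
    (q : Measure X) :
    W₁ (p.map f) q ≤ D * ∫⁻ ω, edist (f ω) (g ω) ∂μ + W₁ (p.map g) q := by
  have := Measure.isProbabilityMeasure_map (μ := p) hf.aemeasurable
  have := Measure.isProbabilityMeasure_map (μ := p) hg.aemeasurable
  have hle : ∫⁻ ω, edist (f ω) (g ω) ∂p ≤ D * ∫⁻ ω, edist (f ω) (g ω) ∂μ :=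
    (lintegral_mono' hp le_rfl).trans_eq (lintegral_smul_measure _ _)
  refine (W₁_triangle _ (p.map g) q).trans ?_
  gcongr
  exact (W₁_map_map_le p hf hg).trans hle

theorem lintegral_W₁_map_le {p : Time T → Measure Ω} (hprob : ∀ s, IsProbabilityMeasure (p s))
    (hp : ∀ s, p s ≤ (D : ℝ≥0∞) • μ) {f : Time T → Ω → X} (hf : ∀ s, Measurable (f s))
    {P : X → X} (hP : Measurable P) {τ : Time T → Time T} (hτ : ∀ s, p (τ s) = p s)
    {η ε : ℝ≥0∞} (hη : ∀ s, ∫⁻ ω, edist (P (f s ω)) (P (f (τ s) ω)) ∂μ ≤ η)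
    {q : Time T → Measure X}
    (hq : ∀ s, W₁ ((p (τ s)).map fun ω => P (f (τ s) ω)) (q (τ s)) ≤ ε) :
    ∫⁻ s, W₁ ((p s).map (f s)) (q (τ s)) ∂(lebT T) ≤
      D * ∫⁻ s, ∫⁻ ω, edist (f s ω) (P (f s ω)) ∂μ ∂(lebT T) +
        (D * η + ε) * ENNReal.ofReal T := by
  have hpt : ∀ s, W₁ ((p s).map (f s)) (q (τ s)) ≤
      D * ∫⁻ ω, edist (f s ω) (P (f s ω)) ∂μ + (D * η + ε) := fun s =>
    calc W₁ ((p s).map (f s)) (q (τ s))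
        ≤ D * ∫⁻ ω, edist (f s ω) (P (f s ω)) ∂μ + W₁ ((p s).map fun ω => P (f s ω)) (q (τ s)) :=
          W₁_map_le_mul_lintegral_add (hp s) (hf s) (hP.comp (hf s)) _
      _ ≤ D * ∫⁻ ω, edist (f s ω) (P (f s ω)) ∂μ +
          (D * ∫⁻ ω, edist (P (f s ω)) (P (f (τ s) ω)) ∂μ +
            W₁ ((p s).map fun ω => P (f (τ s) ω)) (q (τ s))) := by
          gcongr
          exact W₁_map_le_mul_lintegral_add (hp s) (hP.comp (hf s)) (hP.comp (hf (τ s))) _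
      _ ≤ D * ∫⁻ ω, edist (f s ω) (P (f s ω)) ∂μ + (D * η + ε) := by
          gcongr
          · exact hη s
          · exact hτ s ▸ hq s
  refine (lintegral_mono hpt).trans_eq ?_
  rw [lintegral_add_right _ measurable_const, lintegral_const, lebT_univ,
    lintegral_const_mul' _ _ ENNReal.coe_ne_top]

end PiecewiseConstant

theorem edist_le_mul_one_add {E : Type*} [SeminormedAddCommGroup E] {v w : E} {δ : ℝ≥0}
    {g : ℝ≥0∞} (h : ENNReal.ofReal (‖v - w‖ ^ 2) ≤ ENNReal.ofReal ((δ : ℝ) ^ 2) * g) :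
    edist v w ≤ δ * (1 + g) := by
  refine (ENNReal.pow_le_pow_left_iff two_ne_zero).1 ?_
  calc edist v w ^ 2 = ENNReal.ofReal (‖v - w‖ ^ 2) := by
        rw [edist_dist, dist_eq_norm, ENNReal.ofReal_pow (norm_nonneg _)]
    _ ≤ δ ^ 2 * g := by
        have hδ : ENNReal.ofReal ((δ : ℝ) ^ 2) = (δ : ℝ≥0∞) ^ 2 := by
          rw [ENNReal.ofReal_pow δ.coe_nonneg, ENNReal.ofReal_coe_nnreal]
        rwa [hδ] at h
    _ ≤ δ ^ 2 * (1 + g) ^ 2 := by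
        gcongr
        exact le_add_self.trans (le_self_pow₀ le_self_add two_ne_zero)
    _ = (δ * (1 + g)) ^ 2 := (mul_pow _ _ 2).symm

variable {n : ℕ} {prior : Measure (L2x n)}

theorem lintegral_lintegral_edist_le [IsProbabilityMeasure prior] {f : Time T → L2x n → L2x n}
    (hf : Measurable fun p : Time T × L2x n => f p.1 p.2) {E : ℝ≥0∞}
    (hE : ∀ᵐ u ∂prior, ∫⁻ s, gradNormSq (f s u) ∂(lebT T) ≤ E) {δ : ℝ≥0} {P : L2x n → L2x n}
    (hP : ∀ v, ENNReal.ofReal (‖v - P v‖ ^ 2) ≤ ENNReal.ofReal ((δ : ℝ) ^ 2) * gradNormSq v) :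
    ∫⁻ s, ∫⁻ u, edist (f s u) (P (f s u)) ∂prior ∂(lebT T) ≤ δ * (ENNReal.ofReal T + E) := by
  have hg : Measurable fun p : Time T × L2x n => gradNormSq (f p.1 p.2) :=
    measurable_gradNormSq.comp hf
  calc ∫⁻ s, ∫⁻ u, edist (f s u) (P (f s u)) ∂prior ∂(lebT T)
      ≤ ∫⁻ s, ∫⁻ u, δ * (1 + gradNormSq (f s u)) ∂prior ∂(lebT T) :=
        lintegral_mono fun s => lintegral_mono fun u => edist_le_mul_one_add (hP _)
    _ = δ * (ENNReal.ofReal T + ∫⁻ s, ∫⁻ u, gradNormSq (f s u) ∂prior ∂(lebT T)) := by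
        simp only [lintegral_const_mul' _ _ ENNReal.coe_ne_top, lintegral_add_left measurable_const,
          lintegral_const, measure_univ, mul_one, one_mul, lebT_univ]
    _ = δ * (ENNReal.ofReal T + ∫⁻ u, ∫⁻ s, gradNormSq (f s u) ∂(lebT T) ∂prior) := by
        rw [lintegral_lintegral_swap hg.aemeasurable]
    _ ≤ δ * (ENNReal.ofReal T + E) := by
        gcongr
        exact (lintegral_mono_ae hE).trans_eq (by simp)

variable {visc M : ℝ} {S : Set.Ioi (0 : ℝ) → Time T → L2x n → L2x n}

namespace ApproxSolutionOperators

variable (hS : ApproxSolutionOperators visc S) (hdiv : ∀ᵐ u ∂prior, DivFree u)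
  (hM : ∀ᵐ u ∂prior, ‖u‖ ≤ M)

include hS hdiv hM

theorem ae_norm_le : ∀ᵐ u ∂prior, ∀ Δ s, ‖S Δ s u‖ ≤ M := by
  filter_upwards [hdiv, hM] with u hu huM Δ s
  exact (hS.energy Δ s u hu).trans huM

theorem ae_lintegral_gradNormSq_le (hvisc : 0 ≤ visc) :
    ∀ᵐ u ∂prior, ∀ Δ,
      ∫⁻ s, gradNormSq (S Δ s u) ∂(lebT T) ≤ ENNReal.ofReal (visc⁻¹ * M ^ 2) := by
  filter_upwards [hdiv, hM] with u hu huM Δ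
  refine (hS.coercivity Δ u hu).trans ?_
  gcongr

theorem exists_time_step [IsProbabilityMeasure prior] {P : L2x n →L[ℝ] L2x n}
    (hPn : ∀ v, ‖P v‖ ≤ ‖v‖) (hPs : ∀ s : ℝ, ∃ C : ℝ≥0, ∀ v, ‖P v‖ₑ ≤ C * sobolevNorm s v)
    {δ : ℝ≥0} (hδ : 0 < δ) :
    ∃ h > 0, ∀ Δ (s s' : Time T), |(s : ℝ) - s'| ≤ h →
      ∫⁻ u, edist (P (S Δ s u)) (P (S Δ s' u)) ∂prior ≤ δ + ENNReal.ofReal (2 * M) * δ := by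
  obtain ⟨L, -, c, hc⟩ := hS.timeRegularity
  obtain ⟨C, hC⟩ := hPs (-L)
  obtain ⟨K, hK⟩ := exists_nat_lintegral_le prior (fun u => c ‖u‖)
    (η := (δ : ℝ≥0∞)) (ENNReal.coe_ne_zero.2 hδ.ne')
  refine ⟨δ / (C * K + 1), by positivity, fun Δ s s' hss' => hK _ _ _ ?_ ?_ ?_⟩
  · have hSs : ∀ s, Measurable (S Δ s) := fun s => (hS.measurable Δ).comp measurable_prodMk_left
    have hP : Measurable P := P.continuous.measurable
    exact (hP.comp (hSs s)).edist (hP.comp (hSs s'))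
  · filter_upwards [hS.ae_norm_le hdiv hM] with u hu
    rw [edist_dist]
    exact ENNReal.ofReal_le_ofReal (((dist_le_norm_add_norm _ _).trans
      (add_le_add ((hPn _).trans (hu Δ s)) ((hPn _).trans (hu Δ s')))).trans_eq (two_mul M).symm)
  · filter_upwards [hdiv] with u hu huK
    have hstep : (C : ℝ) * (K * (δ / (C * K + 1))) ≤ δ := by
      rw [← mul_assoc, mul_div_assoc', div_le_iff₀ (by positivity), mul_comm]
      gcongr
      exact le_add_of_nonneg_right zero_le_one
    calc edist (P (S Δ s u)) (P (S Δ s' u)) = ‖P (S Δ s u - S Δ s' u)‖ₑ := by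
          rw [map_sub, edist_eq_enorm_sub]
      _ ≤ C * ENNReal.ofReal (c ‖u‖ * |(s : ℝ) - s'|) := by
          refine (hC _).trans ?_
          gcongr
          exact hc Δ u hu s s'
      _ ≤ C * ENNReal.ofReal (K * (δ / (C * K + 1))) := by gcongr
      _ ≤ δ := by
          rw [← ENNReal.ofReal_coe_nnreal (p := C), ← ENNReal.ofReal_mul C.coe_nonneg,
            ← ENNReal.ofReal_coe_nnreal (p := δ)]
          exact ENNReal.ofReal_le_ofReal hstep

theorem totallyBounded_range [IsProbabilityMeasure prior] (hvisc : 0 ≤ visc) {ι : Type*} [Finite ι]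
    {t : ι → ℝ} (ht : ∀ j, 0 ≤ t j) {p : Set.Ioi (0 : ℝ) → Time T → Measure (L2x n)}
    (hprob : ∀ Δ s, IsProbabilityMeasure (p Δ s)) {D : ℝ≥0}
    (hp : ∀ Δ s, p Δ s ≤ (D : ℝ≥0∞) • prior)
    (hpt : ∀ Δ (s s' : Time T), (∀ j, t j ≤ s ↔ t j ≤ s') → p Δ s = p Δ s')
    {ν : Set.Ioi (0 : ℝ) → L1P T (L2x n)} (hν : ∀ Δ s, (ν Δ).meas s = (p Δ s).map (S Δ s)) :
    TotallyBounded (range ν) := by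
  refine EMetric.totallyBounded_iff.2 fun ε hε => ?_
  set E : ℝ≥0∞ := ENNReal.ofReal (visc⁻¹ * M ^ 2)
  set A : ℝ≥0∞ := D * (ENNReal.ofReal T + E) +
    (D * (1 + ENNReal.ofReal (2 * M)) + 1) * ENNReal.ofReal T with hA
  have hA_ne : A ≠ ∞ := by finiteness
  obtain ⟨δ, hδ, hδε⟩ := ENNReal.exists_nnreal_pos_mul_lt hA_ne hε.ne'
  have hδ' : (δ : ℝ≥0∞) ≠ 0 := ENNReal.coe_ne_zero.2 hδ.ne'
  obtain ⟨P, hPfin, hPn, hPg, hPs⟩ := exists_finiteRank_approx n (ε := (δ : ℝ) ^ 2) (by positivity)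
  obtain ⟨h, hh, hstep⟩ := hS.exists_time_step hdiv hM hPn hPs hδ
  obtain ⟨τ, hτh, hτt⟩ := exists_time_grid ht hh
  have hK := isCompact_mem_and_norm_le P.range M
  obtain ⟨Q, hQfin, hQ, hnet⟩ := exists_finite_W₁_net hK hδ'
  obtain ⟨F, hF, hFQ⟩ := exists_finite_L1P_net τ hQfin (fun q hq => (hQ q hq).1)
    fun q hq => (hQ q hq).2
  have hSs : ∀ Δ s, Measurable (S Δ s) := fun Δ s => (hS.measurable Δ).comp measurable_prodMk_left
  have hP : Measurable P := P.continuous.measurable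
  have hPS : ∀ Δ s, Measurable fun u => P (S Δ s u) := fun Δ s => hP.comp (hSs Δ s)
  refine ⟨F, hF, ?_⟩
  rintro _ ⟨Δ, rfl⟩
  have hnear : ∀ s, ∃ q ∈ Q, W₁ ((p Δ s).map fun u => P (S Δ s u)) q ≤ δ := fun s => by
    have := Measure.isProbabilityMeasure_map (μ := p Δ s) (hPS Δ s).aemeasurable
    refine hnet _ ((ae_map_iff (hPS Δ s).aemeasurable hK.measurableSet).2 ?_)
    filter_upwards [(Measure.absolutelyContinuous_of_le_smul (hp Δ s)).ae_le
      (hS.ae_norm_le hdiv hM)] with u hu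
    exact ⟨⟨_, rfl⟩, (hPn _).trans (hu Δ s)⟩
  choose q hqQ hq using hnear
  obtain ⟨ν', hν', hν'q⟩ := hFQ q hqQ
  refine mem_iUnion₂.2 ⟨ν', hν', lt_of_le_of_lt ?_ hδε⟩
  have hspace := lintegral_lintegral_edist_le (hS.measurable Δ)
    ((hS.ae_lintegral_gradNormSq_le hdiv hM hvisc).mono fun u hu => hu Δ) hPg
  calc edist (ν Δ) ν' = ∫⁻ s, W₁ ((p Δ s).map (S Δ s)) (q (τ s)) ∂(lebT T) := by
        simp only [L1P.edist_def, hν, hν'q]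
    _ ≤ D * (δ * (ENNReal.ofReal T + E)) +
        (D * (δ + ENNReal.ofReal (2 * M) * δ) + δ) * ENNReal.ofReal T := by
        refine (lintegral_W₁_map_le (hprob Δ) (hp Δ) (hSs Δ) hP
          (fun s => (hpt Δ _ _ (hτt s)).symm) (fun s => hstep Δ s _ (hτh s))
          fun s => hq (τ s)).trans ?_
        gcongr
    _ = δ * A := by rw [hA]; ring

end ApproxSolutionOperators

end TotalBoundedness

section LocallyUniformConvergence

variable {Y Z : Type*} [PseudoEMetricSpace Z]

theorem tendsto_iSup_edist [TopologicalSpace Y] {ι : Type*} {l : Filter ι} {F : ι → C(Y, Z)}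
    {f : C(Y, Z)} (h : Tendsto F l (𝓝 f)) {K : Set Y} (hK : IsCompact K) :
    Tendsto (fun i => ⨆ y ∈ K, edist (F i y) (f y)) l (𝓝 0) := by
  refine ENNReal.tendsto_nhds_zero.2 fun ε hε => ?_
  filter_upwards [EMetric.tendstoUniformlyOn_iff.1
    (ContinuousMap.tendsto_iff_forall_isCompact_tendstoUniformlyOn.1 h K hK) ε hε] with i hi
  exact iSup₂_le fun y hy => (edist_comm _ _).trans_le (hi y hy).le

theorem tendsto_of_tendsto_iSup_edist {ι : Type*} {l : Filter ι} {F : ι → Y → Z} {f : Y → Z}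
    {K : Set Y} (h : Tendsto (fun i => ⨆ y ∈ K, edist (F i y) (f y)) l (𝓝 0)) {y : Y}
    (hy : y ∈ K) : Tendsto (fun i => F i y) l (𝓝 (f y)) :=
  tendsto_iff_edist_tendsto_0.2 <| tendsto_of_tendsto_of_tendsto_of_le_of_le tendsto_const_nhds h
    (fun _ => zero_le) fun i => le_iSup₂ (f := fun y _ => edist (F i y) (f y)) y hy

theorem exists_subseq_tendsto_iSup_edist [TopologicalSpace Y] [WeaklyLocallyCompactSpace Y]
    [SigmaCompactSpace Y] {ι : Type*} {F : ι → C(Y, Z)} (hF : IsCompact (closure (range F)))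
    (u : ℕ → ι) :
    ∃ φ : ℕ → ℕ, StrictMono φ ∧ ∃ f : C(Y, Z), ∀ K : Set Y, IsCompact K →
      Tendsto (fun k => ⨆ y ∈ K, edist (F (u (φ k)) y) (f y)) atTop (𝓝 0) := by
  obtain ⟨f, -, φ, hφ, hlim⟩ :=
    hF.tendsto_subseq fun k => subset_closure (mem_range_self (u k))
  exact ⟨φ, hφ, f, fun K hK => tendsto_iSup_edist hlim hK⟩

end LocallyUniformConvergence

section FilteringCompactness

variable {T : ℝ} {n d N : ℕ} {Γ : Matrix (Fin d) (Fin d) ℝ}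

/-- The modulus of continuity `C(max(|y|_Γ, |y'|_Γ)) |y - y'|_Γ`, which expresses the local
Lipschitz bounds with constants `C R` on the balls `|y|_Γ ≤ R` by a single function. -/
noncomputable def gammaModulus (Γ : Matrix (Fin d) (Fin d) ℝ) (C : ℝ → ℝ)
    (y y' : Fin N → EuclideanSpace ℝ (Fin d)) : ℝ≥0∞ :=
  ENNReal.ofReal (C (max (gammaNormN Γ y) (gammaNormN Γ y')) * gammaNormN Γ (y - y'))

theorem continuous_uncurry_gammaModulus (hΓ : Γ.PosDef) {C : ℝ → ℝ} (hC : Continuous C) :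
    Continuous (Function.uncurry (gammaModulus (N := N) Γ C)) := by
  have hγ := continuous_gammaNormN (N := N) hΓ
  exact ENNReal.continuous_ofReal.comp <|
    (hC.comp <| (hγ.comp continuous_fst).max (hγ.comp continuous_snd)).mul
      (hγ.comp (continuous_fst.sub continuous_snd))

theorem gammaModulus_self (Γ : Matrix (Fin d) (Fin d) ℝ) (C : ℝ → ℝ)
    (y : Fin N → EuclideanSpace ℝ (Fin d)) : gammaModulus Γ C y y = 0 := by
  simp [gammaModulus, gammaNormN, gammaNorm]

theorem gammaModulus_le {C : ℝ → ℝ} (hC : Monotone C) {R : ℝ}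
    {y y' : Fin N → EuclideanSpace ℝ (Fin d)} (hy : gammaNormN Γ y ≤ R)
    (hy' : gammaNormN Γ y' ≤ R) :
    gammaModulus Γ C y y' ≤ ENNReal.ofReal (C R * gammaNormN Γ (y - y')) :=
  ENNReal.ofReal_le_ofReal <|
    mul_le_mul_of_nonneg_right (hC (max_le hy hy')) (gammaNormN_nonneg Γ _)

variable {ρ : EuclideanSpace ℝ (Fin d) → ℝ} {t : Fin (N + 1) → ℝ}
  {G : Fin N → PathSpace T n → EuclideanSpace ℝ (Fin d)} {prior : Measure (L2x n)}
  {C : ℝ → ℝ} {D : ℝ → ℝ≥0} {M : ℝ}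

theorem posterior_congr_time {S : Time T → L2x n → L2x n}
    {y : Fin N → EuclideanSpace ℝ (Fin d)} {s s' : Time T} (h : ∀ j, t j ≤ s ↔ t j ≤ s') :
    posterior ρ t G S prior y s = posterior ρ t G S prior y s' := by
  have hlik : likelihood ρ t G S y s = likelihood ρ t G S y s' := by
    ext u
    simp only [likelihood, h]
  simp only [posterior, hlik]

namespace FilteringEstimates

theorem W₁_le_gammaModulus {S : Time T → L2x n → L2x n}
    (h : FilteringEstimates Γ ρ t G S prior C D) (y y' : Fin N → EuclideanSpace ℝ (Fin d))
    (s : Time T) :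
    W₁ (filtering ρ t G S prior y s) (filtering ρ t G S prior y' s) ≤ gammaModulus Γ C y y' :=
  h.W₁_le _ y y' s (le_max_left _ _) (le_max_right _ _)

theorem exists_L1P_filtering {S : Time T → L2x n → L2x n}
    (h : FilteringEstimates Γ ρ t G S prior C D)
    (hS : Measurable fun p : Time T × L2x n => S p.1 p.2)
    (hM : ∀ᵐ u ∂prior, ∀ s, ‖S s u‖ ≤ M) (y : Fin N → EuclideanSpace ℝ (Fin d)) :
    ∃ ν : L1P T (L2x n), ∀ s, ν.meas s = filtering ρ t G S prior y s := by
  have hSs : ∀ s, Measurable (S s) := fun s => hS.comp measurable_prodMk_left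
  have := h.isProbabilityMeasure_posterior y
  have hmoment : ∀ s, ∫⁻ u, ‖u‖ₑ ∂(filtering ρ t G S prior y s) ≤ ENNReal.ofReal M := fun s => by
    have hbound : ∀ᵐ u ∂(posterior ρ t G S prior y s), ‖S s u‖ₑ ≤ ENNReal.ofReal M := by
      filter_upwards [(Measure.absolutelyContinuous_of_le_smul
        (h.posterior_le _ y s le_rfl)).ae_le hM] with u hu
      exact (ofReal_norm _).symm.trans_le (ENNReal.ofReal_le_ofReal (hu s))
    rw [filtering, lintegral_map (by fun_prop) (hSs s)]
    exact (lintegral_mono_ae hbound).trans_eq (by simp)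
  refine ⟨L1P.ofMeasurable _
    (fun s => Measure.isProbabilityMeasure_map (hSs s).aemeasurable) (h.measurable_filtering y)
    (fun s => (hmoment s).trans_lt ENNReal.ofReal_lt_top)
    ((lintegral_mono hmoment).trans_lt ?_), fun s => rfl⟩
  rw [lintegral_const, lebT_univ]
  finiteness

theorem exists_equicontinuous_filtering (hΓ : Γ.PosDef) (hC : Continuous C) {ι : Type*}
    {S : ι → Time T → L2x n → L2x n} (h : ∀ i, FilteringEstimates Γ ρ t G (S i) prior C D)
    (hS : ∀ i, Measurable fun p : Time T × L2x n => S i p.1 p.2)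
    (hM : ∀ᵐ u ∂prior, ∀ i s, ‖S i s u‖ ≤ M) :
    ∃ F : ι → C(Fin N → EuclideanSpace ℝ (Fin d), L1P T (L2x n)),
      (∀ i y s, (F i y).meas s = filtering ρ t G (S i) prior y s) ∧
        Equicontinuous fun i => ⇑(F i) := by
  choose F hF using fun i y =>
    (h i).exists_L1P_filtering (hS i) (hM.mono fun u hu => hu i) y
  have hequi : Equicontinuous F :=
    L1P.equicontinuous_of_W₁_le (continuous_uncurry_gammaModulus hΓ hC) (gammaModulus_self Γ C) F
      fun i y y' s => by simpa only [hF] using (h i).W₁_le_gammaModulus y y' s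
  exact ⟨fun i => ⟨F i, hequi.continuous i⟩, hF, hequi⟩

end FilteringEstimates

theorem ApproxSolutionOperators.exists_compact_filtering [IsProbabilityMeasure prior] {visc : ℝ}
    {S : Set.Ioi (0 : ℝ) → Time T → L2x n → L2x n} (hS : ApproxSolutionOperators visc S)
    (hvisc : 0 ≤ visc) (hdiv : ∀ᵐ u ∂prior, DivFree u) (hM : ∀ᵐ u ∂prior, ‖u‖ ≤ M)
    (hΓ : Γ.PosDef) (hC : Continuous C)
    (h : ∀ Δ, FilteringEstimates Γ ρ t G (S Δ) prior C D) (ht : ∀ j, 0 ≤ t j) :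
    ∃ F : Set.Ioi (0 : ℝ) → C(Fin N → EuclideanSpace ℝ (Fin d), L1P T (L2x n)),
      (∀ Δ y s, (F Δ y).meas s = filtering ρ t G (S Δ) prior y s) ∧
        IsCompact (closure (range F)) := by
  obtain ⟨F, hF, hequi⟩ := FilteringEstimates.exists_equicontinuous_filtering hΓ hC h hS.measurable
    (hS.ae_norm_le hdiv hM)
  refine ⟨F, hF, isCompact_closure_range_of_equicontinuous F hequi fun y => ?_⟩
  exact hS.totallyBounded_range hdiv hM hvisc ht
    (fun Δ s => (h Δ).isProbabilityMeasure_posterior y s)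
    (fun Δ s => (h Δ).posterior_le _ y s le_rfl) (fun Δ s s' => posterior_congr_time)
    fun Δ s => hF Δ y s

end FilteringCompactness

end FilteringNS

theorem mainTheorem3 {d N : ℕ} (Γ : Matrix (Fin d) (Fin d) ℝ) (hΓ : Γ.PosDef)
    (ρ : EuclideanSpace ℝ (Fin d) → ℝ) (hρ : IsNoiseDensity Γ ρ)
    (T : ℝ) (hT : 0 < T) (L_G g₀ : ℝ) :
    ∃ C : ℝ → ℝ → ℝ, (∀ R M, 0 < C R M) ∧
      ∀ (n : ℕ) (t : Fin (N + 1) → ℝ), StrictMono t → t 0 = 0 → t (Fin.last N) = T →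
      ∀ G : Fin N → PathSpace T n → EuclideanSpace ℝ (Fin d),
        LipschitzObservables t G L_G → (∀ j, ‖G j 0‖ ≤ g₀) →
      ∀ (prior : Measure (L2x n)) [IsProbabilityMeasure prior] (M : ℝ), 0 < M →
        prior {u | ‖u‖ ≤ M} = 1 → (∀ᵐ u ∂prior, DivFree u) →
      ∀ visc : ℝ, 0 < visc →
      ∀ S : Set.Ioi (0 : ℝ) → Time T → L2x n → L2x n, ApproxSolutionOperators visc S →
      (∃ F : Set.Ioi (0 : ℝ) → C(Fin N → EuclideanSpace ℝ (Fin d), L1P T (L2x n)),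
        (∀ Δ y s, (F Δ y).meas s = filtering ρ t G (S Δ) prior y s) ∧
        IsCompact (closure (Set.range F))) ∧
      (∀ R, 0 < R → ∀ Δ y y', gammaNormN Γ y ≤ R → gammaNormN Γ y' ≤ R → ∀ s,
        W₁ (filtering ρ t G (S Δ) prior y s) (filtering ρ t G (S Δ) prior y' s) ≤
          ENNReal.ofReal (C R M * gammaNormN Γ (y - y'))) ∧
      (∀ Δ : ℕ → Set.Ioi (0 : ℝ), Tendsto (fun k => (Δ k : ℝ)) atTop (𝓝 0) →
        ∃ φ : ℕ → ℕ, StrictMono φ ∧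
        ∃ νlim : C(Fin N → EuclideanSpace ℝ (Fin d), L1P T (L2x n)), ∀ R, 0 < R →
          Tendsto (fun k => ⨆ (y) (_ : gammaNormN Γ y ≤ R),
            ∫⁻ s, W₁ (filtering ρ t G (S (Δ (φ k))) prior y s) ((νlim y).meas s) ∂(lebT T))
            atTop (𝓝 0)) ∧
      (∀ Δ : ℕ → Set.Ioi (0 : ℝ), Tendsto (fun k => (Δ k : ℝ)) atTop (𝓝 0) →
        ∀ νlim : (Fin N → EuclideanSpace ℝ (Fin d)) → L1P T (L2x n),
        (∀ R, 0 < R →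
          Tendsto (fun k => ⨆ (y) (_ : gammaNormN Γ y ≤ R),
            ∫⁻ s, W₁ (filtering ρ t G (S (Δ k)) prior y s) ((νlim y).meas s) ∂(lebT T))
            atTop (𝓝 0)) →
        ∃ νver : (Fin N → EuclideanSpace ℝ (Fin d)) → L1P T (L2x n),
          (∀ y, ∀ᵐ s ∂(lebT T), (νver y).meas s = (νlim y).meas s) ∧
          ∀ R, 0 < R → ∀ y y', gammaNormN Γ y ≤ R → gammaNormN Γ y' ≤ R → ∀ s,
            W₁ ((νver y).meas s) ((νver y').meas s) ≤
              ENNReal.ofReal (C R M * gammaNormN Γ (y - y'))) := by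
  obtain ⟨C, D, hC_pos, hC_cont, hC_mono, hest⟩ :=
    exists_filteringEstimates hΓ hρ hT.le N L_G g₀
  refine ⟨C, hC_pos, fun n t ht ht0 _ G hG hg prior _ M _ hM hdiv visc hvisc S hS => ?_⟩
  replace hM : ∀ᵐ u ∂prior, ‖u‖ ≤ M :=
    (mem_ae_iff_prob_eq_one (measurableSet_le measurable_norm measurable_const)).2 hM
  have h : ∀ Δ, FilteringEstimates Γ ρ t G (S Δ) prior (C · M) (D · M) := fun Δ =>
    hest n t G hG hg prior M (S Δ) (hS.measurable Δ)
      ((hS.ae_norm_le hdiv hM).mono fun u hu => hu Δ)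
  obtain ⟨F, hF, hF_compact⟩ := hS.exists_compact_filtering hvisc.le hdiv hM hΓ (hC_cont M) h
    fun j => ht0 ▸ ht.monotone (Fin.zero_le j)
  refine ⟨⟨F, hF, hF_compact⟩, fun R _ Δ y y' hy hy' s => (h Δ).W₁_le R y y' s hy hy',
    fun Δ _ => ?_, fun Δ _ νlim hlim => ?_⟩
  · obtain ⟨φ, hφ, νlim, hlim⟩ := exists_subseq_tendsto_iSup_edist hF_compact Δ
    refine ⟨φ, hφ, νlim, fun R _ => ?_⟩
    simpa only [L1P.edist_def, hF] using! hlim _ (isCompact_gammaNormN_le hΓ R)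
  · have htend : ∀ y, Tendsto (fun k => F (Δ k) y) atTop (𝓝 (νlim y)) := fun y =>
      tendsto_of_tendsto_iSup_edist (K := {x | gammaNormN Γ x ≤ gammaNormN Γ y + 1})
        (by simpa only [L1P.edist_def, hF] using!
          hlim _ (add_pos_of_nonneg_of_pos (gammaNormN_nonneg Γ y) one_pos)) (by simp)
    obtain ⟨νver, hver, hW⟩ := L1P.exists_modification_of_tendsto
      (continuous_uncurry_gammaModulus hΓ (hC_cont M)) (gammaModulus_self Γ _)
      (fun k y y' s => by simpa only [hF] using (h (Δ k)).W₁_le_gammaModulus y y' s) htend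
    exact ⟨νver, hver,
      fun R _ y y' hy hy' s => (hW y y' s).trans (gammaModulus_le (hC_mono M) hy hy')⟩
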